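/- Let $M$ be a Riemannian manifold (smooth, Hausdorff, second countable, without boundary), let $\Lambda^*(M)$ be the graded algebra of smooth real differential forms on $M$, and let $\omega\in\Lambda^k(M)$ be a $k$-form with $\nabla\omega=0$, where $\nabla$ is the Levi-Civita connection. Let $C$ be the structure operator of $(M,\omega)$: the $C^\infty(M)$-linear graded derivation of $\Lambda^*(M)$, of the parity of $k$, that vanishes on functions and maps each 1-form $\nu$ to the interior product $\nu^\sharp\lrcorner\,\omega$, where $\nu^\sharp$ is the vector field dual to $\nu$. For operators $A,B$ on $\Lambda^*(M)$ of parities $\tilde A,\tilde B$ let $\{A,B\}=AB-(-1)^{\tilde A\tilde B}BA$ be their supercommutator. Here $d$ and $d^*$ are odd, $L_\omega:\eta\mapsto\omega\wedge\eta$ and $\Lambda_\omega$ have the parity of $k$, and the twisted de Rham operator $d_c=\{d,C\}=dC-(-1)^kCd$ and $d_c^*$ have the parity of $k+1$. Here $d^*$, $d_c^*$ and $\Lambda_\omega$ denote the adjoints of $d$, $d_c$ and $L_\omega$ with respect to $(\alpha,\beta)=\int_M\langle\alpha,\beta\rangle\,d\mathrm{vol}$; that is, $(P\alpha,\beta)=(\alpha,P^*\beta)$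 for all smooth forms $\alpha,\beta$ at least one of which has compact support. Then these adjoints exist, and: (i) $\{d,d_c\}=0$, $\{d,d_c^*\}=0$, $\{d^*,d_c\}=0$, $\{d^*,d_c^*\}=0$. (ii) The Laplacian $\Delta=\{d,d^*\}=dd^*+d^*d$ commutes with $L_\omega$ and with $\Lambda_\omega$. (iii) Put $\Delta_c=\{d_c,d_c^*\}$, so that $\Delta_c=d_cd_c^*+d_c^*d_c$ if $k$ is even and $\Delta_c=d_cd_c^*-d_c^*d_c$ if $k$ is odd, and put $H_\omega=\{L_\omega,\Lambda_\omega\}$. Then $$\Delta_c=\{d^*,[H_\omega,d]\}.$$ -/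

import Mathlib

open scoped Manifold ContDiff
open MeasureTheory
noncomputable section
namespace ParallelForm

section Algebra
variable {V W : Type*} [AddCommGroup V] [Module ℝ V] [AddCommGroup W] [Module ℝ W]

/-- The exterior algebra `Λ^*V^*` of the dual space; its product is the wedge product. -/
abbrev Ext (V : Type*) [AddCommGroup V] [Module ℝ V] : Type _ :=
  ExteriorAlgebra ℝ (Module.Dual ℝ V)

/-- A covector, viewed as an element of degree one of `Λ^*V^*`. -/
abbrev covec : Module.Dual ℝ V →ₗ[ℝ] Ext V := ExteriorAlgebra.ι ℝ

/-- Interior product `v ↦ (a ↦ a(v, ·, …, ·))`. -/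
def interior : V →ₗ[ℝ] Module.End ℝ (Ext V) :=
  (CliffordAlgebra.contractLeft (Q := (0 : QuadraticForm ℝ (Module.Dual ℝ V)))) ∘ₗ
    Module.Dual.eval ℝ V

/-- Pull-back of exterior forms along a linear map. -/
def pullback (A : V →ₗ[ℝ] W) : Ext W →ₐ[ℝ] Ext V := ExteriorAlgebra.map A.dualMap

theorem interior_one (v : V) : interior v (1 : Ext V) = 0 :=
  CliffordAlgebra.contractLeft_one (Q := (0 : QuadraticForm ℝ (Module.Dual ℝ V)))
    (Module.Dual.eval ℝ V v)

theorem interior_covec_mul (v : V) (ξ : Module.Dual ℝ V) (a : Ext V) :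
    interior v (covec ξ * a) = ξ v • a - covec ξ * interior v a :=
  CliffordAlgebra.contractLeft_ι_mul _ _ _

theorem pullback_comp {U : Type*} [AddCommGroup U] [Module ℝ U] (A : V →ₗ[ℝ] W) (B : U →ₗ[ℝ] V)
    (a : Ext W) : pullback (A ∘ₗ B) a = pullback B (pullback A a) := by
  have := ExteriorAlgebra.map_comp_map (R := ℝ) A.dualMap B.dualMap
  exact (DFunLike.congr_fun this a).symm

theorem pullback_id (a : Ext V) : pullback (LinearMap.id : V →ₗ[ℝ] V) a = a := by
  have : (LinearMap.id : V →ₗ[ℝ] V).dualMap = LinearMap.id := LinearMap.dualMap_id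
  rw [pullback, this, ExteriorAlgebra.map_id]; rfl

theorem pullback_covec (A : V →ₗ[ℝ] W) (ξ : Module.Dual ℝ W) :
    pullback A (covec ξ) = covec (A.dualMap ξ) := ExteriorAlgebra.map_apply_ι _ _

theorem covec_induction {P : Ext V → Prop} (a : Ext V) (h1 : P 1)
    (hadd : ∀ a b, P a → P b → P (a + b)) (hsmul : ∀ (r : ℝ) a, P a → P (r • a))
    (hmul : ∀ ξ a, P a → P (covec ξ * a)) : P a := by
  refine CliffordAlgebra.left_induction (Q := (0 : QuadraticForm ℝ (Module.Dual ℝ V))) (P := P)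
    (fun r => ?_) hadd (fun m x hx => hmul x m hx) a
  rw [Algebra.algebraMap_eq_smul_one]
  exact hsmul r 1 h1

theorem interior_pullback (A : V →ₗ[ℝ] W) (v : V) (a : Ext W) :
    interior v (pullback A a) = pullback A (interior (A v) a) := by
  induction a using covec_induction with
  | h1 => simp [interior_one]
  | hadd a b ha hb => simp [ha, hb]
  | hsmul r a ha => simp [ha]
  | hmul ξ a ha =>
    rw [map_mul, pullback_covec, interior_covec_mul, interior_covec_mul, ha]
    simp [pullback_covec]

theorem covec_mul_eq (ξ : Module.Dual ℝ V) (a : Ext V) :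
    covec ξ * a = CliffordAlgebra.involute a * covec ξ := by
  induction a using covec_induction with
  | h1 => simp
  | hadd a b ha hb => simp [mul_add, add_mul, ha, hb]
  | hsmul r a ha => simp [ha]
  | hmul η a ha =>
    have h : covec ξ * covec η = - (covec η * covec ξ) :=
      eq_neg_of_add_eq_zero_left (ExteriorAlgebra.ι_add_mul_swap ξ η)
    have h2 : CliffordAlgebra.involute (covec η : Ext V) = - covec η :=
      CliffordAlgebra.involute_ι _
    rw [← mul_assoc, h, map_mul, h2, neg_mul, mul_assoc, ha]
    simp [mul_assoc]

/-- The `ℝ`-linear extension of `p : V^* → Λ^*V^*` to `Λ^*V^*`, `a ↦ ∑ᵢ p(eⁱ) ∧ (e_i ⌟ a)`.  See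
`extendDerivation_covec`, `extendDerivation_mul`: it is the (unique) graded derivation that
extends `p`. -/
def extendDerivation [FiniteDimensional ℝ V] (p : Module.Dual ℝ V →ₗ[ℝ] Ext V) :
    Module.End ℝ (Ext V) :=
  ∑ i, LinearMap.mulLeft ℝ (p ((Module.finBasis ℝ V).coord i)) ∘ₗ
    interior (Module.finBasis ℝ V i)

theorem extendDerivation_apply [FiniteDimensional ℝ V] {I : Type*} [Fintype I]
    (b : Module.Basis I ℝ V) (p : Module.Dual ℝ V →ₗ[ℝ] Ext V) (a : Ext V) :
    extendDerivation p a = ∑ i, p (b.coord i) * interior (b i) a := by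
  classical
  set f := Module.finBasis ℝ V
  have h1 : ∀ j, f j = ∑ i, b.coord i (f j) • b i := fun j => (b.sum_repr (f j)).symm
  have h2 : ∀ i, b.coord i = ∑ j, b.coord i (f j) • f.coord j := by
    intro i
    refine f.ext fun j => ?_
    simp [Finsupp.single_apply, Finset.sum_ite_eq, Module.Basis.coord_apply]
  calc extendDerivation p a = ∑ j, p (f.coord j) * interior (f j) a := by
        simp [extendDerivation, f]
    _ = ∑ j, ∑ i, b.coord i (f j) • (p (f.coord j) * interior (b i) a) := by
        refine Finset.sum_congr rfl fun j _ => ?_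
        conv_lhs => rw [h1 j]
        simp only [map_sum, map_smul, LinearMap.sum_apply, LinearMap.smul_apply, Finset.mul_sum,
          mul_smul_comm]
    _ = ∑ i, p (b.coord i) * interior (b i) a := by
        rw [Finset.sum_comm]
        refine Finset.sum_congr rfl fun i _ => ?_
        conv_rhs => rw [h2 i]
        simp only [map_sum, map_smul, Finset.sum_mul, smul_mul_assoc]

theorem extendDerivation_one [FiniteDimensional ℝ V] (p : Module.Dual ℝ V →ₗ[ℝ] Ext V) :
    extendDerivation p 1 = 0 := by
  simp [extendDerivation, interior_one]

theorem extendDerivation_covec [FiniteDimensional ℝ V] (p : Module.Dual ℝ V →ₗ[ℝ] Ext V)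
    (ξ : Module.Dual ℝ V) : extendDerivation p (covec ξ) = p ξ := by
  set f := Module.finBasis ℝ V
  have h2 : ξ = ∑ j, ξ (f j) • f.coord j := by
    refine f.ext fun j => ?_
    simp
  have h3 : ∀ v, interior v (covec ξ) = ξ v • (1 : Ext V) := by
    intro v
    have := interior_covec_mul v ξ 1
    simpa [interior_one] using this
  rw [extendDerivation_apply f]
  conv_rhs => rw [h2]
  simp only [h3, map_sum, map_smul, mul_smul_comm, mul_one]

theorem interior_mul (v : V) (a b : Ext V) :
    interior v (a * b) = interior v a * b + CliffordAlgebra.involute a * interior v b := by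
  induction a using covec_induction with
  | h1 => simp [interior_one]
  | hadd a a' ha ha' => simp [add_mul, ha, ha']; abel
  | hsmul r a ha => simp [ha]
  | hmul ξ a ha =>
    have h2 : CliffordAlgebra.involute (covec ξ : Ext V) = - covec ξ :=
      CliffordAlgebra.involute_ι _
    rw [mul_assoc, interior_covec_mul, ha, interior_covec_mul, map_mul, h2]
    simp [mul_add, sub_mul, mul_assoc]; abel

/-- The graded Leibniz rule.  If `p` has values in degree `r` (so that its extension has the
parity of `r + 1`), then `ρ(a ∧ b) = ρ(a) ∧ b + (-1)^{(r+1) deg a} a ∧ ρ(b)`. -/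
theorem extendDerivation_mul [FiniteDimensional ℝ V] (p : Module.Dual ℝ V →ₗ[ℝ] Ext V) {r m : ℕ}
    (hp : ∀ ξ, p ξ ∈ ⋀[ℝ]^r (Module.Dual ℝ V)) {a : Ext V} (ha : a ∈ ⋀[ℝ]^m (Module.Dual ℝ V))
    (b : Ext V) :
    extendDerivation p (a * b) =
      extendDerivation p a * b + (-1 : ℝ) ^ ((r + 1) * m) • (a * extendDerivation p b) := by
  have hinv : ∀ (m : ℕ) (a : Ext V), a ∈ ⋀[ℝ]^m (Module.Dual ℝ V) →
      CliffordAlgebra.involute a = (-1 : ℝ) ^ m • a := by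
    intro m
    induction m with
    | zero =>
      intro a ha
      simp only [ExteriorAlgebra.exteriorPower, pow_zero, Submodule.mem_one] at ha
      obtain ⟨t, rfl⟩ := ha
      simp
    | succ m ih =>
      intro a ha
      simp only [ExteriorAlgebra.exteriorPower, pow_succ'] at ha
      refine Submodule.mul_induction_on ha ?_ ?_
      · rintro _ ⟨ξ, rfl⟩ y hy
        have h2 : CliffordAlgebra.involute (covec ξ : Ext V) = - covec ξ :=
          CliffordAlgebra.involute_ι _
        rw [map_mul, h2, ih y hy, pow_succ]; simp
      · intro x y hx hy; simp [hx, hy]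
  have hcomm : ∀ (r m : ℕ) (a b : Ext V), a ∈ ⋀[ℝ]^r (Module.Dual ℝ V) →
      b ∈ ⋀[ℝ]^m (Module.Dual ℝ V) → a * b = (-1 : ℝ) ^ (r * m) • (b * a) := by
    intro r m
    induction r with
    | zero =>
      intro a b ha hb
      simp only [ExteriorAlgebra.exteriorPower, pow_zero, Submodule.mem_one] at ha
      obtain ⟨t, rfl⟩ := ha
      simp [Algebra.commutes]
    | succ r ih =>
      intro a b ha hb
      simp only [ExteriorAlgebra.exteriorPower, pow_succ'] at ha
      refine Submodule.mul_induction_on ha ?_ ?_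
      · rintro _ ⟨ξ, rfl⟩ y hy
        have h3 : ExteriorAlgebra.ι ℝ ξ * b = CliffordAlgebra.involute b * ExteriorAlgebra.ι ℝ ξ :=
          covec_mul_eq ξ b
        rw [mul_assoc, ih y b hy hb, mul_smul_comm, ← mul_assoc, h3, hinv m b hb, add_mul, pow_add]
        simp [mul_assoc, smul_smul]
      · intro x y hx hy; simp [add_mul, mul_add, hx, hy]
  simp only [extendDerivation_apply (Module.finBasis ℝ V), Finset.sum_mul, Finset.mul_sum,
    Finset.smul_sum, ← Finset.sum_add_distrib]
  refine Finset.sum_congr rfl fun i _ => ?_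
  rw [interior_mul, hinv m a ha, mul_add, ← mul_assoc, smul_mul_assoc, mul_smul_comm, ← mul_assoc,
    hcomm r m _ a (hp _) ha, smul_mul_assoc, smul_smul, mul_assoc a, ← pow_add]
  congr 3
  ring

/-- The operator `a ↦ (♯ξ₁ ⌟ ·) ⋯ (♯ξᵣ ⌟ ·)` for `a = ξ₁ ∧ ⋯ ∧ ξᵣ`. -/
def contraction (S : Module.Dual ℝ V →ₗ[ℝ] V) : Ext V →ₐ[ℝ] Module.End ℝ (Ext V) :=
  ExteriorAlgebra.lift ℝ ⟨interior ∘ₗ S, fun _ =>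
    LinearMap.ext fun a => CliffordAlgebra.contractLeft_contractLeft _ a⟩

/-- The inner product on `Λ^*V^*` induced by an inner product on `V` with musical isomorphism
`S = ♯`; different degrees are orthogonal, and
`⟨ξ₁ ∧ ⋯ ∧ ξᵣ, η₁ ∧ ⋯ ∧ ηᵣ⟩ = det (⟨ξᵢ, ηⱼ⟩)`. -/
def extInner (S : Module.Dual ℝ V →ₗ[ℝ] V) (a b : Ext V) : ℝ :=
  ExteriorAlgebra.algebraMapInv (contraction S (CliffordAlgebra.reverse a) b)

theorem extInner_one_one (S : Module.Dual ℝ V →ₗ[ℝ] V) : extInner S 1 1 = 1 := by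
  simp [extInner]

theorem extInner_one_covec_mul (S : Module.Dual ℝ V →ₗ[ℝ] V) (ξ : Module.Dual ℝ V) (a : Ext V) :
    extInner S 1 (covec ξ * a) = 0 := by
  simp [extInner, ExteriorAlgebra.algebraMapInv]

theorem extInner_covec_mul (S : Module.Dual ℝ V →ₗ[ℝ] V) (ξ : Module.Dual ℝ V) (a b : Ext V) :
    extInner S (covec ξ * a) b = extInner S a (interior (S ξ) b) := by
  have h : CliffordAlgebra.reverse (covec ξ : Ext V) = covec ξ := CliffordAlgebra.reverse_ι _
  have h2 : contraction S (covec ξ) = interior (S ξ) := ExteriorAlgebra.lift_ι_apply _ _ _ _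
  rw [extInner, CliffordAlgebra.reverse.map_mul, h, map_mul, h2]
  rfl

theorem extInner_ιMulti (S : Module.Dual ℝ V →ₗ[ℝ] V) {r : ℕ} (ξ η : Fin r → Module.Dual ℝ V) :
    extInner S (ExteriorAlgebra.ιMulti ℝ r ξ) (ExteriorAlgebra.ιMulti ℝ r η) =
      Matrix.det (Matrix.of fun i j => η j (S (ξ i))) := by
  have key : ∀ (r : ℕ) (v : V) (η : Fin (r + 1) → Module.Dual ℝ V),
      interior v (ExteriorAlgebra.ιMulti ℝ (r + 1) η) =
        ∑ j : Fin (r + 1), ((-1 : ℝ) ^ (j : ℕ) * η j v) • ExteriorAlgebra.ιMulti ℝ r (j.removeNth η) := by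
    intro r v
    induction r with
    | zero =>
      intro η
      have := interior_covec_mul v (η 0) 1
      simp only [interior_one, mul_zero, sub_zero, mul_one] at this
      simp [ExteriorAlgebra.ιMulti_apply, this]
    | succ r ih =>
      intro η
      rw [ExteriorAlgebra.ιMulti_succ_apply]
      have h := interior_covec_mul v (η 0) (ExteriorAlgebra.ιMulti ℝ (r + 1) (Matrix.vecTail η))
      rw [h, ih, Finset.mul_sum, Fin.sum_univ_succ (n := r + 1), sub_eq_add_neg, ← Finset.sum_neg_distrib]
      congr 1
      · simp [Fin.removeNth_zero, Matrix.vecTail, Fin.tail_def]; rfl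
      · refine Finset.sum_congr rfl fun j _ => ?_
        rw [ExteriorAlgebra.ιMulti_succ_apply]
        have e1 : (j.succ.removeNth η) 0 = η 0 := by simp [Fin.removeNth]
        have e2 : Matrix.vecTail (j.succ.removeNth η) = j.removeNth (Matrix.vecTail η) := by
          funext i; simp [Fin.removeNth, Matrix.vecTail]
        rw [e1, e2]
        simp [Matrix.vecTail, pow_succ]
  induction r with
  | zero => simp [extInner_one_one]
  | succ r ih =>
    have h := extInner_covec_mul S (ξ 0) (ExteriorAlgebra.ιMulti ℝ r (Matrix.vecTail ξ))
      (ExteriorAlgebra.ιMulti ℝ (r + 1) η)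
    rw [ExteriorAlgebra.ιMulti_succ_apply (v := ξ), h, key, Matrix.det_succ_row_zero]
    simp only [extInner, map_sum, map_smul]
    refine Finset.sum_congr rfl fun j _ => ?_
    have := ih (Matrix.vecTail ξ) (j.removeNth η)
    rw [extInner] at this
    rw [this]
    simp only [Matrix.of_apply, smul_eq_mul]
    congr 1

end Algebra
section Euclidean

/-- The model space `ℝⁿ`. -/
abbrev Euc (n : ℕ) : Type := EuclideanSpace ℝ (Fin n)

variable {n : ℕ}

/-- The standard basis vector `e_i` of `ℝⁿ`. -/
abbrev stdVec (i : Fin n) : Euc n := EuclideanSpace.basisFun (Fin n) ℝ i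

/-- The covector `dxⁱ` on `ℝⁿ`. -/
abbrev stdCovec (i : Fin n) : Module.Dual ℝ (Euc n) :=
  (EuclideanSpace.basisFun (Fin n) ℝ).toBasis.coord i

/-- The basis `dx^I = dx^{i₁} ∧ ⋯ ∧ dx^{iᵣ}`, for `I = {i₁ < ⋯ < iᵣ}`, of `Λ^*(ℝⁿ)^*`. -/
def stdForm (n : ℕ) : Module.Basis (Finset (Fin n)) ℝ (Ext (Euc n)) :=
  (EuclideanSpace.basisFun (Fin n) ℝ).toBasis.dualBasis.ExteriorAlgebra

/-- The coefficient `f_I` of `f = ∑ f_I dx^I`. -/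
def coeff (f : Euc n → Ext (Euc n)) (I : Finset (Fin n)) (y : Euc n) : ℝ := (stdForm n).repr (f y) I

/-- The derivative `∂_v f = ∑ (∂_v f_I) dx^I` of a form on (an open subset of) `ℝⁿ`. -/
def pderiv (f : Euc n → Ext (Euc n)) (y v : Euc n) : Ext (Euc n) :=
  ∑ I, fderiv ℝ (coeff f I) y v • stdForm n I

/-- The exterior derivative `df = ∑ df_I ∧ dx^I` of a form on (an open subset of) `ℝⁿ`. -/
def extD (f : Euc n → Ext (Euc n)) (y : Euc n) : Ext (Euc n) :=
  ∑ I, covec (fderiv ℝ (coeff f I) y : Euc n →ₗ[ℝ] ℝ) * stdForm n I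

/-- Smoothness of a form on an open subset of `ℝⁿ`: its coefficients are smooth. -/
def SmoothOn (f : Euc n → Ext (Euc n)) (s : Set (Euc n)) : Prop :=
  ∀ I, ContDiffOn ℝ ∞ (coeff f I) s

/-- Differentiability of the coefficients at a point. -/
def DiffAt (f : Euc n → Ext (Euc n)) (y : Euc n) : Prop :=
  ∀ I, DifferentiableAt ℝ (coeff f I) y

theorem sum_coeff (f : Euc n → Ext (Euc n)) (y : Euc n) : f y = ∑ I, coeff f I y • stdForm n I :=
  ((stdForm n).sum_repr (f y)).symm

theorem covec_eq_sum (θ : Module.Dual ℝ (Euc n)) : θ = ∑ i, θ (stdVec i) • stdCovec i := by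
  refine (EuclideanSpace.basisFun (Fin n) ℝ).toBasis.ext fun j => ?_
  simp [Finset.sum_apply]

theorem coeff_sum_smul {J : Type*} [Fintype J] (h : J → Euc n → ℝ) (w : J → Ext (Euc n))
    (I : Finset (Fin n)) :
    coeff (fun y => ∑ j, h j y • w j) I = fun y => ∑ j, h j y * (stdForm n).repr (w j) I := by
  funext y
  simp [coeff, Finsupp.finsetSum_apply]

theorem SmoothOn.sum_smul {J : Type*} [Fintype J] {h : J → Euc n → ℝ} {s : Set (Euc n)}
    (hh : ∀ j, ContDiffOn ℝ ∞ (h j) s) (w : J → Ext (Euc n)) :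
    SmoothOn (fun y => ∑ j, h j y • w j) s := by
  intro I
  rw [coeff_sum_smul]
  exact ContDiffOn.sum fun j _ => (hh j).mul contDiffOn_const

theorem SmoothOn.congr {f f' : Euc n → Ext (Euc n)} {s : Set (Euc n)} (hf : SmoothOn f s)
    (h : ∀ y ∈ s, f' y = f y) : SmoothOn f' s :=
  fun I => (hf I).congr fun y hy => by rw [coeff, h y hy, coeff]

theorem SmoothOn.linear {f : Euc n → Ext (Euc n)} {s : Set (Euc n)} (hf : SmoothOn f s)
    (A : Ext (Euc n) →ₗ[ℝ] Ext (Euc n)) : SmoothOn (fun y => A (f y)) s :=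
  (SmoothOn.sum_smul hf fun I => A (stdForm n I)).congr fun y _ => by
    conv_lhs => rw [sum_coeff f y]
    simp only [map_sum, map_smul]

theorem SmoothOn.mul {f f' : Euc n → Ext (Euc n)} {s : Set (Euc n)} (hf : SmoothOn f s)
    (hf' : SmoothOn f' s) : SmoothOn (fun y => f y * f' y) s :=
  (SmoothOn.sum_smul (J := Finset (Fin n) × Finset (Fin n))
    (h := fun p y => coeff f p.1 y * coeff f' p.2 y) (fun p => (hf p.1).mul (hf' p.2))
    fun p => stdForm n p.1 * stdForm n p.2).congr fun y _ => by
    conv_lhs => rw [sum_coeff f y, sum_coeff f' y]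
    rw [Finset.sum_mul_sum, Fintype.sum_prod_type]
    simp [smul_smul, mul_comm]

theorem SmoothOn.add {f f' : Euc n → Ext (Euc n)} {s : Set (Euc n)} (hf : SmoothOn f s)
    (hf' : SmoothOn f' s) : SmoothOn (fun y => f y + f' y) s := fun I =>
  ((hf I).add (hf' I)).congr fun y _ => by simp [coeff]

theorem SmoothOn.smul {f : Euc n → Ext (Euc n)} {h : Euc n → ℝ} {s : Set (Euc n)}
    (hh : ContDiffOn ℝ ∞ h s) (hf : SmoothOn f s) : SmoothOn (fun y => h y • f y) s := fun I =>
  (hh.mul (hf I)).congr fun y _ => by simp [coeff]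

theorem SmoothOn.sum {J : Type*} [Fintype J] {f : J → Euc n → Ext (Euc n)} {s : Set (Euc n)}
    (hf : ∀ j, SmoothOn (f j) s) : SmoothOn (fun y => ∑ j, f j y) s := fun I =>
  (ContDiffOn.sum (f := fun j => coeff (f j) I) (s := Finset.univ) (t := s)
    fun j _ => hf j I).congr fun y _ => by simp [coeff, Finsupp.finsetSum_apply]

theorem SmoothOn.covec {θ : Euc n → Module.Dual ℝ (Euc n)} {s : Set (Euc n)}
    (h : ∀ i, ContDiffOn ℝ ∞ (fun y => θ y (stdVec i)) s) :
    SmoothOn (fun y => covec (θ y)) s :=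
  (SmoothOn.sum_smul h fun i => ParallelForm.covec (stdCovec i)).congr fun y _ => by
    conv_lhs => rw [covec_eq_sum (θ y)]
    simp only [map_sum, map_smul]

theorem SmoothOn.diffAt {f : Euc n → Ext (Euc n)} {s : Set (Euc n)} (hf : SmoothOn f s)
    (hs : IsOpen s) {y : Euc n} (hy : y ∈ s) : DiffAt f y := fun I =>
  ((hf I).contDiffAt (hs.mem_nhds hy)).differentiableAt (by simp)

theorem SmoothOn.extD {f : Euc n → Ext (Euc n)} {s : Set (Euc n)} (hf : SmoothOn f s)
    (hs : IsOpen s) : SmoothOn (extD f) s := by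
  refine SmoothOn.sum fun I => SmoothOn.mul (SmoothOn.covec fun i => ?_)
    (SmoothOn.covec (θ := 0) (fun i => contDiffOn_const) |>.add
      (SmoothOn.sum_smul (J := Unit) (h := fun _ _ => 1) (fun _ => contDiffOn_const)
        (fun _ => stdForm n I)) |>.congr fun y _ => by simp)
  exact ((hf I).fderiv_of_isOpen hs (m := ∞) (by simp)).clm_apply contDiffOn_const

theorem extD_congr {f f' : Euc n → Ext (Euc n)} {y : Euc n} (h : f =ᶠ[nhds y] f') :
    extD f y = extD f' y := by
  refine Finset.sum_congr rfl fun I _ => ?_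
  have : coeff f I =ᶠ[nhds y] coeff f' I := h.mono fun z hz => by rw [coeff, hz, coeff]
  rw [this.fderiv_eq]

theorem DiffAt.sum_smul {J : Type*} [Fintype J] {h : J → Euc n → ℝ} {y : Euc n}
    (hh : ∀ j, DifferentiableAt ℝ (h j) y) (w : J → Ext (Euc n)) :
    DiffAt (fun y => ∑ j, h j y • w j) y := by
  intro I
  rw [coeff_sum_smul]
  exact DifferentiableAt.fun_sum fun j _ => (hh j).mul_const _

theorem extD_sum_smul {J : Type*} [Fintype J] {h : J → Euc n → ℝ} {y : Euc n}
    (hh : ∀ j, DifferentiableAt ℝ (h j) y) (w : J → Ext (Euc n)) :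
    extD (fun y => ∑ j, h j y • w j) y =
      ∑ j, covec (fderiv ℝ (h j) y : Euc n →ₗ[ℝ] ℝ) * w j := by
  have h1 : ∀ j, w j = ∑ I, (stdForm n).repr (w j) I • stdForm n I :=
    fun j => ((stdForm n).sum_repr (w j)).symm
  have h2 : ∀ I, (fderiv ℝ (coeff (fun y => ∑ j, h j y • w j) I) y : Euc n →ₗ[ℝ] ℝ) =
      ∑ j, (stdForm n).repr (w j) I • (fderiv ℝ (h j) y : Euc n →ₗ[ℝ] ℝ) := by
    intro I
    rw [coeff_sum_smul, fderiv_fun_sum fun j _ => (hh j).mul_const _]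
    refine LinearMap.ext fun v => ?_
    simp [fderiv_mul_const (hh _), Finset.sum_apply]
  rw [extD]
  simp only [h2, map_sum, map_smul, Finset.sum_mul]
  rw [Finset.sum_comm]
  refine Finset.sum_congr rfl fun j _ => ?_
  conv_rhs => rw [h1 j]
  simp only [Finset.mul_sum, mul_smul_comm, smul_mul_assoc]

theorem DiffAt.mul {f f' : Euc n → Ext (Euc n)} {y : Euc n} (hf : DiffAt f y)
    (hf' : DiffAt f' y) : DiffAt (fun y => f y * f' y) y := by
  have : (fun y => f y * f' y) = fun y => ∑ p : Finset (Fin n) × Finset (Fin n),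
      (coeff f p.1 y * coeff f' p.2 y) • (stdForm n p.1 * stdForm n p.2) := by
    funext y
    conv_lhs => rw [sum_coeff f y, sum_coeff f' y]
    rw [Finset.sum_mul_sum, Fintype.sum_prod_type]
    simp [smul_smul, mul_comm]
  rw [this]
  exact DiffAt.sum_smul (J := Finset (Fin n) × Finset (Fin n))
    (h := fun p y => coeff f p.1 y * coeff f' p.2 y) (fun p => (hf p.1).fun_mul (hf' p.2)) _

theorem extD_mul {f f' : Euc n → Ext (Euc n)} {y : Euc n} (hf : DiffAt f y) (hf' : DiffAt f' y) :
    extD (fun y => f y * f' y) y =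
      extD f y * f' y + CliffordAlgebra.involute (f y) * extD f' y := by
  have : (fun y => f y * f' y) = fun y => ∑ p : Finset (Fin n) × Finset (Fin n),
      (coeff f p.1 y * coeff f' p.2 y) • (stdForm n p.1 * stdForm n p.2) := by
    funext y
    conv_lhs => rw [sum_coeff f y, sum_coeff f' y]
    rw [Finset.sum_mul_sum, Fintype.sum_prod_type]
    simp [smul_smul, mul_comm]
  rw [this, extD_sum_smul (J := Finset (Fin n) × Finset (Fin n))
    (h := fun p y => coeff f p.1 y * coeff f' p.2 y) (fun p => (hf p.1).fun_mul (hf' p.2))]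
  conv_rhs => rw [sum_coeff f y, sum_coeff f' y]
  rw [extD, extD, map_sum, Finset.sum_mul_sum, Finset.sum_mul_sum, ← Finset.sum_add_distrib,
    Fintype.sum_prod_type]
  refine Finset.sum_congr rfl fun I _ => ?_
  rw [← Finset.sum_add_distrib]
  refine Finset.sum_congr rfl fun J _ => ?_
  have e : (fderiv ℝ (fun y => coeff f I y * coeff f' J y) y : Euc n →ₗ[ℝ] ℝ) =
      coeff f I y • (fderiv ℝ (coeff f' J) y : Euc n →ₗ[ℝ] ℝ) +
        coeff f' J y • (fderiv ℝ (coeff f I) y : Euc n →ₗ[ℝ] ℝ) := by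
    rw [fderiv_fun_mul (hf I) (hf' J)]; rfl
  rw [e, map_add, map_smul, map_smul, map_smul, add_mul, add_comm, ← mul_assoc]
  congr 1
  · simp [mul_assoc]
  · have := covec_mul_eq (fderiv ℝ (coeff f' J) y : Euc n →ₗ[ℝ] ℝ) (stdForm n I)
    simp only [smul_mul_assoc]
    rw [← mul_assoc, ← mul_assoc, this]

theorem DiffAt.add {f f' : Euc n → Ext (Euc n)} {y : Euc n} (hf : DiffAt f y)
    (hf' : DiffAt f' y) : DiffAt (fun y => f y + f' y) y := by
  intro I
  have : coeff (fun y => f y + f' y) I = fun y => coeff f I y + coeff f' I y := by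
    funext y; simp [coeff]
  rw [this]
  exact (hf I).fun_add (hf' I)

theorem extD_add {f f' : Euc n → Ext (Euc n)} {y : Euc n} (hf : DiffAt f y) (hf' : DiffAt f' y) :
    extD (fun y => f y + f' y) y = extD f y + extD f' y := by
  simp only [extD, ← Finset.sum_add_distrib]
  refine Finset.sum_congr rfl fun I _ => ?_
  have : coeff (fun y => f y + f' y) I = fun y => coeff f I y + coeff f' I y := by
    funext y; simp [coeff]
  rw [this, fderiv_fun_add (hf I) (hf' I), ← add_mul, ← map_add]
  rfl

theorem diffAt_const (w : Ext (Euc n)) (y : Euc n) : DiffAt (fun _ => w) y :=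
  fun _ => differentiableAt_const _

theorem extD_const (w : Ext (Euc n)) (y : Euc n) : extD (fun _ => w) y = 0 := by
  refine Finset.sum_eq_zero fun I _ => ?_
  have : fderiv ℝ (coeff (fun _ => w) I) y = 0 := fderiv_const_apply _
  rw [this]
  exact (congrArg (· * stdForm n I) (map_zero covec)).trans (zero_mul _)

theorem diffAt_smul_one {h : Euc n → ℝ} {y : Euc n} (hh : DifferentiableAt ℝ h y) :
    DiffAt (fun y => h y • (1 : Ext (Euc n))) y := by
  have := DiffAt.sum_smul (J := Unit) (h := fun _ => h) (fun _ => hh) (fun _ => (1 : Ext (Euc n)))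
  simpa using this

theorem extD_smul_one {h : Euc n → ℝ} {y : Euc n} (hh : DifferentiableAt ℝ h y) :
    extD (fun y => h y • (1 : Ext (Euc n))) y = covec (fderiv ℝ h y : Euc n →ₗ[ℝ] ℝ) := by
  have := extD_sum_smul (J := Unit) (h := fun _ => h) (fun _ => hh) (fun _ => (1 : Ext (Euc n)))
  simpa using this

theorem DiffAt.smul {h : Euc n → ℝ} {f : Euc n → Ext (Euc n)} {y : Euc n}
    (hh : DifferentiableAt ℝ h y) (hf : DiffAt f y) : DiffAt (fun y => h y • f y) y := by
  have := (diffAt_smul_one hh).mul hf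
  simpa using this

theorem extD_smul {h : Euc n → ℝ} {f : Euc n → Ext (Euc n)} {y : Euc n}
    (hh : DifferentiableAt ℝ h y) (hf : DiffAt f y) :
    extD (fun y => h y • f y) y =
      covec (fderiv ℝ h y : Euc n →ₗ[ℝ] ℝ) * f y + h y • extD f y := by
  have := extD_mul (diffAt_smul_one hh) hf
  rw [extD_smul_one hh] at this
  simpa using this

theorem DiffAt.sum {J : Type*} {f : J → Euc n → Ext (Euc n)} {y : Euc n} (s : Finset J)
    (hf : ∀ j, DiffAt (f j) y) : DiffAt (fun y => ∑ j ∈ s, f j y) y := by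
  classical
  induction s using Finset.induction_on with
  | empty => simpa using diffAt_const 0 y
  | insert j s hj ih => simpa [Finset.sum_insert hj] using (hf j).add ih

theorem extD_sum {J : Type*} {f : J → Euc n → Ext (Euc n)} {y : Euc n} (s : Finset J)
    (hf : ∀ j, DiffAt (f j) y) : extD (fun y => ∑ j ∈ s, f j y) y = ∑ j ∈ s, extD (f j) y := by
  classical
  induction s using Finset.induction_on with
  | empty => simpa using extD_const 0 y
  | insert j s hj ih =>
    simp only [Finset.sum_insert hj]
    rw [extD_add (hf j) (DiffAt.sum s hf), ih]

/-- The exterior derivative commutes with pull-back. -/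
theorem extD_pullback {f : Euc n → Ext (Euc n)} {ψ : Euc n → Euc n} {y : Euc n}
    (hf : DiffAt f (ψ y)) (hψ : ContDiffAt ℝ 2 ψ y) :
    extD (fun z => pullback (fderiv ℝ ψ z : Euc n →ₗ[ℝ] Euc n) (f (ψ z))) y =
      pullback (fderiv ℝ ψ y : Euc n →ₗ[ℝ] Euc n) (extD f (ψ y)) := by
  have hψ1 : DifferentiableAt ℝ ψ y := hψ.differentiableAt (by simp)
  have hψ2 : DifferentiableAt ℝ (fderiv ℝ ψ) y :=
    (hψ.fderiv_right (m := 1) (by norm_num)).differentiableAt (by simp)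
  have hsymm : IsSymmSndFDerivAt ℝ ψ y := hψ.isSymmSndFDerivAt (by simp)
  set P : Euc n → Ext (Euc n) →ₐ[ℝ] Ext (Euc n) :=
    fun z => pullback (fderiv ℝ ψ z : Euc n →ₗ[ℝ] Euc n) with hP
  have hcov : ∀ ξ : Module.Dual ℝ (Euc n),
      DiffAt (fun z => P z (covec ξ)) y ∧ extD (fun z => P z (covec ξ)) y = 0 := by
    intro ξ
    have e1 : (fun z => P z (covec ξ)) =
        fun z => ∑ i, (LinearMap.toContinuousLinearMap ξ) (fderiv ℝ ψ z (stdVec i)) •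
          covec (stdCovec i) := by
      funext z
      rw [hP]
      simp only [pullback_covec]
      conv_lhs => rw [covec_eq_sum (LinearMap.dualMap _ ξ)]
      simp only [map_sum, map_smul]
      rfl
    have hd : ∀ i, HasFDerivAt
        (fun z => (LinearMap.toContinuousLinearMap ξ) (fderiv ℝ ψ z (stdVec i)))
        ((LinearMap.toContinuousLinearMap ξ) ∘L
          ((fderiv ℝ (fderiv ℝ ψ) y).flip (stdVec i))) y := by
      intro i
      have := (hψ2.hasFDerivAt.clm_apply (hasFDerivAt_const (stdVec i) y))
      refine ((LinearMap.toContinuousLinearMap ξ).hasFDerivAt.comp y this).congr_fderiv ?_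
      ext v; simp
    rw [e1]
    refine ⟨DiffAt.sum_smul (fun i => (hd i).differentiableAt) _, ?_⟩
    rw [extD_sum_smul (fun i => (hd i).differentiableAt)]
    set H : Fin n → Fin n → ℝ :=
      fun i j => ξ (fderiv ℝ (fderiv ℝ ψ) y (stdVec j) (stdVec i)) with hH
    have hHs : ∀ i j, H i j = H j i := fun i j => by
      rw [hH]; exact congrArg ξ (hsymm (stdVec j) (stdVec i))
    have e2 : ∀ i, covec (fderiv ℝ (fun z =>
        (LinearMap.toContinuousLinearMap ξ) (fderiv ℝ ψ z (stdVec i))) y : Euc n →ₗ[ℝ] ℝ) =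
        ∑ j, H i j • covec (stdCovec j) := by
      intro i
      conv_lhs => rw [covec_eq_sum
        (fderiv ℝ (fun z => (LinearMap.toContinuousLinearMap ξ) (fderiv ℝ ψ z (stdVec i))) y :
          Euc n →ₗ[ℝ] ℝ)]
      simp only [map_sum, map_smul, (hd i).fderiv]
      rfl
    simp only [e2, Finset.sum_mul, smul_mul_assoc]
    have hneg : ∑ i, ∑ j, H i j • (covec (stdCovec j) * covec (stdCovec i) : Ext (Euc n)) =
        - ∑ i, ∑ j, H i j • (covec (stdCovec j) * covec (stdCovec i) : Ext (Euc n)) := by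
      conv_lhs => rw [Finset.sum_comm]
      rw [← Finset.sum_neg_distrib]
      refine Finset.sum_congr rfl fun i _ => ?_
      rw [← Finset.sum_neg_distrib]
      refine Finset.sum_congr rfl fun j _ => ?_
      have h : (covec (stdCovec i) * covec (stdCovec j) : Ext (Euc n)) =
          - (covec (stdCovec j) * covec (stdCovec i)) :=
        eq_neg_of_add_eq_zero_left (ExteriorAlgebra.ι_add_mul_swap _ _)
      rw [h, hHs j i, smul_neg]
    have h2 : (2 : ℝ) • ∑ i, ∑ j, H i j •
        (covec (stdCovec j) * covec (stdCovec i) : Ext (Euc n)) = 0 := by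
      rw [two_smul]
      exact add_eq_zero_iff_eq_neg.mpr hneg
    exact (smul_eq_zero.mp h2).resolve_left two_ne_zero
  have hconst : ∀ w : Ext (Euc n),
      DiffAt (fun z => P z w) y ∧ extD (fun z => P z w) y = 0 := by
    intro w
    induction w using covec_induction with
    | h1 => simpa using ⟨diffAt_const 1 y, extD_const 1 y⟩
    | hadd a b ha hb =>
      simp only [map_add]
      exact ⟨ha.1.add hb.1, by rw [extD_add ha.1 hb.1, ha.2, hb.2, add_zero]⟩
    | hsmul r a ha =>
      simp only [map_smul]
      refine ⟨DiffAt.smul (differentiableAt_const r) ha.1, ?_⟩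
      rw [extD_smul (differentiableAt_const r) ha.1, ha.2, smul_zero, add_zero,
        fderiv_fun_const]
      exact (congrArg (· * _) (map_zero covec)).trans (zero_mul _)
    | hmul ξ a ha =>
      simp only [map_mul]
      refine ⟨(hcov ξ).1.mul ha.1, ?_⟩
      rw [extD_mul (hcov ξ).1 ha.1, ha.2, (hcov ξ).2]
      simp
  have hcomp : ∀ I, DifferentiableAt ℝ (fun z => coeff f I (ψ z)) y :=
    fun I => DifferentiableAt.fun_comp' y (hf I) hψ1
  have e3 : (fun z => P z (f (ψ z))) =
      fun z => ∑ I, coeff f I (ψ z) • P z (stdForm n I) := by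
    funext z
    conv_lhs => rw [sum_coeff f (ψ z)]
    simp only [map_sum, map_smul]
  rw [e3, extD_sum _ fun I => DiffAt.smul (hcomp I) (hconst _).1, extD, map_sum]
  refine Finset.sum_congr rfl fun I _ => ?_
  rw [extD_smul (hcomp I) (hconst _).1, (hconst _).2, smul_zero, add_zero, map_mul, hP]
  simp only [pullback_covec]
  congr 2
  have : fderiv ℝ (fun z => coeff f I (ψ z)) y = (fderiv ℝ (coeff f I) (ψ y)) ∘L fderiv ℝ ψ y :=
    fderiv_fun_comp y (hf I) hψ1
  rw [this]
  rfl

end Euclidean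

section Manifold

variable {n : ℕ} {M : Type*} [TopologicalSpace M] [ChartedSpace (Euc n) M]

instance (x : M) : FiniteDimensional ℝ (TangentSpace (𝓡 n) x) :=
  inferInstanceAs (FiniteDimensional ℝ (Euc n))

/-- The domain (in `ℝⁿ`) of the coordinates centred at `c`. -/
abbrev chartDom (n : ℕ) {M : Type*} [TopologicalSpace M] [ChartedSpace (Euc n) M] (c : M) :
    Set (Euc n) := (extChartAt (𝓡 n) c).target

/-- The inverse of the chart at `c`. -/
abbrev chartInv (c : M) : Euc n → M := (extChartAt (𝓡 n) c).symm

/-- The derivative of the inverse of the chart at `c`: it maps `e_i` to `∂/∂xⁱ`. -/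
def frame (c : M) (y : Euc n) : Euc n →ₗ[ℝ] TangentSpace (𝓡 n) (chartInv c y) :=
  (mfderiv (𝓡 n) (𝓡 n) (chartInv c) y).toLinearMap ∘ₗ
    (NormedSpace.fromTangentSpace (𝕜 := ℝ) y).symm.toLinearMap

/-- The derivative of the chart at `c`. -/
def coframe (c x : M) : TangentSpace (𝓡 n) x →ₗ[ℝ] Euc n :=
  (NormedSpace.fromTangentSpace (𝕜 := ℝ) (extChartAt (𝓡 n) c x)).toLinearMap ∘ₗ
    (mfderiv (𝓡 n) (𝓡 n) (extChartAt (𝓡 n) c) x).toLinearMap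

/-- A differential form, of arbitrary regularity and not necessarily homogeneous: a section of
`Λ^*T^*M`. -/
abbrev RoughForm (n : ℕ) (M : Type*) [TopologicalSpace M] [ChartedSpace (Euc n) M] : Type _ :=
  (x : M) → Ext (TangentSpace (𝓡 n) x)

/-- A differential form written in the coordinates centred at `c`. -/
def inChart (c : M) (α : RoughForm n M) (y : Euc n) : Ext (Euc n) :=
  pullback (frame c y) (α (chartInv c y))

/-- The space `Λ^*(M)` of smooth differential forms: the coefficients in coordinates are smooth. -/
def Form (n : ℕ) (M : Type*) [TopologicalSpace M] [ChartedSpace (Euc n) M] :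
    Submodule ℝ (RoughForm n M) where
  carrier := {α | ∀ c, SmoothOn (inChart c α) (chartDom n c)}
  add_mem' {α β} hα hβ c := ((hα c).add (hβ c)).congr fun y _ => by simp [inChart]
  zero_mem' c := fun I => (contDiffOn_const (c := (0 : ℝ))).congr
    fun y _ => by simp [coeff, inChart]
  smul_mem' r α hα c := (SmoothOn.smul (contDiffOn_const (c := r)) (hα c)).congr
    fun y _ => by simp [inChart]

/-- `α` is a differential `k`-form. -/
def IsHomogeneous (α : Form n M) (k : ℕ) : Prop :=
  ∀ x, α.1 x ∈ ⋀[ℝ]^k (Module.Dual ℝ (TangentSpace (𝓡 n) x))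

/-- The support of `α` is compact. -/
def HasCompactFormSupport (α : Form n M) : Prop := IsCompact (closure {x | α.1 x ≠ 0})

/-- The operator `L_Ω : η ↦ Ω ∧ η`. -/
def wedge (Ω : Form n M) : Module.End ℝ (Form n M) where
  toFun η := ⟨fun x => Ω.1 x * η.1 x, fun c => ((Ω.2 c).mul (η.2 c)).congr
    fun y _ => by simp [inChart]⟩
  map_add' _ _ := Subtype.ext <| funext fun _ => mul_add _ _ _
  map_smul' r η := Subtype.ext <| funext fun x => mul_smul_comm r (Ω.1 x) (η.1 x)

section Charts

theorem isOpen_chartDom (c : M) : IsOpen (chartDom n c) := isOpen_extChartAt_target c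

/-- The exterior derivative at `x`, computed in the coordinates centred at `x`. -/
def roughD (α : RoughForm n M) : RoughForm n M := fun x =>
  pullback (coframe x x) (extD (inChart x α) (extChartAt (𝓡 n) x x))

theorem roughD_add (α β : Form n M) : roughD (α.1 + β.1) = roughD α.1 + roughD β.1 := by
  funext x
  have hx : extChartAt (𝓡 n) x x ∈ chartDom n x := mem_extChartAt_target x
  have h : inChart x (α.1 + β.1) = fun y => inChart x α.1 y + inChart x β.1 y :=
    funext fun y => map_add (pullback (frame x y)) (α.1 _) (β.1 _)
  rw [roughD, h, extD_add ((α.2 x).diffAt (isOpen_chartDom x) hx)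
    ((β.2 x).diffAt (isOpen_chartDom x) hx), map_add]
  rfl

theorem roughD_smul (r : ℝ) (α : Form n M) : roughD (r • α.1) = r • roughD α.1 := by
  funext x
  have hx : extChartAt (𝓡 n) x x ∈ chartDom n x := mem_extChartAt_target x
  have h : inChart x (r • α.1) = fun y => r • inChart x α.1 y :=
    funext fun y => map_smul (pullback (frame x y)) r (α.1 _)
  have h0 : covec (((0 : Euc n → Euc n →L[ℝ] ℝ) (extChartAt (𝓡 n) x x) : Euc n →L[ℝ] ℝ) :
      Euc n →ₗ[ℝ] ℝ) = 0 := map_zero covec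
  rw [roughD, h, extD_smul (differentiableAt_const r) ((α.2 x).diffAt (isOpen_chartDom x) hx),
    fderiv_fun_const, h0, zero_mul, zero_add, map_smul]
  rfl

variable [IsManifold (𝓡 n) ∞ M]

theorem coframe_comp_frame {c : M} {y : Euc n} (hy : y ∈ chartDom n c) :
    coframe c (chartInv c y) ∘ₗ frame c y = LinearMap.id := by
  have h := mfderiv_extChartAt_comp_mfderivWithin_extChartAt_symm (I := 𝓡 n) hy
  rw [ModelWithCorners.range_eq_univ, mfderivWithin_univ] at h
  refine LinearMap.ext fun v => ?_
  have h2 := DFunLike.congr_fun h ((NormedSpace.fromTangentSpace (𝕜 := ℝ) y).symm v)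
  exact h2

theorem frame_comp_coframe {c : M} {y : Euc n} (hy : y ∈ chartDom n c) :
    frame c y ∘ₗ coframe c (chartInv c y) = LinearMap.id := by
  have h := mfderivWithin_extChartAt_symm_comp_mfderiv_extChartAt (I := 𝓡 n) hy
  rw [ModelWithCorners.range_eq_univ, mfderivWithin_univ] at h
  refine LinearMap.ext fun v => ?_
  have h2 := DFunLike.congr_fun h v
  exact h2

theorem mdifferentiableAt_chartInv {c : M} {y : Euc n} (hy : y ∈ chartDom n c) :
    MDifferentiableAt (𝓡 n) (𝓡 n) (chartInv c) y := by
  have h := mdifferentiableWithinAt_extChartAt_symm (I := 𝓡 n) hy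
  rwa [ModelWithCorners.range_eq_univ, mdifferentiableWithinAt_univ] at h

/-- The change of coordinates from the chart at `c` to the chart at `c'`. -/
def transition (c c' : M) (y : Euc n) : Euc n := extChartAt (𝓡 n) c' (chartInv c y)

theorem contDiffAt_transition {c c' : M} {y : Euc n} (hy : y ∈ chartDom n c)
    (hy' : chartInv c y ∈ (extChartAt (𝓡 n) c').source) : ContDiffAt ℝ ∞ (transition c c') y := by
  have h1 := contDiffWithinAt_ext_coord_change (I := 𝓡 n) (n := ∞) c' c (y := y)
    (by rw [PartialEquiv.trans_source]; exact ⟨hy, hy'⟩)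
  rwa [ModelWithCorners.range_eq_univ, contDiffWithinAt_univ] at h1

theorem fderiv_transition {c c' : M} {y : Euc n} (hy : y ∈ chartDom n c)
    (hy' : chartInv c y ∈ (extChartAt (𝓡 n) c').source) :
    (fderiv ℝ (transition c c') y : Euc n →ₗ[ℝ] Euc n) =
      coframe c' (chartInv c y) ∘ₗ frame c y := by
  have h1 : MDifferentiableAt (𝓡 n) (𝓡 n) (extChartAt (𝓡 n) c') (chartInv c y) :=
    mdifferentiableAt_extChartAt (by simpa using hy')
  have h := mfderiv_comp y h1 (mdifferentiableAt_chartInv hy)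
  have h2 : mfderiv (𝓡 n) (𝓡 n) (extChartAt (𝓡 n) c' ∘ chartInv c) y =
      fderiv ℝ (transition c c') y := mfderiv_eq_fderiv
  rw [h2] at h
  refine LinearMap.ext fun v => ?_
  have h3 := DFunLike.congr_fun h ((NormedSpace.fromTangentSpace (𝕜 := ℝ) y).symm v)
  exact h3

theorem inChart_transition (α : RoughForm n M) {c c' : M} {y : Euc n} (hy : y ∈ chartDom n c)
    (hy' : chartInv c y ∈ (extChartAt (𝓡 n) c').source) :
    inChart c α y = pullback (fderiv ℝ (transition c c') y : Euc n →ₗ[ℝ] Euc n)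
      (inChart c' α (transition c c' y)) := by
  have hz : transition c c' y ∈ chartDom n c' := (extChartAt (𝓡 n) c').map_source hy'
  have hx : chartInv c' (transition c c' y) = chartInv c y :=
    (extChartAt (𝓡 n) c').left_inv hy'
  have h2 : ∀ x, chartInv c' (transition c c' y) = x →
      pullback (coframe c' x) (inChart c' α (transition c c' y)) = α x := by
    rintro x rfl
    rw [inChart, ← pullback_comp, frame_comp_coframe hz, pullback_id]
  rw [fderiv_transition hy hy', pullback_comp, h2 _ hx, inChart]

/-- The exterior derivative is given by the usual formula in every chart. -/
theorem inChart_roughD (α : Form n M) {c : M} {y : Euc n} (hy : y ∈ chartDom n c) :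
    inChart c (roughD α.1) y = extD (inChart c α.1) y := by
  set x := chartInv c y with hx
  have hy' : chartInv c y ∈ (extChartAt (𝓡 n) x).source := mem_extChartAt_source x
  have hz : transition c x y ∈ chartDom n x := (extChartAt (𝓡 n) x).map_source hy'
  have hev : inChart c α.1 =ᶠ[nhds y] fun z =>
      pullback (fderiv ℝ (transition c x) z : Euc n →ₗ[ℝ] Euc n)
        (inChart x α.1 (transition c x z)) := by
    have hcont : ContinuousAt (chartInv c) y := continuousAt_extChartAt_symm'' hy
    filter_upwards [(isOpen_chartDom c).mem_nhds hy,
      hcont.preimage_mem_nhds ((isOpen_extChartAt_source x).mem_nhds hy')] with z hz hz'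
    exact inChart_transition α.1 hz hz'
  rw [extD_congr hev, extD_pullback ((α.2 x).diffAt (isOpen_chartDom x) hz)
    ((contDiffAt_transition hy hy').of_le ENat.LEInfty.out), fderiv_transition hy hy',
    pullback_comp]
  rfl

/-- The exterior derivative `d` of smooth differential forms. -/
def deRham (n : ℕ) (M : Type*) [TopologicalSpace M] [ChartedSpace (Euc n) M]
    [IsManifold (𝓡 n) ∞ M] : Module.End ℝ (Form n M) where
  toFun α := ⟨roughD α.1, fun c => ((α.2 c).extD (isOpen_chartDom c)).congr
    fun _ hy => inChart_roughD α hy⟩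
  map_add' α β := Subtype.ext (roughD_add α β)
  map_smul' r α := Subtype.ext (roughD_smul r α)

end Charts

section Metric

variable [IsManifold (𝓡 n) ∞ M]

/-- A smooth Riemannian metric on `M`. -/
abbrev SmoothMetric (n : ℕ) (M : Type*) [TopologicalSpace M] [ChartedSpace (Euc n) M]
    [IsManifold (𝓡 n) ∞ M] : Type _ :=
  Bundle.ContMDiffRiemannianMetric (𝓡 n) ∞ (Euc n) (fun x : M => TangentSpace (𝓡 n) x)

/-- `v ↦ g(v, ·)`. -/
def flat (g : SmoothMetric n M) (x : M) :
    TangentSpace (𝓡 n) x →ₗ[ℝ] Module.Dual ℝ (TangentSpace (𝓡 n) x) :=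
  ContinuousLinearMap.coeLM ℝ ∘ₗ (g.inner x).toLinearMap

theorem flat_apply (g : SmoothMetric n M) (x : M) (v w : TangentSpace (𝓡 n) x) :
    flat g x v w = g.inner x v w := rfl

theorem flat_injective (g : SmoothMetric n M) (x : M) : Function.Injective (flat g x) := by
  refine (injective_iff_map_eq_zero _).mpr fun v hv => ?_
  by_contra h
  have h1 := g.pos x v h
  rw [← flat_apply, hv] at h1
  exact lt_irrefl 0 h1

/-- The isomorphism `ξ ↦ ξ^♯` of `T^*_xM` with `T_xM`, defined by `g(ξ^♯, ·) = ξ`. -/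
def sharp (g : SmoothMetric n M) (x : M) :
    Module.Dual ℝ (TangentSpace (𝓡 n) x) ≃ₗ[ℝ] TangentSpace (𝓡 n) x :=
  (LinearEquiv.ofInjectiveOfFinrankEq (flat g x) (flat_injective g x)
    Subspace.dual_finrank_eq.symm).symm

theorem inner_sharp (g : SmoothMetric n M) (x : M) (ξ : Module.Dual ℝ (TangentSpace (𝓡 n) x))
    (v : TangentSpace (𝓡 n) x) : g.inner x (sharp g x ξ) v = ξ v := by
  have h : flat g x (sharp g x ξ) = ξ := (LinearEquiv.ofInjectiveOfFinrankEq (flat g x)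
    (flat_injective g x) Subspace.dual_finrank_eq.symm).apply_symm_apply ξ
  rw [← flat_apply, h]

/-- The coefficients `g_ij` of the metric in the coordinates centred at `c`. -/
def metricCoeff (g : SmoothMetric n M) (c : M) (y : Euc n) : Matrix (Fin n) (Fin n) ℝ :=
  Matrix.of fun i j => g.inner (chartInv c y) (frame c y (stdVec i)) (frame c y (stdVec j))

/-- The Christoffel symbols `Γ^k_ij = ½ ∑_l g^{kl} (∂_i g_jl + ∂_j g_il - ∂_l g_ij)` of the
Levi-Civita connection in the coordinates centred at `c`. -/
def christoffel (g : SmoothMetric n M) (c : M) (y : Euc n) (i j k : Fin n) : ℝ :=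
  (1 / 2) * ∑ l, (metricCoeff g c y)⁻¹ k l *
    (fderiv ℝ (fun z => metricCoeff g c z j l) y (stdVec i) +
      fderiv ℝ (fun z => metricCoeff g c z i l) y (stdVec j) -
      fderiv ℝ (fun z => metricCoeff g c z i j) y (stdVec l))

/-- The Levi-Civita covariant derivative `∇_i α = ∂_i α - ∑_{jk} Γ^k_ij dx^j ∧ (e_k ⌟ α)` of a
differential form in the coordinates centred at `c`; that is, `∇_i` is the derivation with
`∇_i dx^k = - ∑_j Γ^k_ij dx^j`. -/
def covDeriv (g : SmoothMetric n M) (α : Form n M) (c : M) (y : Euc n) (i : Fin n) : Ext (Euc n) :=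
  pderiv (inChart c α.1) y (stdVec i) -
    ∑ j, ∑ k, christoffel g c y i j k •
      (covec (stdCovec j) * interior (stdVec k) (inChart c α.1 y))

/-- `∇α = 0`. -/
def IsParallel (g : SmoothMetric n M) (α : Form n M) : Prop :=
  ∀ (c : M), ∀ y ∈ chartDom n c, ∀ i, covDeriv g α c y i = 0

theorem contDiffOn_det {s : Set (Euc n)} {m : ℕ} {A : Euc n → Matrix (Fin m) (Fin m) ℝ}
    (hA : ∀ i j, ContDiffOn ℝ ∞ (fun y => A y i j) s) :
    ContDiffOn ℝ ∞ (fun y => (A y).det) s := by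
  simp only [Matrix.det_apply]
  exact ContDiffOn.sum fun σ _ => (contDiffOn_prod fun i _ => hA _ _).const_smul _

theorem contDiffOn_metricCoeff (g : SmoothMetric n M) (c : M) (i j : Fin n) :
    ContDiffOn ℝ ∞ (fun y => metricCoeff g c y i j) (chartDom n c) := by
  have hb : ContMDiffOn (𝓡 n) (𝓡 n) ∞ (chartInv c) (chartDom n c) := contMDiffOn_extChartAt_symm c
  have hv : ∀ i, ContMDiffOn (𝓡 n) ((𝓡 n).prod (𝓡 n)) ∞ (fun y => (⟨chartInv c y,
      frame c y (stdVec i)⟩ : TangentBundle (𝓡 n) M)) (chartDom n c) := by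
    intro i
    have h1 := hb.contMDiffOn_tangentMapWithin (m := ∞) (by simp)
      (isOpen_chartDom c).uniqueMDiffOn
    have h0 : ContMDiffOn (𝓡 n) ((𝓡 n).prod (𝓡 n)) ∞ (fun y : Euc n => (⟨y,
        (NormedSpace.fromTangentSpace (𝕜 := ℝ) y).symm (stdVec i)⟩ : TangentBundle (𝓡 n) (Euc n)))
        (chartDom n c) :=
      contMDiffOn_vectorSpace_iff_contDiffOn.mpr contDiffOn_const
    refine (h1.comp h0 fun y hy => hy).congr fun y hy => ?_
    rw [Function.comp_apply, tangentMapWithin_eq_tangentMap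
      ((isOpen_chartDom c).uniqueMDiffWithinAt hy) (mdifferentiableAt_chartInv hy)]
    rfl
  have h : ContMDiffOn (𝓡 n) ((𝓡 n).prod 𝓘(ℝ)) ∞
      (fun y ↦ Bundle.TotalSpace.mk' ℝ (E := Bundle.Trivial M ℝ) (chartInv c y)
        (g.inner (chartInv c y) (frame c y (stdVec i)) (frame c y (stdVec j)))) (chartDom n c) := by
    apply ContMDiffOn.clm_bundle_apply₂ (F₁ := Euc n) (F₂ := Euc n)
    · exact g.contMDiff.comp_contMDiffOn hb
    · exact hv i
    · exact hv j
  intro y hy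
  have h2 := h y hy
  simp only [Bundle.contMDiffWithinAt_totalSpace] at h2
  exact h2.2.contDiffWithinAt

theorem contDiffOn_metricCoeff_inv (g : SmoothMetric n M) (c : M) (i j : Fin n)
    (hdet : ∀ y ∈ chartDom n c, (metricCoeff g c y).det ≠ 0) :
    ContDiffOn ℝ ∞ (fun y => (metricCoeff g c y)⁻¹ i j) (chartDom n c) := by
  have h : (fun y => (metricCoeff g c y)⁻¹ i j) = fun y =>
      ((metricCoeff g c y).det)⁻¹ * ((metricCoeff g c y).updateRow j (Pi.single i 1)).det := by
    funext y
    rw [Matrix.inv_def, Matrix.smul_apply, Matrix.adjugate_apply, Ring.inverse_eq_inv', smul_eq_mul]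
  rw [h]
  refine ((contDiffOn_det (contDiffOn_metricCoeff g c)).inv hdet).mul (contDiffOn_det fun k l => ?_)
  by_cases hk : k = j
  · subst hk
    simp only [Matrix.updateRow_self]
    exact contDiffOn_const
  · simp only [Matrix.updateRow_ne hk]
    exact contDiffOn_metricCoeff g c k l

/-- The basis `∂/∂xⁱ` of the tangent space. -/
def frameBasis {c : M} {y : Euc n} (hy : y ∈ chartDom n c) :
    Module.Basis (Fin n) ℝ (TangentSpace (𝓡 n) (chartInv c y)) :=
  (EuclideanSpace.basisFun (Fin n) ℝ).toBasis.map (LinearEquiv.ofLinearMap (frame c y)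
    (coframe c (chartInv c y)) (frame_comp_coframe hy) (coframe_comp_frame hy))

theorem frameBasis_apply {c : M} {y : Euc n} (hy : y ∈ chartDom n c) (i : Fin n) :
    frameBasis hy i = frame c y (stdVec i) := by
  simp [frameBasis]

theorem metricCoeff_inv (g : SmoothMetric n M) {c : M} {y : Euc n} (hy : y ∈ chartDom n c) :
    (metricCoeff g c y).det ≠ 0 ∧ ∀ i, sharp g _ ((frameBasis hy).coord i) =
      ∑ j, (metricCoeff g c y)⁻¹ i j • frame c y (stdVec j) := by
  set b := frameBasis hy with hb
  set A : Matrix (Fin n) (Fin n) ℝ :=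
    Matrix.of fun i j => b.coord j (sharp g _ (b.coord i)) with hA
  have h1 : ∀ i, sharp g _ (b.coord i) = ∑ j, A i j • b j := fun i => (b.sum_repr _).symm
  have h2 : A * metricCoeff g c y = 1 := by
    ext i k
    have h3 := inner_sharp g _ (b.coord i) (b k)
    rw [h1] at h3
    rw [Matrix.mul_apply, Matrix.one_apply]
    simp only [map_sum, map_smul, _root_.sum_apply, _root_.smul_apply,
      smul_eq_mul, Module.Basis.coord_apply, Module.Basis.repr_self, Finsupp.single_apply] at h3
    simp only [metricCoeff, Matrix.of_apply, ← frameBasis_apply hy, ← hb]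
    rw [h3]
    simp [eq_comm]
  refine ⟨fun h0 => ?_, fun i => ?_⟩
  · have := congrArg Matrix.det h2
    rw [Matrix.det_mul, h0, mul_zero, Matrix.det_one] at this
    exact zero_ne_one this
  · rw [Matrix.inv_eq_left_inv h2, h1]
    simp only [hb, frameBasis_apply]

/-- The map `ν ↦ ν^♯ ⌟ Ω` from `T^*_xM` to `Λ^*T^*_xM`. -/
def structureSymbol (g : SmoothMetric n M) (Ω : Form n M) (x : M) :
    Module.Dual ℝ (TangentSpace (𝓡 n) x) →ₗ[ℝ] Ext (TangentSpace (𝓡 n) x) :=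
  interior.flip (Ω.1 x) ∘ₗ (sharp g x).toLinearMap

theorem smoothOn_structure (g : SmoothMetric n M) (Ω α : Form n M) (c : M) :
    SmoothOn (inChart c fun x => extendDerivation (structureSymbol g Ω x) (α.1 x))
      (chartDom n c) := by
  have h : SmoothOn (fun y => ∑ i, (∑ j, (metricCoeff g c y)⁻¹ i j •
      interior (stdVec j) (inChart c Ω.1 y)) * interior (stdVec i) (inChart c α.1 y))
      (chartDom n c) :=
    SmoothOn.sum fun i => SmoothOn.mul (SmoothOn.sum fun j => SmoothOn.smul
      (contDiffOn_metricCoeff_inv g c i j fun y hy => (metricCoeff_inv g hy).1)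
      ((Ω.2 c).linear _)) ((α.2 c).linear _)
  refine h.congr fun y hy => ?_
  rw [inChart, extendDerivation_apply (frameBasis hy), map_sum]
  refine Finset.sum_congr rfl fun i _ => ?_
  rw [map_mul, structureSymbol, LinearMap.comp_apply, LinearEquiv.coe_coe,
    (metricCoeff_inv g hy).2 i, LinearMap.flip_apply, frameBasis_apply]
  simp only [map_sum, map_smul, LinearMap.sum_apply, LinearMap.smul_apply, inChart,
    interior_pullback]

/-- The structure operator `C` of `(M, Ω)`: the graded derivation of `Λ^*(M)` which is linear over
the smooth functions and maps a 1-form `ν` to `ν^♯ ⌟ Ω`. -/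
def structureOp (g : SmoothMetric n M) (Ω : Form n M) : Module.End ℝ (Form n M) where
  toFun α := ⟨fun x => extendDerivation (structureSymbol g Ω x) (α.1 x),
    smoothOn_structure g Ω α⟩
  map_add' α β := Subtype.ext <| funext fun x => map_add _ (α.1 x) (β.1 x)
  map_smul' r α := Subtype.ext <| funext fun x => map_smul _ r (α.1 x)

/-- The supercommutator `{A, B} = AB - (-1)^{ab} BA` of operators of parities `a` and `b`. -/
def superComm (a b : ℕ) (A B : Module.End ℝ (Form n M)) : Module.End ℝ (Form n M) :=
  A * B - (-1 : ℝ) ^ (a * b) • (B * A)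

/-- The twisted de Rham operator `d_c = {d, C}` of `(M, Ω)`, for a `k`-form `Ω`. -/
def twistedD (g : SmoothMetric n M) (k : ℕ) (Ω : Form n M) : Module.End ℝ (Form n M) :=
  superComm 1 k (deRham n M) (structureOp g Ω)

section Adjoint

variable [MeasurableSpace M] [BorelSpace M]

/-- The Riemannian measure of the domain of the chart at `c`: in coordinates it is
`√(det g_ij) dx¹⋯dxⁿ`. -/
def chartVolume (g : SmoothMetric n M) (c : M) : Measure M :=
  ((volume.restrict (chartDom n c)).withDensity
    fun y => ENNReal.ofReal (√(metricCoeff g c y).det)).map (chartInv c)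

/-- The Riemannian measure: the least measure on `M` that is at least `√(det g_ij) dx¹⋯dxⁿ` in
every chart (equivalently, it is equal to this measure in every chart). -/
def riemannianVolume (g : SmoothMetric n M) : Measure M := ⨆ c, chartVolume g c

/-- The `L²` inner product `∫_M ⟨α, β⟩ dvol` of differential forms. -/
def formInner (g : SmoothMetric n M) (α β : Form n M) : ℝ :=
  ∫ x, extInner (sharp g x).toLinearMap (α.1 x) (β.1 x) ∂(riemannianVolume g)

/-- `Q` is the (formal) adjoint of `P`: `(Pα, β) = (α, Qβ)` for all smooth forms `α`, `β` one of
which has compact support. -/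
def IsAdjoint (g : SmoothMetric n M) (P Q : Module.End ℝ (Form n M)) : Prop :=
  ∀ α β : Form n M, HasCompactFormSupport α ∨ HasCompactFormSupport β →
    formInner g (P α) β = formInner g α (Q β)

open Classical in
/-- The adjoint of an operator on differential forms (zero if there is none). -/
def adjoint (g : SmoothMetric n M) (P : Module.End ℝ (Form n M)) : Module.End ℝ (Form n M) :=
  if h : ∃ Q, IsAdjoint g P Q then h.choose else 0

/-- The adjoint `d^*` of the exterior derivative. -/
def codiff (g : SmoothMetric n M) : Module.End ℝ (Form n M) := adjoint g (deRham n M)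

/-- The adjoint `d_c^*` of the twisted de Rham operator. -/
def twistedCodiff (g : SmoothMetric n M) (k : ℕ) (Ω : Form n M) : Module.End ℝ (Form n M) :=
  adjoint g (twistedD g k Ω)

/-- The adjoint `Λ_Ω` of `L_Ω`. -/
def wedgeAdjoint (g : SmoothMetric n M) (Ω : Form n M) : Module.End ℝ (Form n M) :=
  adjoint g (wedge Ω)

/-- The Laplacian `Δ = {d, d^*} = d d^* + d^* d`. -/
def laplacian (g : SmoothMetric n M) : Module.End ℝ (Form n M) :=
  superComm 1 1 (deRham n M) (codiff g)

/-- The twisted Laplacian `Δ_c = {d_c, d_c^*}`, where `d_c`, `d_c^*` have the parity of `k + 1`. -/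
def twistedLaplacian (g : SmoothMetric n M) (k : ℕ) (Ω : Form n M) : Module.End ℝ (Form n M) :=
  superComm (k + 1) (k + 1) (twistedD g k Ω) (twistedCodiff g k Ω)

/-- The operator `H_Ω = {L_Ω, Λ_Ω}` (of even parity), where `L_Ω`, `Λ_Ω` have the parity of `k`. -/
def lefschetzH (g : SmoothMetric n M) (k : ℕ) (Ω : Form n M) : Module.End ℝ (Form n M) :=
  superComm k k (wedge Ω) (wedgeAdjoint g Ω)

end Adjoint

end Metric

end Manifold

end ParallelForm

end

/-!
Three facts about a parallel `k`-form `Ω` carry the proof, with `d`, `L = Ω ∧ ·` and the structure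
operator `C` as in the statement.

* `Ω` is closed, so `d L = (-1)^k L d` (`deRham_mul_wedge`).
* The codifferential `δ = -∑ g^{ij} e_i ⌟ ∇_j` is the adjoint of `d` (`isAdjoint_codifferential`).
  Up to the density `√(det g_ij)`, the difference `⟨dα, β⟩ - ⟨α, δβ⟩` is the divergence of a vector
  field (`IsLocalMetric.sum_fderiv_sqrt_det_mul`); its integral over a chart vanishes when one of
  the forms is supported there, and a partition of unity does the rest.
* `d_c = {d, C}` is equal to `(-1)^k {δ, L}` (`twistedD_eq`).  Indeed `d = ∑ dxⁱ ∧ ∇_i`, and `∇`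
  commutes with `L` and with `C` because `Ω` is parallel, so that both sides are, up to the same
  sign, the operator `-∑ ((dxⁱ)^♯ ⌟ Ω) ∧ ∇_i` (`IsLocalMetric.extD_structure_sub`).

The adjoint of `L` is contraction with `Ω` (`isAdjoint_contractForm`), so the adjoint of `d_c` is
`(-1)^k {Λ, d}`.  Taking adjoints reverses products, and an operator is determined by its adjoint
since the pairing of forms is positive definite (`form_eq_of_formInner_eq`).  The identities are
then formal consequences of `d² = 0`, of `d L = (-1)^k L d`, of the two expressions for `d_c`, and
of the adjoints of these relations, by the super Jacobi identity: `{d, d_c} = 0` because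
`d_c = {d, C}`, `{δ, d_c} = 0` because `d_c = ± {δ, L}`, and
`[Δ, L] = ± {d, d_c} ± {δ, {d, L}} = 0` (`laplacian_comm_of_superComm`); the formula for the twisted
Laplacian is `superComm_bracket_bracket`.

The codifferential is defined chart by chart.  The coordinate expressions agree on overlaps because
each of them represents the functional `α ↦ (dα, β)` on forms supported there (`chartCodiff_eq`), so
that no transformation rule for the Christoffel symbols is needed.
-/

noncomputable section
namespace ParallelForm

/-! ### Linear algebra of the inner product on exterior forms -/

section Algebra
variable {V W : Type*} [AddCommGroup V] [Module ℝ V] [AddCommGroup W] [Module ℝ W]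

theorem covec_mul_covec (ξ η : Module.Dual ℝ V) :
    (covec ξ * covec η : Ext V) = - (covec η * covec ξ) :=
  eq_neg_of_add_eq_zero_left (ExteriorAlgebra.ι_add_mul_swap _ _)

theorem involute_covec (ξ : Module.Dual ℝ V) :
    CliffordAlgebra.involute (covec ξ : Ext V) = - covec ξ := CliffordAlgebra.involute_ι _

theorem involute_of_mem {m : ℕ} {a : Ext V} (ha : a ∈ ⋀[ℝ]^m (Module.Dual ℝ V)) :
    CliffordAlgebra.involute a = (-1 : ℝ) ^ m • a := by
  induction m generalizing a with
  | zero =>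
    simp only [ExteriorAlgebra.exteriorPower, pow_zero, Submodule.mem_one] at ha
    obtain ⟨t, rfl⟩ := ha
    simp
  | succ m ih =>
    simp only [ExteriorAlgebra.exteriorPower, pow_succ'] at ha
    refine Submodule.mul_induction_on ha ?_ ?_
    · rintro _ ⟨ξ, rfl⟩ y hy
      have h : CliffordAlgebra.involute (ExteriorAlgebra.ι ℝ ξ) = _ := involute_covec ξ
      rw [map_mul, h, ih hy, pow_succ]
      simp
    · intro x y hx hy; simp [hx, hy]

theorem involute_interior (v : V) (a : Ext V) :
    CliffordAlgebra.involute (interior v a) = - interior v (CliffordAlgebra.involute a) := by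
  induction a using covec_induction with
  | h1 => simp [interior_one]
  | hadd a b ha hb => simp [ha, hb]; abel
  | hsmul r a ha => simp [ha]
  | hmul ξ a ha =>
    simp [interior_covec_mul, ha]

theorem extInner_add_left (S : Module.Dual ℝ V →ₗ[ℝ] V) (a a' b : Ext V) :
    extInner S (a + a') b = extInner S a b + extInner S a' b := by simp [extInner]

theorem extInner_smul_left (S : Module.Dual ℝ V →ₗ[ℝ] V) (r : ℝ) (a b : Ext V) :
    extInner S (r • a) b = r * extInner S a b := by simp [extInner]

theorem extInner_add_right (S : Module.Dual ℝ V →ₗ[ℝ] V) (a b b' : Ext V) :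
    extInner S a (b + b') = extInner S a b + extInner S a b' := by simp [extInner]

theorem extInner_smul_right (S : Module.Dual ℝ V →ₗ[ℝ] V) (r : ℝ) (a b : Ext V) :
    extInner S a (r • b) = r * extInner S a b := by simp [extInner]

/-- `extInner S` as a bilinear form. -/
def extInnerB (S : Module.Dual ℝ V →ₗ[ℝ] V) : Ext V →ₗ[ℝ] Ext V →ₗ[ℝ] ℝ :=
  LinearMap.mk₂ ℝ (extInner S) (extInner_add_left S) (extInner_smul_left S)
    (extInner_add_right S) (extInner_smul_right S)

theorem extInnerB_apply (S : Module.Dual ℝ V →ₗ[ℝ] V) (a b : Ext V) :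
    extInnerB S a b = extInner S a b := rfl

theorem extInner_sum_left {J : Type*} (s : Finset J) (S : Module.Dual ℝ V →ₗ[ℝ] V)
    (a : J → Ext V) (b : Ext V) :
    extInner S (∑ j ∈ s, a j) b = ∑ j ∈ s, extInner S (a j) b := by
  simp only [← extInnerB_apply, map_sum, LinearMap.sum_apply]

theorem extInner_sum_right {J : Type*} (s : Finset J) (S : Module.Dual ℝ V →ₗ[ℝ] V)
    (a : Ext V) (b : J → Ext V) :
    extInner S a (∑ j ∈ s, b j) = ∑ j ∈ s, extInner S a (b j) := by
  simp only [← extInnerB_apply, map_sum]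

theorem extInner_sub_right (S : Module.Dual ℝ V →ₗ[ℝ] V) (a b b' : Ext V) :
    extInner S a (b - b') = extInner S a b - extInner S a b' := by
  simp only [← extInnerB_apply, map_sub]

theorem extInner_neg_right (S : Module.Dual ℝ V →ₗ[ℝ] V) (a b : Ext V) :
    extInner S a (-b) = - extInner S a b := by
  simp only [← extInnerB_apply, map_neg]

theorem extInner_zero_left (S : Module.Dual ℝ V →ₗ[ℝ] V) (b : Ext V) : extInner S 0 b = 0 := by
  simp only [← extInnerB_apply, map_zero, LinearMap.zero_apply]

theorem extInner_zero_right (S : Module.Dual ℝ V →ₗ[ℝ] V) (b : Ext V) : extInner S b 0 = 0 := by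
  simp only [← extInnerB_apply, map_zero]

/-- For a symmetric `S`, wedging with `ξ` from the second slot is also adjoint to contraction. -/
theorem extInner_covec_mul_right {S : Module.Dual ℝ V →ₗ[ℝ] V}
    (hS : ∀ ξ η : Module.Dual ℝ V, ξ (S η) = η (S ξ))
    (ξ : Module.Dual ℝ V) (b a : Ext V) :
    extInner S b (covec ξ * a) = extInner S (interior (S ξ) b) a := by
  induction b using covec_induction generalizing a with
  | h1 => rw [extInner_one_covec_mul, interior_one, extInner_zero_left]
  | hadd b b' h h' => simp only [extInner_add_left, map_add, h, h']
  | hsmul r b h => simp only [extInner_smul_left, map_smul, h]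
  | hmul η b h =>
    rw [extInner_covec_mul, interior_covec_mul, extInner_sub_right, extInner_smul_right, h,
      interior_covec_mul, sub_eq_add_neg, sub_eq_add_neg, extInner_add_left, extInner_smul_left,
      ← neg_one_smul ℝ (covec η * _), extInner_smul_left, extInner_covec_mul, hS ξ η]
    ring

theorem extInner_symm {S : Module.Dual ℝ V →ₗ[ℝ] V}
    (hS : ∀ ξ η : Module.Dual ℝ V, ξ (S η) = η (S ξ))
    (a b : Ext V) : extInner S a b = extInner S b a := by
  induction a using covec_induction generalizing b with
  | h1 =>
    induction b using covec_induction with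
    | h1 => rfl
    | hadd b b' h h' => simp only [extInner_add_left, extInner_add_right, h, h']
    | hsmul r b h => simp only [extInner_smul_left, extInner_smul_right, h]
    | hmul η b h =>
      rw [extInner_one_covec_mul, extInner_covec_mul, interior_one, extInner_zero_right]
  | hadd a a' h h' => simp only [extInner_add_left, extInner_add_right, h, h']
  | hsmul r a h => simp only [extInner_smul_left, extInner_smul_right, h]
  | hmul η a h => rw [extInner_covec_mul, h, extInner_covec_mul_right hS]

/-- Pull-back is isometric along a map that intertwines the musical isomorphisms. -/
theorem extInner_pullback (A : V →ₗ[ℝ] W) {S : Module.Dual ℝ V →ₗ[ℝ] V}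
    {T : Module.Dual ℝ W →ₗ[ℝ] W} (h : ∀ ξ, A (S (ξ ∘ₗ A)) = T ξ) (a b : Ext W) :
    extInner S (pullback A a) (pullback A b) = extInner T a b := by
  have h1 : ∀ b : Ext W, extInner S 1 (pullback A b) = extInner T 1 b := by
    intro b
    induction b using covec_induction with
    | h1 => simp [extInner_one_one]
    | hadd b b' h h' => simp only [map_add, extInner_add_right, h, h']
    | hsmul r b h => simp only [map_smul, extInner_smul_right, h]
    | hmul η b h =>
      rw [map_mul, pullback_covec, extInner_one_covec_mul, extInner_one_covec_mul]
  induction a using covec_induction generalizing b with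
  | h1 => rw [map_one, h1]
  | hadd a a' h h' => simp only [map_add, extInner_add_left, h, h']
  | hsmul r a h => simp only [map_smul, extInner_smul_left, h]
  | hmul η a ih =>
    rw [map_mul, pullback_covec, extInner_covec_mul, extInner_covec_mul, interior_pullback, ih]
    congr 2
    exact congrArg interior (h η)

theorem extInner_mul_left (S : Module.Dual ℝ V →ₗ[ℝ] V) (w a b : Ext V) :
    extInner S (w * a) b = extInner S a (contraction S (CliffordAlgebra.reverse w) b) := by
  rw [extInner, CliffordAlgebra.reverse.map_mul, map_mul]; rfl

theorem contraction_pullback (A : V →ₗ[ℝ] W) {S : Module.Dual ℝ V →ₗ[ℝ] V}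
    {T : Module.Dual ℝ W →ₗ[ℝ] W} (h : ∀ ξ, A (S (ξ ∘ₗ A)) = T ξ) (a b : Ext W) :
    contraction S (pullback A a) (pullback A b) = pullback A (contraction T a b) := by
  induction a using covec_induction generalizing b with
  | h1 => simp
  | hadd a a' h h' => simp only [map_add, LinearMap.add_apply, h, h']
  | hsmul r a h => simp only [map_smul, LinearMap.smul_apply, h]
  | hmul η a ih =>
    have h2 : contraction S (covec (A.dualMap η)) = interior (S (A.dualMap η)) :=
      ExteriorAlgebra.lift_ι_apply _ _ _ _
    have h3 : contraction T (covec η) = interior (T η) := ExteriorAlgebra.lift_ι_apply _ _ _ _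
    rw [map_mul, pullback_covec, map_mul, map_mul, Module.End.mul_apply, Module.End.mul_apply, ih,
      h2, h3, interior_pullback]
    congr 2
    exact congrArg interior (h η)

theorem reverse_pullback (A : V →ₗ[ℝ] W) (a : Ext W) :
    CliffordAlgebra.reverse (pullback A a) = pullback A (CliffordAlgebra.reverse a) := by
  have h : ∀ (b : Ext W), CliffordAlgebra.reverse (pullback A (CliffordAlgebra.reverse b)) =
      pullback A b := by
    intro b
    induction b using covec_induction with
    | h1 => simp
    | hadd b b' h h' => simp only [map_add, h, h']
    | hsmul r b h => simp only [map_smul, h]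
    | hmul η b h =>
      have h2 : CliffordAlgebra.reverse (covec η : Ext W) = covec η :=
        CliffordAlgebra.reverse_ι _
      have h3 : CliffordAlgebra.reverse (covec (A.dualMap η) : Ext V) = covec (A.dualMap η) :=
        CliffordAlgebra.reverse_ι _
      rw [CliffordAlgebra.reverse.map_mul, map_mul, CliffordAlgebra.reverse.map_mul, h, h2,
        pullback_covec, h3, map_mul, pullback_covec]
  have := h (CliffordAlgebra.reverse a)
  rwa [CliffordAlgebra.reverse_reverse] at this

/-- Euler's identity: `∑ eⁱ ∧ (e_i ⌟ a) = p a` for a `p`-form `a`. -/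
theorem sum_covec_mul_interior {I : Type*} [Fintype I] (b : Module.Basis I ℝ V) {p : ℕ}
    {a : Ext V} (ha : a ∈ ⋀[ℝ]^p (Module.Dual ℝ V)) :
    ∑ i, covec (b.coord i) * interior (b i) a = (p : ℝ) • a := by
  classical
  induction p generalizing a with
  | zero =>
    simp only [ExteriorAlgebra.exteriorPower, pow_zero, Submodule.mem_one] at ha
    obtain ⟨t, rfl⟩ := ha
    simp [Algebra.algebraMap_eq_smul_one, interior_one]
  | succ p ih =>
    simp only [ExteriorAlgebra.exteriorPower, pow_succ'] at ha
    refine Submodule.mul_induction_on ha ?_ ?_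
    · rintro _ ⟨ξ, rfl⟩ y hy
      have h1 : ξ = ∑ i, ξ (b i) • b.coord i := b.ext fun j => by
        simp
      have h2 : ∀ i, covec (b.coord i) * interior (b i) (covec ξ * y) =
          (ξ (b i) • covec (b.coord i)) * y +
            covec ξ * (covec (b.coord i) * interior (b i) y) := by
        intro i
        rw [interior_covec_mul, mul_sub, ← mul_assoc, covec_mul_covec (b.coord i)]
        simp [mul_assoc]
      have h3 : (∑ i, ξ (b i) • covec (b.coord i) : Ext V) = covec ξ := by
        conv_rhs => rw [h1]
        simp only [map_sum, map_smul]
      change ∑ i, covec (b.coord i) * interior (b i) (covec ξ * y) = _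
      rw [Finset.sum_congr rfl fun i _ => h2 i, Finset.sum_add_distrib, ← Finset.sum_mul,
        ← Finset.mul_sum, ih hy, h3]
      push_cast
      rw [add_smul, one_smul, mul_smul_comm, add_comm]
    · intro x y hx hy; simp only [map_add, mul_add, Finset.sum_add_distrib, hx, hy, smul_add]

theorem interior_mem {p : ℕ} {a : Ext V} (ha : a ∈ ⋀[ℝ]^(p + 1) (Module.Dual ℝ V)) (v : V) :
    interior v a ∈ ⋀[ℝ]^p (Module.Dual ℝ V) := by
  induction p generalizing a with
  | zero =>
    simp only [ExteriorAlgebra.exteriorPower, zero_add, pow_one] at ha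
    obtain ⟨ξ, rfl⟩ := ha
    have := interior_covec_mul v ξ 1
    simp only [mul_one, interior_one, mul_zero, sub_zero] at this
    change interior v (covec ξ) ∈ _
    rw [this, ← Algebra.algebraMap_eq_smul_one]
    simp [ExteriorAlgebra.exteriorPower]
  | succ p ih =>
    simp only [ExteriorAlgebra.exteriorPower] at ha
    rw [pow_succ'] at ha
    refine Submodule.mul_induction_on ha ?_ ?_
    · rintro _ ⟨ξ, rfl⟩ y hy
      change interior v (covec ξ * y) ∈ _
      rw [interior_covec_mul]
      refine Submodule.sub_mem _ (Submodule.smul_mem _ _ hy) ?_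
      rw [ExteriorAlgebra.exteriorPower, pow_succ']
      exact Submodule.mul_mem_mul ⟨ξ, rfl⟩ (ih hy)
    · intro x y hx hy; rw [map_add]; exact Submodule.add_mem _ hx hy

/-- The inner product on exterior forms is positive definite.  In a basis `e_i` that is orthogonal
for the metric, `p ⟨a, a⟩ = ∑ ⟨eⁱ ∧ (e_i ⌟ a), a⟩ = ∑ sᵢ ⟨e_i ⌟ a, e_i ⌟ a⟩` with `sᵢ > 0` for a
`p`-form `a`, and forms of different degrees are orthogonal. -/
theorem extInner_self_pos {I : Type*} [Fintype I] (b : Module.Basis I ℝ V)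
    {S : Module.Dual ℝ V →ₗ[ℝ] V} (hS : ∀ ξ η : Module.Dual ℝ V, ξ (S η) = η (S ξ))
    {s : I → ℝ} (hs : ∀ i, 0 < s i)
    (hb : ∀ i, S (b.coord i) = s i • b i) {a : Ext V} (ha : a ≠ 0) : 0 < extInner S a a := by
  classical
  have key : ∀ (p : ℕ) (a c : Ext V), a ∈ ⋀[ℝ]^p (Module.Dual ℝ V) →
      (p : ℝ) * extInner S a c = ∑ i, s i * extInner S (interior (b i) a) (interior (b i) c) := by
    intro p a c ha
    rw [← extInner_smul_left, ← sum_covec_mul_interior b ha, extInner_sum_left]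
    refine Finset.sum_congr rfl fun i _ => ?_
    rw [extInner_covec_mul, hb, map_smul, LinearMap.smul_apply, extInner_smul_right]
  -- Exchanging the roles of `a` and `c` gives `p ⟨a, c⟩ = q ⟨a, c⟩`.
  have horth : ∀ (p q : ℕ) (a c : Ext V), a ∈ ⋀[ℝ]^p (Module.Dual ℝ V) →
      c ∈ ⋀[ℝ]^q (Module.Dual ℝ V) → p ≠ q → extInner S a c = 0 := by
    intro p q a c ha hc hpq
    have h1 := key p a c ha
    have h2 := key q c a hc
    simp only [extInner_symm hS c a, fun i => extInner_symm hS (interior (b i) c)] at h2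
    rw [← h2] at h1
    have h3 : ((p : ℝ) - q) * extInner S a c = 0 := by rw [sub_mul, h1, sub_self]
    refine (mul_eq_zero.mp h3).resolve_left (sub_ne_zero.mpr ?_)
    exact_mod_cast hpq
  have hpos : ∀ (p : ℕ) (a : Ext V), a ∈ ⋀[ℝ]^p (Module.Dual ℝ V) → a ≠ 0 →
      0 < extInner S a a := by
    intro p
    induction p with
    | zero =>
      intro a ha h0
      simp only [ExteriorAlgebra.exteriorPower, pow_zero, Submodule.mem_one] at ha
      obtain ⟨t, rfl⟩ := ha
      rw [Algebra.algebraMap_eq_smul_one] at h0 ⊢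
      rw [extInner_smul_left, extInner_smul_right, extInner_one_one, mul_one]
      have : t ≠ 0 := fun h => h0 (by rw [h, zero_smul])
      exact mul_self_pos.mpr this
    | succ p ih =>
      intro a ha h0
      have hnn : ∀ i, 0 ≤ s i * extInner S (interior (b i) a) (interior (b i) a) := by
        intro i
        rcases eq_or_ne (interior (b i) a) 0 with h | h
        · rw [h, extInner_zero_left, mul_zero]
        · exact (mul_pos (hs i) (ih _ (interior_mem ha _) h)).le
      -- By Euler's identity a form of positive degree with vanishing contractions is zero.
      have hex : ∃ i, interior (b i) a ≠ 0 := by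
        by_contra! hall
        have h1 := sum_covec_mul_interior b ha
        simp only [hall, mul_zero, Finset.sum_const_zero] at h1
        refine h0 ((smul_eq_zero.mp h1.symm).resolve_left ?_)
        positivity
      obtain ⟨i, hi⟩ := hex
      have h2 := key (p + 1) a a ha
      have h3 : 0 < ∑ i, s i * extInner S (interior (b i) a) (interior (b i) a) :=
        Finset.sum_pos' (fun i _ => hnn i)
          ⟨i, Finset.mem_univ i, mul_pos (hs i) (ih _ (interior_mem ha _) hi)⟩
      rw [← h2] at h3
      exact pos_of_mul_pos_right h3 (by positivity)
  -- The general case: decompose `a` into its orthogonal homogeneous components.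
  set D := DirectSum.decompose (fun p => ⋀[ℝ]^p (Module.Dual ℝ V)) a with hD
  have hsum : a = ∑ p ∈ D.support, (D p : Ext V) := (DirectSum.sum_support_decompose _ a).symm
  have hself : extInner S a a = ∑ p ∈ D.support, extInner S (D p : Ext V) (D p : Ext V) := by
    conv_lhs => rw [hsum]
    rw [extInner_sum_left]
    refine Finset.sum_congr rfl fun p hp => ?_
    rw [extInner_sum_right, Finset.sum_eq_single p]
    · intro q _ hq
      exact horth p q _ _ (D p).2 (D q).2 hq.symm
    · exact fun h => absurd hp h
  rw [hself]
  refine Finset.sum_pos (fun p hp => hpos p _ (D p).2 fun h => ?_) ?_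
  · exact (DFinsupp.mem_support_iff.mp hp) (Subtype.ext h)
  · rw [Finset.nonempty_iff_ne_empty]
    intro h
    rw [h, Finset.sum_empty] at hsum
    exact ha hsum

/-- The same, for the musical isomorphism of an inner product `B` on `V`. -/
theorem extInner_self_pos_of_inner [FiniteDimensional ℝ V] {B : LinearMap.BilinForm ℝ V}
    (hB : ∀ v w, B v w = B w v) (hpos : ∀ v, v ≠ 0 → 0 < B v v)
    {S : Module.Dual ℝ V →ₗ[ℝ] V} (hS : ∀ ξ v, B (S ξ) v = ξ v) {a : Ext V} (ha : a ≠ 0) :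
    0 < extInner S a a := by
  have hsymm : LinearMap.IsSymm B := ⟨fun v w => by simpa using hB v w⟩
  obtain ⟨b, hb⟩ := LinearMap.BilinForm.exists_orthogonal_basis hsymm
  rw [LinearMap.isOrthoᵢ_def] at hb
  have hbp : ∀ i, 0 < B (b i) (b i) := fun i => hpos _ (b.ne_zero i)
  have hinj : ∀ v w, (∀ u, B v u = B w u) → v = w := by
    intro v w h
    by_contra hne
    have := hpos (v - w) (sub_ne_zero.mpr hne)
    rw [map_sub (B (v - w)), hB (v - w) v, hB (v - w) w, h, sub_self] at this
    exact lt_irrefl 0 this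
  refine extInner_self_pos b (fun ξ η => ?_) (s := fun i => (B (b i) (b i))⁻¹)
    (fun i => inv_pos.mpr (hbp i)) (fun i => ?_) ha
  · rw [← hS ξ, ← hS η, hB]
  · refine hinj _ _ fun u => ?_
    rw [hS, map_smul, LinearMap.smul_apply, smul_eq_mul]
    have h1 : B (b i) u = ∑ j, b.repr u j * B (b i) (b j) := by
      conv_lhs => rw [← b.sum_repr u]
      simp only [map_sum, map_smul, smul_eq_mul]
    rw [h1, Finset.sum_eq_single i, mul_comm, mul_assoc, mul_inv_cancel₀ (hbp i).ne', mul_one]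
    · rfl
    · intro j _ hj
      rw [hb i j hj.symm, mul_zero]
    · simp

/-- The canonical element `∑ eⁱ ⊗ e_i` is invariant. -/
theorem sum_coord_comp_mul {I : Type*} [Fintype I] (b : Module.Basis I ℝ V) (A : V →ₗ[ℝ] V)
    (p : Module.Dual ℝ V →ₗ[ℝ] Ext V) (q : V →ₗ[ℝ] Ext V) :
    ∑ i, p (b.coord i ∘ₗ A) * q (b i) = ∑ i, p (b.coord i) * q (A (b i)) := by
  classical
  have h1 : ∀ i, b.coord i ∘ₗ A = ∑ j, b.coord i (A (b j)) • b.coord j := fun i =>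
    b.ext fun j => by simp [Finsupp.single_apply]
  have h2 : ∀ i, A (b i) = ∑ j, b.coord j (A (b i)) • b j := fun i => (b.sum_repr _).symm
  calc _ = ∑ i, ∑ j, b.coord i (A (b j)) • (p (b.coord j) * q (b i)) := by
        refine Finset.sum_congr rfl fun i _ => ?_
        rw [h1]
        simp only [map_sum, map_smul, Finset.sum_mul, smul_mul_assoc]
    _ = _ := by
        rw [Finset.sum_comm]
        refine Finset.sum_congr rfl fun i _ => ?_
        conv_rhs => rw [h2]
        simp only [map_sum, map_smul, Finset.mul_sum, mul_smul_comm]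

end Algebra

/-! ### Derivations of degree zero -/

section Algebra
variable {V : Type*} [AddCommGroup V] [Module ℝ V] [FiniteDimensional ℝ V]

/-- The derivation of `Λ^*V^*` that extends the transpose of an endomorphism `A` of `V`. -/
def derivOf (A : V →ₗ[ℝ] V) : Module.End ℝ (Ext V) := extendDerivation (covec ∘ₗ A.dualMap)

theorem derivOf_one (A : V →ₗ[ℝ] V) : derivOf A 1 = 0 := extendDerivation_one _

/-- The graded Leibniz rule on a product with a covector.  Here `s` is the sign of the derivation;
its values on covectors then have the sign `-s`. -/
theorem extendDerivation_covec_mul (p : Module.Dual ℝ V →ₗ[ℝ] Ext V) {s : ℝ}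
    (hp : ∀ ξ, CliffordAlgebra.involute (p ξ) = (-s) • p ξ) (ξ : Module.Dual ℝ V) (a : Ext V) :
    extendDerivation p (covec ξ * a) = p ξ * a + s • (covec ξ * extendDerivation p a) := by
  have h : ∀ η, p η * covec ξ = (-s) • (covec ξ * p η) := by
    intro η
    have h2 := covec_mul_eq ξ (CliffordAlgebra.involute (p η))
    rw [CliffordAlgebra.involute_involute, hp] at h2
    rw [← h2, mul_smul_comm]
  conv_rhs => rw [← extendDerivation_covec p ξ]
  simp only [extendDerivation_apply (Module.finBasis ℝ V), Finset.mul_sum, Finset.sum_mul,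
    Finset.smul_sum, ← Finset.sum_add_distrib]
  refine Finset.sum_congr rfl fun i _ => ?_
  have h1 := interior_covec_mul (Module.finBasis ℝ V i) ξ 1
  simp only [mul_one, interior_one, mul_zero, sub_zero] at h1
  rw [interior_covec_mul, mul_sub, h1, ← mul_assoc, h]
  simp [mul_assoc]

theorem derivOf_covec_mul (A : V →ₗ[ℝ] V) (ξ : Module.Dual ℝ V) (a : Ext V) :
    derivOf A (covec ξ * a) = covec (ξ ∘ₗ A) * a + covec ξ * derivOf A a := by
  have h := extendDerivation_covec_mul (covec ∘ₗ A.dualMap) (s := 1)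
    (fun ξ => by simp) ξ a
  rw [one_smul] at h
  exact h

theorem derivOf_mul (A : V →ₗ[ℝ] V) (a b : Ext V) :
    derivOf A (a * b) = derivOf A a * b + a * derivOf A b := by
  induction a using covec_induction with
  | h1 => simp [derivOf_one]
  | hadd a a' h h' => simp only [add_mul, map_add, h, h']; abel
  | hsmul r a h => simp only [smul_mul_assoc, map_smul, h, smul_add]
  | hmul ξ a h =>
    rw [mul_assoc, derivOf_covec_mul, h, derivOf_covec_mul]
    simp only [mul_add, add_mul, mul_assoc, add_assoc]

theorem derivOf_interior (A : V →ₗ[ℝ] V) (v : V) (a : Ext V) :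
    derivOf A (interior v a) = interior v (derivOf A a) - interior (A v) a := by
  induction a using covec_induction with
  | h1 => simp [interior_one, derivOf_one]
  | hadd a a' h h' => simp only [map_add, h, h']; abel
  | hsmul r a h => simp only [map_smul, h, smul_sub]
  | hmul ξ a h =>
    simp only [interior_covec_mul, derivOf_covec_mul, map_sub, map_add, map_smul, h, mul_sub,
      LinearMap.comp_apply]
    abel

end Algebra

/-! ### Derivatives of forms on open subsets of `ℝⁿ` -/

section Euclidean
variable {n : ℕ}

theorem pderiv_congr {f f' : Euc n → Ext (Euc n)} {y : Euc n} (h : f =ᶠ[nhds y] f') (v : Euc n) :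
    pderiv f y v = pderiv f' y v := by
  refine Finset.sum_congr rfl fun I _ => ?_
  have : coeff f I =ᶠ[nhds y] coeff f' I := h.mono fun z hz => by rw [coeff, hz, coeff]
  rw [this.fderiv_eq]

theorem pderiv_sum_smul {J : Type*} [Fintype J] {h : J → Euc n → ℝ} {y : Euc n}
    (hh : ∀ j, DifferentiableAt ℝ (h j) y) (w : J → Ext (Euc n)) (v : Euc n) :
    pderiv (fun y => ∑ j, h j y • w j) y v = ∑ j, fderiv ℝ (h j) y v • w j := by
  have h1 : ∀ j, w j = ∑ I, (stdForm n).repr (w j) I • stdForm n I :=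
    fun j => ((stdForm n).sum_repr (w j)).symm
  have h2 : ∀ I, fderiv ℝ (coeff (fun y => ∑ j, h j y • w j) I) y v =
      ∑ j, (stdForm n).repr (w j) I * fderiv ℝ (h j) y v := by
    intro I
    rw [coeff_sum_smul, fderiv_fun_sum fun j _ => (hh j).mul_const _]
    simp [fderiv_mul_const (hh _)]
  rw [pderiv]
  simp only [h2, Finset.sum_smul]
  rw [Finset.sum_comm]
  refine Finset.sum_congr rfl fun j _ => ?_
  conv_rhs => rw [h1 j]
  simp only [Finset.smul_sum, smul_smul, mul_comm]

theorem DiffAt.linear {f : Euc n → Ext (Euc n)} {y : Euc n} (hf : DiffAt f y)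
    (A : Ext (Euc n) →ₗ[ℝ] Ext (Euc n)) : DiffAt (fun z => A (f z)) y := by
  have : (fun z => A (f z)) = fun z => ∑ I, coeff f I z • A (stdForm n I) := by
    funext z
    conv_lhs => rw [sum_coeff f z]
    simp only [map_sum, map_smul]
  rw [this]
  exact DiffAt.sum_smul hf _

theorem pderiv_linear {f : Euc n → Ext (Euc n)} {y : Euc n} (hf : DiffAt f y)
    (A : Ext (Euc n) →ₗ[ℝ] Ext (Euc n)) (v : Euc n) :
    pderiv (fun z => A (f z)) y v = A (pderiv f y v) := by
  have : (fun z => A (f z)) = fun z => ∑ I, coeff f I z • A (stdForm n I) := by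
    funext z
    conv_lhs => rw [sum_coeff f z]
    simp only [map_sum, map_smul]
  rw [this, pderiv_sum_smul hf, pderiv, map_sum]
  simp only [map_smul]

theorem pderiv_add {f f' : Euc n → Ext (Euc n)} {y : Euc n} (hf : DiffAt f y) (hf' : DiffAt f' y)
    (v : Euc n) : pderiv (fun y => f y + f' y) y v = pderiv f y v + pderiv f' y v := by
  simp only [pderiv, ← Finset.sum_add_distrib]
  refine Finset.sum_congr rfl fun I _ => ?_
  have : coeff (fun y => f y + f' y) I = fun y => coeff f I y + coeff f' I y := by
    funext y; simp [coeff]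
  rw [this, fderiv_fun_add (hf I) (hf' I), ← add_smul]
  rfl

theorem pderiv_smul {h : Euc n → ℝ} {f : Euc n → Ext (Euc n)} {y : Euc n}
    (hh : DifferentiableAt ℝ h y) (hf : DiffAt f y) (v : Euc n) :
    pderiv (fun y => h y • f y) y v = fderiv ℝ h y v • f y + h y • pderiv f y v := by
  conv_rhs => rw [sum_coeff f y]
  simp only [pderiv, Finset.smul_sum, ← Finset.sum_add_distrib]
  refine Finset.sum_congr rfl fun I _ => ?_
  have : coeff (fun y => h y • f y) I = fun y => h y * coeff f I y := by
    funext y; simp [coeff]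
  rw [this, fderiv_fun_mul hh (hf I), smul_smul, smul_smul, ← add_smul]
  congr 1
  simp [mul_comm]; ring

theorem pderiv_sum {J : Type*} (s : Finset J) {f : J → Euc n → Ext (Euc n)} {y : Euc n}
    (hf : ∀ j, DiffAt (f j) y) (v : Euc n) :
    pderiv (fun y => ∑ j ∈ s, f j y) y v = ∑ j ∈ s, pderiv (f j) y v := by
  classical
  induction s using Finset.induction_on with
  | empty =>
    simp only [Finset.sum_empty]
    refine Finset.sum_eq_zero fun I _ => ?_
    have : coeff (fun _ => (0 : Ext (Euc n))) I = fun _ => 0 := by funext z; simp [coeff]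
    rw [this, fderiv_fun_const]
    simp
  | insert j s hj ih =>
    simp only [Finset.sum_insert hj]
    rw [pderiv_add (hf j) (DiffAt.sum s hf), ih]

theorem pderiv_mul {f f' : Euc n → Ext (Euc n)} {y : Euc n} (hf : DiffAt f y) (hf' : DiffAt f' y)
    (v : Euc n) :
    pderiv (fun y => f y * f' y) y v = pderiv f y v * f' y + f y * pderiv f' y v := by
  have : (fun y => f y * f' y) = fun y => ∑ I, coeff f I y • (stdForm n I * f' y) := by
    funext y
    conv_lhs => rw [sum_coeff f y]
    simp only [Finset.sum_mul, smul_mul_assoc]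
  have hm : ∀ I, DiffAt (fun y => stdForm n I * f' y) y := fun I =>
    hf'.linear (LinearMap.mulLeft ℝ (stdForm n I))
  rw [this, pderiv_sum _ fun I => DiffAt.smul (hf I) (hm I)]
  conv_rhs => rw [sum_coeff f y]
  rw [pderiv, Finset.sum_mul, Finset.sum_mul, ← Finset.sum_add_distrib]
  refine Finset.sum_congr rfl fun I _ => ?_
  rw [pderiv_smul (hf I) (hm I), smul_mul_assoc, smul_mul_assoc]
  congr 2
  exact pderiv_linear hf' (LinearMap.mulLeft ℝ (stdForm n I)) v

theorem SmoothOn.pderiv {f : Euc n → Ext (Euc n)} {s : Set (Euc n)} (hf : SmoothOn f s)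
    (hs : IsOpen s) (v : Euc n) : SmoothOn (fun y => ParallelForm.pderiv f y v) s :=
  SmoothOn.sum_smul (fun I => ((hf I).fderiv_of_isOpen hs (m := ∞) (by simp)).clm_apply
    contDiffOn_const) _

theorem extD_eq_sum_pderiv (f : Euc n → Ext (Euc n)) (y : Euc n) :
    extD f y = ∑ i, covec (stdCovec i) * pderiv f y (stdVec i) := by
  simp only [extD, pderiv, Finset.mul_sum]
  rw [Finset.sum_comm]
  refine Finset.sum_congr rfl fun I _ => ?_
  conv_lhs => rw [covec_eq_sum (fderiv ℝ (coeff f I) y : Euc n →ₗ[ℝ] ℝ)]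
  simp only [map_sum, map_smul, Finset.sum_mul, smul_mul_assoc, mul_smul_comm]
  rfl

theorem sum_sum_covec_mul_eq_zero {H : Fin n → Fin n → Ext (Euc n)} (h : ∀ i j, H i j = H j i) :
    ∑ i, ∑ j, covec (stdCovec i) * (covec (stdCovec j) * H i j) = 0 := by
  have hneg : ∑ i, ∑ j, covec (stdCovec i) * (covec (stdCovec j) * H i j) =
      - ∑ i, ∑ j, covec (stdCovec i) * (covec (stdCovec j) * H i j) := by
    conv_lhs => rw [Finset.sum_comm]
    simp only [← Finset.sum_neg_distrib]
    refine Finset.sum_congr rfl fun i _ => Finset.sum_congr rfl fun j _ => ?_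
    rw [← mul_assoc, covec_mul_covec, h j i, neg_mul, mul_assoc]
  have h2 : (2 : ℝ) • ∑ i, ∑ j, covec (stdCovec i) * (covec (stdCovec j) * H i j) = 0 := by
    rw [two_smul]
    exact add_eq_zero_iff_eq_neg.mpr hneg
  exact (smul_eq_zero.mp h2).resolve_left two_ne_zero

theorem extD_extD {f : Euc n → Ext (Euc n)} {s : Set (Euc n)} (hf : SmoothOn f s)
    (hs : IsOpen s) {y : Euc n} (hy : y ∈ s) : extD (extD f) y = 0 := by
  have h1 : extD f = fun z => ∑ i, covec (stdCovec i) * pderiv f z (stdVec i) :=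
    funext fun z => extD_eq_sum_pderiv f z
  have hp : ∀ i, DiffAt (fun z => pderiv f z (stdVec i)) y := fun i =>
    (hf.pderiv hs (stdVec i)).diffAt hs hy
  have hm : ∀ i, DiffAt (fun z => covec (stdCovec i) * pderiv f z (stdVec i)) y := fun i =>
    (hp i).linear (LinearMap.mulLeft ℝ (covec (stdCovec i)))
  rw [extD_eq_sum_pderiv, h1]
  have h2 : ∀ j, pderiv (fun z => ∑ i, covec (stdCovec i) * pderiv f z (stdVec i)) y (stdVec j) =
      ∑ i, covec (stdCovec i) * pderiv (fun z => pderiv f z (stdVec i)) y (stdVec j) := by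
    intro j
    rw [pderiv_sum _ hm]
    exact Finset.sum_congr rfl fun i _ =>
      pderiv_linear (hp i) (LinearMap.mulLeft ℝ (covec (stdCovec i))) _
  simp only [h2, Finset.mul_sum]
  refine sum_sum_covec_mul_eq_zero
    (H := fun j i => pderiv (fun z => pderiv f z (stdVec i)) y (stdVec j)) fun j i => ?_
  -- Second partial derivatives commute.
  have h3 : ∀ i j, pderiv (fun z => pderiv f z (stdVec i)) y (stdVec j) =
      ∑ I, fderiv ℝ (fderiv ℝ (coeff f I)) y (stdVec j) (stdVec i) • stdForm n I := by
    intro i j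
    have hd : ∀ I, DifferentiableAt ℝ (fderiv ℝ (coeff f I)) y := fun I =>
      (((hf I).fderiv_of_isOpen hs (m := ∞) (by simp)).contDiffAt
        (hs.mem_nhds hy)).differentiableAt (by simp)
    have := pderiv_sum_smul (h := fun I z => fderiv ℝ (coeff f I) z (stdVec i)) (y := y)
      (fun I => (hd I).clm_apply (differentiableAt_const _)) (fun I => stdForm n I) (stdVec j)
    refine this.trans (Finset.sum_congr rfl fun I _ => ?_)
    rw [fderiv_clm_apply (hd I) (differentiableAt_const _)]
    simp
  simp only [h3]
  refine Finset.sum_congr rfl fun I _ => ?_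
  have hsymm : IsSymmSndFDerivAt ℝ (coeff f I) y :=
    (((hf I).contDiffAt (hs.mem_nhds hy))).isSymmSndFDerivAt
      (by simpa using ENat.LEInfty.out)
  rw [hsymm]

end Euclidean

/-! ### Riemannian metrics on open subsets of `ℝⁿ` -/

section LocalMetric
variable {n : ℕ}

/-- `G` is the matrix of a smooth Riemannian metric on the open set `U`.  Of positivity, only
`det G > 0` is recorded; smoothness of `G⁻¹` is included for convenience. -/
structure IsLocalMetric (G : Euc n → Matrix (Fin n) (Fin n) ℝ) (U : Set (Euc n)) : Prop where
  isOpen : IsOpen U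
  smooth : ∀ i j, ContDiffOn ℝ ∞ (fun y => G y i j) U
  smooth_inv : ∀ i j, ContDiffOn ℝ ∞ (fun y => (G y)⁻¹ i j) U
  symm : ∀ y ∈ U, ∀ i j, G y i j = G y j i
  det_pos : ∀ y ∈ U, 0 < (G y).det

/-- The derivative `∂_l g_ij`. -/
def dMetric (G : Euc n → Matrix (Fin n) (Fin n) ℝ) (y : Euc n) (l i j : Fin n) : ℝ :=
  fderiv ℝ (fun z => G z i j) y (stdVec l)

/-- The Christoffel symbol `Γ^k_ij` of `G`. -/
def gam (G : Euc n → Matrix (Fin n) (Fin n) ℝ) (y : Euc n) (i j k : Fin n) : ℝ :=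
  (1 / 2) * ∑ l, (G y)⁻¹ k l * (dMetric G y i j l + dMetric G y j i l - dMetric G y l i j)

/-- The isomorphism `♯` of `G`, in coordinates. -/
def raise (G : Euc n → Matrix (Fin n) (Fin n) ℝ) (y : Euc n) : Module.Dual ℝ (Euc n) →ₗ[ℝ] Euc n :=
  ∑ i, ∑ j, (G y)⁻¹ i j • (LinearMap.applyₗ (R := ℝ) (stdVec i)).smulRight (stdVec j)

/-- The endomorphism `v ↦ Γ_l v` of `ℝⁿ`, `e_j ↦ ∑ Γ^k_lj e_k`. -/
def connVec (G : Euc n → Matrix (Fin n) (Fin n) ℝ) (y : Euc n) (l : Fin n) : Euc n →ₗ[ℝ] Euc n :=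
  ∑ j, ∑ k, gam G y l j k • (stdCovec j).smulRight (stdVec k)

/-- The Levi-Civita derivative `∇_l = ∂_l - Γ_l` of forms. -/
def nabla (G : Euc n → Matrix (Fin n) (Fin n) ℝ) (f : Euc n → Ext (Euc n)) (y : Euc n)
    (l : Fin n) : Ext (Euc n) :=
  pderiv f y (stdVec l) - derivOf (connVec G y l) (f y)

/-- The codifferential `-∑ g^{ij} e_i ⌟ ∇_j` of forms. -/
def localCodiff (G : Euc n → Matrix (Fin n) (Fin n) ℝ) (f : Euc n → Ext (Euc n)) (y : Euc n) :
    Ext (Euc n) :=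
  -∑ i, interior (raise G y (stdCovec i)) (nabla G f y i)

variable {G : Euc n → Matrix (Fin n) (Fin n) ℝ} {U : Set (Euc n)} {y : Euc n}

theorem stdCovec_stdVec (i j : Fin n) : stdCovec i (stdVec j) = if i = j then 1 else 0 := by
  simp [stdCovec, stdVec]

theorem raise_apply (ξ : Module.Dual ℝ (Euc n)) :
    raise G y ξ = ∑ i, ∑ j, (ξ (stdVec i) * (G y)⁻¹ i j) • stdVec j := by
  simp [raise, smul_smul, mul_comm]

theorem connVec_apply (l : Fin n) (v : Euc n) :
    connVec G y l v = ∑ j, ∑ k, (stdCovec j v * gam G y l j k) • stdVec k := by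
  simp [connVec, smul_smul, mul_comm]

theorem connVec_stdVec (l j : Fin n) :
    connVec G y l (stdVec j) = ∑ k, gam G y l j k • stdVec k := by
  rw [connVec_apply, Finset.sum_eq_single j]
  · simp
  · intro i _ hi
    simp [hi]
  · simp

theorem derivOf_connVec (l : Fin n) (a : Ext (Euc n)) :
    derivOf (connVec G y l) a =
      ∑ j, ∑ k, gam G y l j k • (covec (stdCovec j) * interior (stdVec k) a) := by
  have h : ∀ k, stdCovec k ∘ₗ connVec G y l = ∑ j, gam G y l j k • stdCovec j := by
    intro k
    refine (EuclideanSpace.basisFun (Fin n) ℝ).toBasis.ext fun j => ?_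
    have := connVec_stdVec (G := G) (y := y) l j
    simp only [OrthonormalBasis.coe_toBasis, LinearMap.comp_apply, LinearMap.sum_apply,
      LinearMap.smul_apply]
    rw [this]
    simp only [map_sum, map_smul, stdCovec_stdVec]
    simp
  rw [derivOf, extendDerivation_apply (EuclideanSpace.basisFun (Fin n) ℝ).toBasis, Finset.sum_comm]
  refine Finset.sum_congr rfl fun k _ => ?_
  rw [OrthonormalBasis.coe_toBasis, LinearMap.comp_apply]
  change covec (stdCovec k ∘ₗ connVec G y l) * _ = _
  rw [h, map_sum, Finset.sum_mul]
  simp only [map_smul, smul_mul_assoc]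

namespace IsLocalMetric

variable (hG : IsLocalMetric G U) (hy : y ∈ U)
include hG hy

theorem mul_inv : G y * (G y)⁻¹ = 1 :=
  Matrix.mul_nonsing_inv _ (isUnit_iff_ne_zero.mpr (hG.det_pos y hy).ne')

theorem inv_mul : (G y)⁻¹ * G y = 1 :=
  Matrix.nonsing_inv_mul _ (isUnit_iff_ne_zero.mpr (hG.det_pos y hy).ne')

theorem inv_symm (i j : Fin n) : (G y)⁻¹ i j = (G y)⁻¹ j i := by
  have h : (G y).transpose = G y := Matrix.ext fun i j => hG.symm y hy j i
  have h2 : ((G y)⁻¹).transpose = (G y)⁻¹ := by rw [Matrix.transpose_nonsing_inv, h]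
  conv_lhs => rw [← h2]
  rfl

theorem differentiableAt (i j : Fin n) : DifferentiableAt ℝ (fun z => G z i j) y :=
  ((hG.smooth i j).contDiffAt (hG.isOpen.mem_nhds hy)).differentiableAt (by simp)

theorem differentiableAt_inv (i j : Fin n) : DifferentiableAt ℝ (fun z => (G z)⁻¹ i j) y :=
  ((hG.smooth_inv i j).contDiffAt (hG.isOpen.mem_nhds hy)).differentiableAt (by simp)

theorem dMetric_symm (l i j : Fin n) : dMetric G y l i j = dMetric G y l j i := by
  have : (fun z => G z i j) =ᶠ[nhds y] fun z => G z j i := by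
    filter_upwards [hG.isOpen.mem_nhds hy] with z hz using hG.symm z hz i j
  rw [dMetric, this.fderiv_eq, dMetric]

/-- The connection is torsion free. -/
theorem gam_symm (i j k : Fin n) : gam G y i j k = gam G y j i k := by
  simp only [gam]
  congr 1
  refine Finset.sum_congr rfl fun l _ => ?_
  rw [hG.dMetric_symm hy l i j, add_comm]

theorem sum_metric_mul_gam (a b i : Fin n) : ∑ m, G y i m * gam G y a b m =
    (1 / 2) * (dMetric G y a b i + dMetric G y b a i - dMetric G y i a b) := by
  have h := hG.mul_inv hy
  calc _ = (1 / 2) * ∑ l, (G y * (G y)⁻¹) i l *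
        (dMetric G y a b l + dMetric G y b a l - dMetric G y l a b) := by
        simp only [gam, Matrix.mul_apply, Finset.mul_sum, Finset.sum_mul]
        rw [Finset.sum_comm]
        refine Finset.sum_congr rfl fun l _ => Finset.sum_congr rfl fun m _ => ?_
        ring
    _ = _ := by
        rw [h]
        simp [Matrix.one_apply]

/-- The connection is metric: `∂_l g_ij = ∑ (g_im Γ^m_lj + g_jm Γ^m_li)`. -/
theorem dMetric_eq (l i j : Fin n) : dMetric G y l i j =
    ∑ m, G y i m * gam G y l j m + ∑ m, G y j m * gam G y l i m := by
  rw [hG.sum_metric_mul_gam hy, hG.sum_metric_mul_gam hy, hG.dMetric_symm hy l j i,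
    hG.dMetric_symm hy i l j, hG.dMetric_symm hy j l i]
  ring

/-- The matrix identity `∂_l G = G Γ_l + Γ_lᵀ G`. -/
theorem dMetric_matrix (l : Fin n) : Matrix.of (dMetric G y l) =
    G y * Matrix.of (fun m j => gam G y l j m) + Matrix.of (fun j m => gam G y l j m) * G y := by
  ext i j
  rw [Matrix.of_apply, hG.dMetric_eq hy, Matrix.add_apply, Matrix.mul_apply, Matrix.mul_apply]
  congr 1
  refine Finset.sum_congr rfl fun m _ => ?_
  rw [Matrix.of_apply, hG.symm y hy j m, mul_comm]

/-- `∂_l g^{ij} = -∑ (Γ^i_lk g^{kj} + Γ^j_lk g^{ik})`. -/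
theorem fderiv_inv (l i j : Fin n) : fderiv ℝ (fun z => (G z)⁻¹ i j) y (stdVec l) =
    -(∑ k, gam G y l k i * (G y)⁻¹ k j + ∑ k, (G y)⁻¹ i k * gam G y l k j) := by
  set D : Matrix (Fin n) (Fin n) ℝ :=
    Matrix.of fun i j => fderiv ℝ (fun z => (G z)⁻¹ i j) y (stdVec l) with hD
  -- Differentiate `G⁻¹ G = 1`.
  have h1 : D * G y + (G y)⁻¹ * Matrix.of (dMetric G y l) = 0 := by
    ext i j
    have hev : (fun z => ∑ k, (G z)⁻¹ i k * G z k j) =ᶠ[nhds y]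
        fun _ => (1 : Matrix (Fin n) (Fin n) ℝ) i j := by
      filter_upwards [hG.isOpen.mem_nhds hy] with z hz
      rw [← hG.inv_mul hz, Matrix.mul_apply]
    have h2 := hev.fderiv_eq (𝕜 := ℝ)
    rw [fderiv_fun_const, fderiv_fun_sum fun k _ =>
      (hG.differentiableAt_inv hy i k).fun_mul (hG.differentiableAt hy k j)] at h2
    have h3 := DFunLike.congr_fun h2 (stdVec l : Euc n)
    rw [_root_.sum_apply] at h3
    rw [Matrix.add_apply, Matrix.mul_apply, Matrix.mul_apply, ← Finset.sum_add_distrib]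
    refine Eq.trans (Finset.sum_congr rfl fun k _ => ?_) h3
    rw [fderiv_fun_mul (hG.differentiableAt_inv hy i k) (hG.differentiableAt hy k j)]
    simp [hD, dMetric]
    ring
  rw [hG.dMetric_matrix hy] at h1
  have h4 : D = -(Matrix.of (fun m j => gam G y l j m) * (G y)⁻¹ +
      (G y)⁻¹ * Matrix.of (fun j m => gam G y l j m)) := by
    have h5 : D = (D * G y) * (G y)⁻¹ := by rw [mul_assoc, hG.mul_inv hy, mul_one]
    rw [h5, eq_neg_of_add_eq_zero_left h1, mul_add, ← mul_assoc, hG.inv_mul hy, one_mul, neg_mul,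
      add_mul, mul_assoc _ _ (G y)⁻¹, mul_assoc _ (G y) (G y)⁻¹, hG.mul_inv hy, mul_one]
  have h6 : D i j = _ := congrFun (congrFun h4 i) j
  rw [hD, Matrix.of_apply] at h6
  rw [h6, Matrix.neg_apply, Matrix.add_apply, Matrix.mul_apply, Matrix.mul_apply]
  rfl

end IsLocalMetric

/-- Jacobi's formula for the derivative of a determinant. -/
theorem hasFDerivAt_det {E : Type*} [NormedAddCommGroup E] [NormedSpace ℝ E]
    {A : E → Matrix (Fin n) (Fin n) ℝ} {x : E} (hA : ∀ i j, DifferentiableAt ℝ (fun z => A z i j) x)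
    (v : E) : DifferentiableAt ℝ (fun z => (A z).det) x ∧ fderiv ℝ (fun z => (A z).det) x v =
      ((A x).adjugate * Matrix.of fun i j => fderiv ℝ (fun z => A z i j) x v).trace := by
  have h1 : HasFDerivAt (fun z => (A z).det) (∑ σ : Equiv.Perm (Fin n),
      ((Equiv.Perm.sign σ : ℤ) : ℝ) • ∑ i, (∏ j ∈ Finset.univ.erase i, A x (σ j) j) •
        fderiv ℝ (fun z => A z (σ i) i) x) x := by
    simp only [Matrix.det_apply']
    exact HasFDerivAt.fun_sum fun σ _ => (HasFDerivAt.finsetProd fun i _ =>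
      (hA (σ i) i).hasFDerivAt).const_mul _
  refine ⟨h1.differentiableAt, ?_⟩
  set B : Matrix (Fin n) (Fin n) ℝ := Matrix.of fun i j => fderiv ℝ (fun z => A z i j) x v
  have h2 : ∀ i, ((A x).adjugate * B) i i = ((A x).updateCol i (B.col i)).det := by
    intro i
    rw [← Matrix.cramer_apply, Matrix.cramer_eq_adjugate_mulVec, Matrix.mul_apply]
    rfl
  rw [h1.fderiv, Matrix.trace]
  simp only [Matrix.diag_apply, h2, Matrix.det_apply']
  rw [Finset.sum_comm, _root_.sum_apply]
  refine Finset.sum_congr rfl fun σ _ => ?_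
  rw [_root_.smul_apply, _root_.sum_apply, smul_eq_mul, Finset.mul_sum]
  refine Finset.sum_congr rfl fun i _ => ?_
  rw [← Finset.prod_erase_mul _ _ (Finset.mem_univ i)]
  congr 1
  rw [_root_.smul_apply, smul_eq_mul, Matrix.updateCol_self]
  congr 1
  refine Finset.prod_congr rfl fun j hj => ?_
  rw [Matrix.updateCol_ne (Finset.ne_of_mem_erase hj)]

namespace IsLocalMetric

variable (hG : IsLocalMetric G U) (hy : y ∈ U)
include hG hy

/-- `∂_l √(det G) = √(det G) ∑ Γ^k_lk`. -/
theorem fderiv_sqrt_det (l : Fin n) :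
    DifferentiableAt ℝ (fun z => √(G z).det) y ∧ fderiv ℝ (fun z => √(G z).det) y (stdVec l) =
      √(G y).det * ∑ k, gam G y l k k := by
  obtain ⟨h1, h2⟩ := hasFDerivAt_det (fun i j => hG.differentiableAt hy i j) (stdVec l)
  have hpos := hG.det_pos y hy
  refine ⟨h1.sqrt hpos.ne', ?_⟩
  rw [fderiv_sqrt h1 hpos.ne', _root_.smul_apply, h2]
  have h3 : (G y).adjugate = (G y).det • (G y)⁻¹ := by
    rw [Matrix.inv_def, Ring.inverse_eq_inv', smul_smul, mul_inv_cancel₀ hpos.ne', one_smul]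
  have h4 : (Matrix.of fun i j => fderiv ℝ (fun z => G z i j) y (stdVec l)) =
      Matrix.of (dMetric G y l) := rfl
  have h5 : (Matrix.of (fun m j => gam G y l j m)).trace = ∑ k, gam G y l k k := rfl
  have h6 : (Matrix.of (fun j m => gam G y l j m)).trace = ∑ k, gam G y l k k := rfl
  rw [h4, hG.dMetric_matrix hy, h3, Matrix.smul_mul, Matrix.trace_smul, mul_add, ← mul_assoc,
    hG.inv_mul hy, one_mul, Matrix.trace_add, ← mul_assoc, Matrix.trace_mul_comm, ← mul_assoc,
    hG.mul_inv hy, one_mul, h5, h6, smul_eq_mul, smul_eq_mul]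
  have h7 : √(G y).det ≠ 0 := (Real.sqrt_pos.mpr hpos).ne'
  have h8 : (G y).det = √(G y).det * √(G y).det := (Real.mul_self_sqrt hpos.le).symm
  field_simp
  nth_rewrite 1 [h8]
  ring

theorem raise_symm (ξ η : Module.Dual ℝ (Euc n)) : ξ (raise G y η) = η (raise G y ξ) := by
  rw [raise_apply, raise_apply]
  simp only [map_sum, map_smul, smul_eq_mul]
  rw [Finset.sum_comm]
  refine Finset.sum_congr rfl fun i _ => Finset.sum_congr rfl fun j _ => ?_
  rw [hG.inv_symm hy]
  ring

/-- The isomorphism `♯` is parallel: its derivative is `∂_l ♯ = -Γ_l ♯ - ♯ Γ_lᵀ`. -/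
theorem sum_fderiv_inv_smul (l : Fin n) (ξ : Module.Dual ℝ (Euc n)) :
    ∑ i, ∑ j, (ξ (stdVec i) * fderiv ℝ (fun z => (G z)⁻¹ i j) y (stdVec l)) • stdVec j =
      -(connVec G y l (raise G y ξ) + raise G y (ξ ∘ₗ connVec G y l)) := by
  have h1 : connVec G y l (raise G y ξ) =
      ∑ i, ∑ j, (ξ (stdVec i) * ∑ k, (G y)⁻¹ i k * gam G y l k j) • stdVec j := by
    rw [raise_apply]
    simp only [map_sum, map_smul, connVec_stdVec, Finset.smul_sum, smul_smul, Finset.mul_sum,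
      Finset.sum_smul, mul_assoc]
    exact Finset.sum_congr rfl fun i _ => Finset.sum_comm
  have h2 : raise G y (ξ ∘ₗ connVec G y l) =
      ∑ i, ∑ j, (ξ (stdVec i) * ∑ k, gam G y l k i * (G y)⁻¹ k j) • stdVec j := by
    rw [raise_apply]
    simp only [LinearMap.comp_apply, connVec_stdVec, map_sum, map_smul, smul_eq_mul,
      Finset.sum_mul, Finset.mul_sum, Finset.sum_smul]
    rw [Finset.sum_comm, Finset.sum_congr rfl fun j _ => Finset.sum_comm, Finset.sum_comm]
    refine Finset.sum_congr rfl fun i _ => Finset.sum_congr rfl fun j _ =>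
      Finset.sum_congr rfl fun k _ => ?_
    congr 1
    ring
  rw [h1, h2, ← Finset.sum_add_distrib, ← Finset.sum_neg_distrib]
  refine Finset.sum_congr rfl fun i _ => ?_
  rw [← Finset.sum_add_distrib, ← Finset.sum_neg_distrib]
  refine Finset.sum_congr rfl fun j _ => ?_
  rw [hG.fderiv_inv hy, ← add_smul, ← neg_smul]
  congr 1
  ring

end IsLocalMetric
end LocalMetric

/-! ### The Levi-Civita connection and the inner product of forms in coordinates -/

section LocalMetric
variable {n : ℕ} {G : Euc n → Matrix (Fin n) (Fin n) ℝ} {U : Set (Euc n)} {y : Euc n}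

theorem interior_raise (ξ : Module.Dual ℝ (Euc n)) (a : Ext (Euc n)) :
    interior (raise G y ξ) a =
      ∑ i, ∑ j, (ξ (stdVec i) * (G y)⁻¹ i j) • interior (stdVec j) a := by
  rw [raise_apply]
  simp only [map_sum, map_smul, LinearMap.sum_apply, LinearMap.smul_apply]

theorem nabla_mul {f f' : Euc n → Ext (Euc n)} (hf : DiffAt f y) (hf' : DiffAt f' y) (l : Fin n) :
    nabla G (fun z => f z * f' z) y l = nabla G f y l * f' y + f y * nabla G f' y l := by
  simp only [nabla, pderiv_mul hf hf', derivOf_mul]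
  noncomm_ring

theorem nabla_interior {f : Euc n → Ext (Euc n)} (hf : DiffAt f y) (v : Euc n) (l : Fin n) :
    nabla G (fun z => interior v (f z)) y l =
      interior v (nabla G f y l) + interior (connVec G y l v) (f y) := by
  simp only [nabla, pderiv_linear hf, derivOf_interior, map_sub]
  abel

theorem nabla_sum {J : Type*} (s : Finset J) {f : J → Euc n → Ext (Euc n)}
    (hf : ∀ j, DiffAt (f j) y) (l : Fin n) :
    nabla G (fun z => ∑ j ∈ s, f j z) y l = ∑ j ∈ s, nabla G (f j) y l := by
  simp only [nabla, pderiv_sum s hf, map_sum, Finset.sum_sub_distrib]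

namespace IsLocalMetric

variable (hG : IsLocalMetric G U)
include hG

theorem diffAt_interior_raise (hy : y ∈ U) {f : Euc n → Ext (Euc n)} (hf : DiffAt f y)
    (ξ : Module.Dual ℝ (Euc n)) : DiffAt (fun z => interior (raise G z ξ) (f z)) y := by
  simp only [interior_raise]
  exact DiffAt.sum _ fun i => DiffAt.sum _ fun j =>
    DiffAt.smul ((hG.differentiableAt_inv hy i j).const_mul _) (hf.linear _)

theorem smoothOn_interior_raise {f : Euc n → Ext (Euc n)} (hf : SmoothOn f U)
    (ξ : Module.Dual ℝ (Euc n)) : SmoothOn (fun z => interior (raise G z ξ) (f z)) U := by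
  simp only [interior_raise]
  exact SmoothOn.sum fun i => SmoothOn.sum fun j =>
    SmoothOn.smul (contDiffOn_const.mul (hG.smooth_inv i j)) (hf.linear _)

/-- Contraction with `♯ξ` satisfies the Leibniz rule for the connection. -/
theorem nabla_interior_raise (hy : y ∈ U) {f : Euc n → Ext (Euc n)} (hf : DiffAt f y)
    (ξ : Module.Dual ℝ (Euc n)) (l : Fin n) :
    nabla G (fun z => interior (raise G z ξ) (f z)) y l =
      interior (raise G y ξ) (nabla G f y l) -
        interior (raise G y (ξ ∘ₗ connVec G y l)) (f y) := by
  have h1 : pderiv (fun z => interior (raise G z ξ) (f z)) y (stdVec l) =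
      interior (∑ i, ∑ j, (ξ (stdVec i) * fderiv ℝ (fun z => (G z)⁻¹ i j) y (stdVec l)) •
        stdVec j) (f y) + interior (raise G y ξ) (pderiv f y (stdVec l)) := by
    have hd : ∀ i j, DifferentiableAt ℝ (fun z => ξ (stdVec i) * (G z)⁻¹ i j) y := fun i j =>
      (hG.differentiableAt_inv hy i j).const_mul _
    simp only [interior_raise]
    rw [pderiv_sum _ fun i => DiffAt.sum _ fun j => DiffAt.smul (hd i j) (hf.linear _)]
    simp only [map_sum, map_smul, LinearMap.sum_apply, LinearMap.smul_apply,
      ← Finset.sum_add_distrib]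
    refine Finset.sum_congr rfl fun i _ => ?_
    rw [pderiv_sum _ fun j => DiffAt.smul (hd i j) (hf.linear _)]
    refine Finset.sum_congr rfl fun j _ => ?_
    rw [pderiv_smul (hd i j) (hf.linear _), pderiv_linear hf,
      fderiv_const_mul (hG.differentiableAt_inv hy i j)]
    rfl
  rw [nabla, h1, hG.sum_fderiv_inv_smul hy, derivOf_interior, nabla]
  simp only [map_neg, map_add, map_sub, LinearMap.neg_apply, LinearMap.add_apply]
  abel

/-- The exterior derivative is the antisymmetrization of the connection. -/
theorem extD_eq_sum_nabla (hy : y ∈ U) (f : Euc n → Ext (Euc n)) :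
    extD f y = ∑ i, covec (stdCovec i) * nabla G f y i := by
  have h : ∑ i, covec (stdCovec i) * derivOf (connVec G y i) (f y) = 0 := by
    have h1 := sum_sum_covec_mul_eq_zero
      -- `Γ^k_ij` is symmetric in `i, j`, while `dxⁱ ∧ dxʲ` is alternating.
      (H := fun i j => ∑ k, gam G y i j k • interior (stdVec k) (f y))
      (fun i j => by simp only [hG.gam_symm hy i j])
    rw [← h1]
    refine Finset.sum_congr rfl fun i _ => ?_
    rw [derivOf_connVec, Finset.mul_sum]
    refine Finset.sum_congr rfl fun j _ => ?_
    simp only [Finset.mul_sum, mul_smul_comm]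
  simp only [nabla, mul_sub, Finset.sum_sub_distrib, h, sub_zero, extD_eq_sum_pderiv]

/-- The derivative of the inner product of forms with constant coefficients. -/
theorem fderiv_extInner_const (hy : y ∈ U) (a b : Ext (Euc n)) :
    DifferentiableAt ℝ (fun z => extInner (raise G z) a b) y ∧
      ∀ l, fderiv ℝ (fun z => extInner (raise G z) a b) y (stdVec l) =
        -(extInner (raise G y) (derivOf (connVec G y l) a) b +
          extInner (raise G y) a (derivOf (connVec G y l) b)) := by
  induction a using covec_induction generalizing b with
  | h1 =>
    have h1 : ∀ z, extInner (raise G z) 1 b = ExteriorAlgebra.algebraMapInv b := fun z => by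
      simp [extInner]
    simp only [h1]
    refine ⟨differentiableAt_const _, fun l => ?_⟩
    -- `Γ_l b` has no component of degree zero.
    rw [derivOf_one, extInner_zero_left, derivOf_connVec, extInner_sum_right]
    simp [extInner_sum_right, extInner_smul_right, extInner_one_covec_mul]
  | hadd a a' h h' =>
    simp only [extInner_add_left, map_add]
    refine ⟨(h b).1.fun_add (h' b).1, fun l => ?_⟩
    rw [fderiv_fun_add (h b).1 (h' b).1, _root_.add_apply, (h b).2, (h' b).2]
    ring
  | hsmul r a h =>
    simp only [extInner_smul_left, map_smul]
    refine ⟨(h b).1.const_mul r, fun l => ?_⟩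
    rw [fderiv_const_mul (h b).1, _root_.smul_apply, (h b).2, smul_eq_mul]
    ring
  | hmul ξ a h =>
    have e : ∀ z, extInner (raise G z) (covec ξ * a) b = ∑ i, ∑ j,
        (ξ (stdVec i) * (G z)⁻¹ i j) * extInner (raise G z) a (interior (stdVec j) b) := by
      intro z
      rw [extInner_covec_mul, interior_raise]
      simp only [extInner_sum_right, extInner_smul_right]
    have hd : ∀ i j, DifferentiableAt ℝ (fun z => ξ (stdVec i) * (G z)⁻¹ i j) y := fun i j =>
      (hG.differentiableAt_inv hy i j).const_mul _
    have hd2 : ∀ i j, DifferentiableAt ℝ (fun z => (ξ (stdVec i) * (G z)⁻¹ i j) *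
        extInner (raise G z) a (interior (stdVec j) b)) y := fun i j =>
      (hd i j).fun_mul (h _).1
    refine ⟨?_, fun l => ?_⟩
    · simp only [e]
      exact DifferentiableAt.fun_sum fun i _ => DifferentiableAt.fun_sum fun j _ => hd2 i j
    have h1 : fderiv ℝ (fun z => extInner (raise G z) (covec ξ * a) b) y (stdVec l) =
        extInner (raise G y) a (interior (∑ i, ∑ j,
          (ξ (stdVec i) * fderiv ℝ (fun z => (G z)⁻¹ i j) y (stdVec l)) • stdVec j) b) -
        (extInner (raise G y) (derivOf (connVec G y l) a) (interior (raise G y ξ) b) +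
          extInner (raise G y) a (∑ i, ∑ j, (ξ (stdVec i) * (G y)⁻¹ i j) •
            derivOf (connVec G y l) (interior (stdVec j) b))) := by
      simp only [e]
      rw [fderiv_fun_sum fun i _ => DifferentiableAt.fun_sum fun j _ => hd2 i j,
        _root_.sum_apply, interior_raise]
      simp only [map_sum, map_smul, LinearMap.sum_apply, LinearMap.smul_apply,
        extInner_sum_right, extInner_smul_right, ← Finset.sum_add_distrib,
        ← Finset.sum_sub_distrib]
      refine Finset.sum_congr rfl fun i _ => ?_
      rw [fderiv_fun_sum fun j _ => hd2 i j, _root_.sum_apply]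
      refine Finset.sum_congr rfl fun j _ => ?_
      rw [fderiv_fun_mul (hd i j) (h _).1, fderiv_const_mul (hG.differentiableAt_inv hy i j),
        _root_.add_apply, _root_.smul_apply, _root_.smul_apply, _root_.smul_apply, (h _).2]
      simp only [smul_eq_mul]
      ring
    have h2 : ∑ i, ∑ j, (ξ (stdVec i) * (G y)⁻¹ i j) •
        derivOf (connVec G y l) (interior (stdVec j) b) =
        derivOf (connVec G y l) (interior (raise G y ξ) b) := by
      rw [interior_raise]
      simp only [map_sum, map_smul]
    rw [h1, h2, hG.sum_fderiv_inv_smul hy, derivOf_interior, derivOf_covec_mul, extInner_add_left,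
      extInner_covec_mul, extInner_covec_mul, extInner_covec_mul]
    simp only [map_neg, map_add, LinearMap.neg_apply, LinearMap.add_apply, extInner_neg_right,
      extInner_add_right, extInner_sub_right]
    ring

theorem contDiffOn_extInner_const (a b : Ext (Euc n)) :
    ContDiffOn ℝ ∞ (fun z => extInner (raise G z) a b) U := by
  induction a using covec_induction generalizing b with
  | h1 =>
    have h1 : ∀ z, extInner (raise G z) 1 b = ExteriorAlgebra.algebraMapInv b := fun z => by
      simp [extInner]
    simp only [h1]
    exact contDiffOn_const
  | hadd a a' h h' =>
    simp only [extInner_add_left]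
    exact (h b).add (h' b)
  | hsmul r a h =>
    simp only [extInner_smul_left]
    exact contDiffOn_const.mul (h b)
  | hmul ξ a h =>
    simp only [extInner_covec_mul, interior_raise, extInner_sum_right, extInner_smul_right]
    exact ContDiffOn.sum fun i _ => ContDiffOn.sum fun j _ =>
      (contDiffOn_const.mul (hG.smooth_inv i j)).mul (h _)

omit hG in
theorem extInner_eq_sum (f h : Euc n → Ext (Euc n)) (z : Euc n) :
    extInner (raise G z) (f z) (h z) = ∑ I, ∑ J, coeff f I z * (coeff h J z *
      extInner (raise G z) (stdForm n I) (stdForm n J)) := by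
  conv_lhs => rw [sum_coeff f z, sum_coeff h z]
  rw [extInner_sum_left]
  simp only [extInner_sum_right, extInner_smul_left, extInner_smul_right]
  exact Finset.sum_congr rfl fun I _ => Finset.sum_congr rfl fun J _ => by ring

theorem contDiffOn_extInner {f h : Euc n → Ext (Euc n)} (hf : SmoothOn f U) (hh : SmoothOn h U) :
    ContDiffOn ℝ ∞ (fun z => extInner (raise G z) (f z) (h z)) U := by
  simp only [extInner_eq_sum f h]
  exact ContDiffOn.sum fun I _ => ContDiffOn.sum fun J _ =>
    (hf I).mul ((hh J).mul (hG.contDiffOn_extInner_const _ _))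

/-- The Levi-Civita connection is compatible with the inner product of forms. -/
theorem fderiv_extInner (hy : y ∈ U) {f h : Euc n → Ext (Euc n)} (hf : DiffAt f y)
    (hh : DiffAt h y) (l : Fin n) :
    DifferentiableAt ℝ (fun z => extInner (raise G z) (f z) (h z)) y ∧
    fderiv ℝ (fun z => extInner (raise G z) (f z) (h z)) y (stdVec l) =
      extInner (raise G y) (nabla G f y l) (h y) + extInner (raise G y) (f y) (nabla G h y l) := by
  have hE := fun I J => hG.fderiv_extInner_const hy (stdForm n I) (stdForm n J)
  have hd : ∀ I J, DifferentiableAt ℝ (fun z => coeff f I z * (coeff h J z *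
      extInner (raise G z) (stdForm n I) (stdForm n J))) y := fun I J =>
    (hf I).fun_mul ((hh J).fun_mul (hE I J).1)
  refine ⟨?_, ?_⟩
  · simp only [extInner_eq_sum f h]
    exact DifferentiableAt.fun_sum fun I _ => DifferentiableAt.fun_sum fun J _ => hd I J
  have h1 : fderiv ℝ (fun z => extInner (raise G z) (f z) (h z)) y (stdVec l) =
      extInner (raise G y) (pderiv f y (stdVec l)) (h y) +
      extInner (raise G y) (f y) (pderiv h y (stdVec l)) -
      (extInner (raise G y) (derivOf (connVec G y l) (f y)) (h y) +
        extInner (raise G y) (f y) (derivOf (connVec G y l) (h y))) := by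
    simp only [extInner_eq_sum f h]
    rw [fderiv_fun_sum fun I _ => DifferentiableAt.fun_sum fun J _ => hd I J, _root_.sum_apply]
    conv_rhs => rw [sum_coeff f y, sum_coeff h y]
    simp only [pderiv, map_sum, map_smul]
    rw [extInner_sum_left, extInner_sum_left, extInner_sum_left, extInner_sum_left]
    simp only [extInner_sum_right, extInner_smul_left, extInner_smul_right,
      ← Finset.sum_add_distrib, ← Finset.sum_sub_distrib]
    refine Finset.sum_congr rfl fun I _ => ?_
    rw [fderiv_fun_sum fun J _ => hd I J, _root_.sum_apply]
    refine Finset.sum_congr rfl fun J _ => ?_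
    rw [fderiv_fun_mul (hf I) ((hh J).fun_mul (hE I J).1), fderiv_fun_mul (hh J) (hE I J).1]
    simp only [_root_.add_apply, _root_.smul_apply, smul_eq_mul, (hE I J).2]
    ring
  rw [h1]
  simp only [nabla, extInner_sub_right, extInner_symm (hG.raise_symm hy) _ (h y)]
  ring

/-- The difference of `⟨df, h⟩` and `⟨f, d^*h⟩` is a divergence. -/
theorem sum_fderiv_sqrt_det_mul (hy : y ∈ U) {f h : Euc n → Ext (Euc n)} (hf : DiffAt f y)
    (hh : DiffAt h y) :
    ∑ i, fderiv ℝ (fun z => √(G z).det *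
      extInner (raise G z) (f z) (interior (raise G z (stdCovec i)) (h z))) y (stdVec i) =
    √(G y).det * (extInner (raise G y) (extD f y) (h y) -
      extInner (raise G y) (f y) (localCodiff G h y)) := by
  have hi := fun i => hG.diffAt_interior_raise hy hh (stdCovec i)
  have h1 : ∀ i, fderiv ℝ (fun z => √(G z).det *
      extInner (raise G z) (f z) (interior (raise G z (stdCovec i)) (h z))) y (stdVec i) =
      √(G y).det * (extInner (raise G y) (covec (stdCovec i) * nabla G f y i) (h y) +
        extInner (raise G y) (f y) (interior (raise G y (stdCovec i)) (nabla G h y i)) +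
        extInner (raise G y) (f y) (interior (raise G y ((∑ k, gam G y i k k) • stdCovec i -
          stdCovec i ∘ₗ connVec G y i)) (h y))) := by
    intro i
    obtain ⟨ha, hb⟩ := hG.fderiv_extInner hy hf (hi i) i
    rw [fderiv_fun_mul (hG.fderiv_sqrt_det hy i).1 ha, _root_.add_apply, _root_.smul_apply,
      _root_.smul_apply, hb, (hG.fderiv_sqrt_det hy i).2, hG.nabla_interior_raise hy hh,
      extInner_covec_mul]
    simp only [map_sub, map_smul, LinearMap.sub_apply, LinearMap.smul_apply, extInner_sub_right,
      extInner_smul_right, smul_eq_mul]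
    ring
  -- The derivative of the density cancels the Christoffel symbols `∑ Γ^i_ij` that remain from
  -- `∇_i ((dxⁱ)^♯)`; this uses that the connection is torsion free.
  have h2 : ∑ i, ((∑ k, gam G y i k k) • stdCovec i - stdCovec i ∘ₗ connVec G y i) = 0 := by
    refine (EuclideanSpace.basisFun (Fin n) ℝ).toBasis.ext fun j => ?_
    have h3 := fun i => connVec_stdVec (G := G) (y := y) i j
    simp only [OrthonormalBasis.coe_toBasis, LinearMap.sum_apply, LinearMap.sub_apply,
      LinearMap.smul_apply, LinearMap.comp_apply, h3, map_sum, map_smul, stdCovec_stdVec,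
      LinearMap.zero_apply]
    simp [Finset.sum_sub_distrib, hG.gam_symm hy]
  simp only [h1, ← Finset.mul_sum, Finset.sum_add_distrib, ← extInner_sum_left,
    ← extInner_sum_right, ← LinearMap.sum_apply, ← map_sum, h2]
  rw [← hG.extD_eq_sum_nabla hy, localCodiff, extInner_neg_right]
  simp [extInner_zero_right]

end IsLocalMetric
end LocalMetric

section LocalMetric
variable {n : ℕ} {G : Euc n → Matrix (Fin n) (Fin n) ℝ} {U : Set (Euc n)} {y : Euc n}

/-- The symbol `ξ ↦ ξ^♯ ⌟ w` of the structure operator of a form `w`, in coordinates. -/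
def localSymbol (G : Euc n → Matrix (Fin n) (Fin n) ℝ) (w : Euc n → Ext (Euc n)) (y : Euc n) :
    Module.Dual ℝ (Euc n) →ₗ[ℝ] Ext (Euc n) :=
  interior.flip (w y) ∘ₗ raise G y

theorem localSymbol_apply (w : Euc n → Ext (Euc n)) (ξ : Module.Dual ℝ (Euc n)) :
    localSymbol G w y ξ = interior (raise G y ξ) (w y) := rfl

theorem extendDerivation_localSymbol (w : Euc n → Ext (Euc n)) (a : Ext (Euc n)) :
    extendDerivation (localSymbol G w y) a =
      ∑ i, interior (raise G y (stdCovec i)) (w y) * interior (stdVec i) a := by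
  rw [extendDerivation_apply (EuclideanSpace.basisFun (Fin n) ℝ).toBasis]
  simp only [OrthonormalBasis.coe_toBasis]
  rfl

namespace IsLocalMetric

variable (hG : IsLocalMetric G U)
include hG

theorem contDiffOn_gam (i j k : Fin n) : ContDiffOn ℝ ∞ (fun y => gam G y i j k) U := by
  have hd : ∀ l i j, ContDiffOn ℝ ∞ (fun y => dMetric G y l i j) U := fun l i j =>
    ((hG.smooth i j).fderiv_of_isOpen hG.isOpen (m := ∞) (by simp)).clm_apply contDiffOn_const
  exact contDiffOn_const.mul (ContDiffOn.sum fun l _ =>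
    (hG.smooth_inv k l).mul (((hd _ _ _).add (hd _ _ _)).sub (hd _ _ _)))

theorem smoothOn_nabla {f : Euc n → Ext (Euc n)} (hf : SmoothOn f U) (l : Fin n) :
    SmoothOn (fun y => nabla G f y l) U := by
  have h : SmoothOn (fun y => pderiv f y (stdVec l) + (-1 : ℝ) • ∑ j, ∑ k, gam G y l j k •
      (covec (stdCovec j) * interior (stdVec k) (f y))) U :=
    (hf.pderiv hG.isOpen _).add (SmoothOn.smul contDiffOn_const (SmoothOn.sum fun j =>
      SmoothOn.sum fun k => SmoothOn.smul (hG.contDiffOn_gam l j k)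
        ((hf.linear (interior (stdVec k))).linear (LinearMap.mulLeft ℝ (covec (stdCovec j))))))
  refine h.congr fun y _ => ?_
  rw [nabla, derivOf_connVec, neg_one_smul, sub_eq_add_neg]

theorem smoothOn_localCodiff {f : Euc n → Ext (Euc n)} (hf : SmoothOn f U) :
    SmoothOn (localCodiff G f) U := by
  have h : SmoothOn
      (fun y => (-1 : ℝ) • ∑ i, interior (raise G y (stdCovec i)) (nabla G f y i)) U :=
    SmoothOn.smul contDiffOn_const (SmoothOn.sum fun i =>
      hG.smoothOn_interior_raise (hG.smoothOn_nabla hf i) _)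
  refine h.congr fun y _ => ?_
  rw [localCodiff, neg_one_smul]

/-- Contraction of smooth forms is smooth. -/
theorem smoothOn_contraction {f h : Euc n → Ext (Euc n)} (hf : SmoothOn f U) (hh : SmoothOn h U) :
    SmoothOn (fun y => contraction (raise G y) (f y) (h y)) U := by
  have key : ∀ (a : Ext (Euc n)) (h : Euc n → Ext (Euc n)), SmoothOn h U →
      SmoothOn (fun y => contraction (raise G y) a (h y)) U := by
    intro a
    induction a using covec_induction with
    | h1 => intro h hh; simpa using hh
    | hadd a b ha hb =>
      intro h hh
      simpa only [map_add, LinearMap.add_apply] using (ha h hh).add (hb h hh)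
    | hsmul r a ha =>
      intro h hh
      simpa only [map_smul, LinearMap.smul_apply] using SmoothOn.smul contDiffOn_const (ha h hh)
    | hmul ξ a ha =>
      intro h hh
      have e : ∀ y, contraction (raise G y) (covec ξ) = interior (raise G y ξ) := fun y =>
        ExteriorAlgebra.lift_ι_apply _ _ _ _
      simpa only [map_mul, Module.End.mul_apply, e] using
        hG.smoothOn_interior_raise (ha h hh) ξ
  refine (SmoothOn.sum fun I => SmoothOn.smul (hf I) (key (stdForm n I) h hh)).congr fun y _ => ?_
  conv_lhs => rw [sum_coeff f y]
  simp only [map_sum, map_smul, LinearMap.sum_apply, LinearMap.smul_apply]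

/-- A parallel form is closed. -/
theorem extD_eq_zero (hy : y ∈ U) {w : Euc n → Ext (Euc n)} (hw : ∀ l, nabla G w y l = 0) :
    extD w y = 0 := by
  simp [hG.extD_eq_sum_nabla hy, hw]

/-- The structure operator of a parallel form commutes with the connection. -/
theorem nabla_structure (hy : y ∈ U) {w f : Euc n → Ext (Euc n)} (hwd : DiffAt w y)
    (hf : DiffAt f y) (hw : ∀ l, nabla G w y l = 0) (l : Fin n) :
    nabla G (fun z => extendDerivation (localSymbol G w z) (f z)) y l =
      extendDerivation (localSymbol G w y) (nabla G f y l) := by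
  have hi : ∀ i, DiffAt (fun z => interior (raise G z (stdCovec i)) (w z)) y := fun i =>
    hG.diffAt_interior_raise hy hwd _
  have hj : ∀ i, DiffAt (fun z => interior (stdVec i) (f z)) y := fun i => hf.linear _
  -- The terms in `Γ_l` cancel by the invariance of `∑ dxⁱ ⊗ e_i`.
  have hinv := sum_coord_comp_mul (EuclideanSpace.basisFun (Fin n) ℝ).toBasis (connVec G y l)
    (localSymbol G w y) (interior.flip (f y))
  simp only [OrthonormalBasis.coe_toBasis, LinearMap.flip_apply] at hinv
  change ∑ i, interior (raise G y (stdCovec i ∘ₗ connVec G y l)) (w y) *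
    interior (stdVec i) (f y) = ∑ i, interior (raise G y (stdCovec i)) (w y) *
    interior (connVec G y l (stdVec i)) (f y) at hinv
  simp only [extendDerivation_localSymbol]
  rw [nabla_sum _ fun i => (hi i).mul (hj i)]
  simp only [nabla_mul (hi _) (hj _), hG.nabla_interior_raise hy hwd, nabla_interior hf, hw,
    map_zero, zero_sub, neg_mul, mul_add, Finset.sum_add_distrib, Finset.sum_neg_distrib, hinv]
  abel

/-- For a parallel `k`-form `w` with structure operator `C`, the graded commutator of `d` and `C`
is, up to the sign `(-1)^k`, that of `d^*` and `w ∧ ·`: both are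
`-∑ ((dxⁱ)^♯ ⌟ w) ∧ ∇_i`, up to the same sign. -/
theorem extD_structure_sub (hy : y ∈ U) {w f : Euc n → Ext (Euc n)} (hwd : DiffAt w y)
    (hf : DiffAt f y) (hw : ∀ l, nabla G w y l = 0) {k : ℕ}
    (hk : CliffordAlgebra.involute (w y) = (-1 : ℝ) ^ k • w y) :
    extD (fun z => extendDerivation (localSymbol G w z) (f z)) y -
        (-1 : ℝ) ^ k • extendDerivation (localSymbol G w y) (extD f y) =
      (-1 : ℝ) ^ k • (localCodiff G (fun z => w z * f z) y -
        (-1 : ℝ) ^ k • (w y * localCodiff G f y)) := by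
  have hsq : (-1 : ℝ) ^ k * (-1 : ℝ) ^ k = 1 := by rw [← mul_pow]; simp
  have h1 : extD (fun z => extendDerivation (localSymbol G w z) (f z)) y -
        (-1 : ℝ) ^ k • extendDerivation (localSymbol G w y) (extD f y) =
      -((-1 : ℝ) ^ k • ∑ i, interior (raise G y (stdCovec i)) (w y) * nabla G f y i) := by
    -- `ξ^♯ ⌟ w` has the parity of `k - 1`.
    have hp : ∀ ξ, CliffordAlgebra.involute (localSymbol G w y ξ) =
        (-(-1 : ℝ) ^ k) • localSymbol G w y ξ := fun ξ => by
      rw [localSymbol_apply, involute_interior, hk, map_smul, neg_smul]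
    rw [hG.extD_eq_sum_nabla hy, hG.extD_eq_sum_nabla hy]
    simp only [hG.nabla_structure hy hwd hf hw, map_sum, extendDerivation_covec_mul _ hp,
      Finset.sum_add_distrib, smul_add, ← Finset.smul_sum, smul_smul, hsq, one_smul,
      localSymbol_apply]
    abel
  have h2 : localCodiff G (fun z => w z * f z) y - (-1 : ℝ) ^ k • (w y * localCodiff G f y) =
      - ∑ i, interior (raise G y (stdCovec i)) (w y) * nabla G f y i := by
    simp only [localCodiff, nabla_mul hwd hf, hw, zero_mul, zero_add, interior_mul, hk,
      smul_mul_assoc, Finset.sum_add_distrib, ← Finset.smul_sum, mul_neg, Finset.mul_sum]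
    simp
  rw [h1, h2, smul_neg]

end IsLocalMetric

theorem localCodiff_congr {f f' : Euc n → Ext (Euc n)} (h : f =ᶠ[nhds y] f') :
    localCodiff G f y = localCodiff G f' y := by
  simp only [localCodiff, nabla, pderiv_congr h, h.eq_of_nhds]

theorem localCodiff_zero (y : Euc n) :
    localCodiff G (fun _ => 0) y = 0 := by
  have h : ∀ v, pderiv (fun _ : Euc n => (0 : Ext (Euc n))) y v = 0 := fun v => by
    simpa using pderiv_linear (diffAt_const (n := n) 0 y) 0 v
  simp [localCodiff, nabla, h]

theorem nabla_add {f h : Euc n → Ext (Euc n)} (hf : DiffAt f y) (hh : DiffAt h y) (l : Fin n) :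
    nabla G (fun z => f z + h z) y l = nabla G f y l + nabla G h y l := by
  simp only [nabla, pderiv_add hf hh, map_add]
  abel

theorem localCodiff_add {f h : Euc n → Ext (Euc n)} (hf : DiffAt f y) (hh : DiffAt h y) :
    localCodiff G (fun z => f z + h z) y = localCodiff G f y + localCodiff G h y := by
  simp only [localCodiff, nabla_add hf hh, map_add, Finset.sum_add_distrib, neg_add]

theorem localCodiff_smul {f : Euc n → Ext (Euc n)} (hf : DiffAt f y) (r : ℝ) :
    localCodiff G (fun z => r • f z) y = r • localCodiff G f y := by
  have h : ∀ v, pderiv (fun z => r • f z) y v = r • pderiv f y v := fun v => by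
    simpa using pderiv_smul (differentiableAt_const r) hf v
  simp only [localCodiff, nabla, h, map_smul, ← smul_sub, ← Finset.smul_sum, smul_neg]

end LocalMetric

/-! ### Forms on a manifold in coordinates -/

section Manifold
variable {n : ℕ} {M : Type*} [TopologicalSpace M] [ChartedSpace (Euc n) M]
  [IsManifold (𝓡 n) ∞ M]

theorem metricCoeff_posDef (g : SmoothMetric n M) {c : M} {y : Euc n} (hy : y ∈ chartDom n c) :
    (metricCoeff g c y).PosDef := by
  refine Matrix.PosDef.of_dotProduct_mulVec_pos ?_ fun {v} hv => ?_
  · ext i j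
    simp [metricCoeff, Matrix.conjTranspose_apply, g.symm]
  · set u := ∑ i, v i • frameBasis hy i with hu
    have hu0 : u ≠ 0 := by
      intro h0
      apply hv
      funext i
      have := congrArg (fun t => (frameBasis hy).repr t i) h0
      simpa [hu, Finsupp.single_apply] using this
    have h1 := g.pos _ u hu0
    refine h1.trans_eq ?_
    simp only [hu, map_sum, map_smul, _root_.sum_apply, _root_.smul_apply, smul_eq_mul,
      dotProduct, Matrix.mulVec, metricCoeff, Matrix.of_apply, frameBasis_apply, Finset.mul_sum,
      Pi.star_apply, star_trivial]
    rw [Finset.sum_comm]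
    refine Finset.sum_congr rfl fun i _ => Finset.sum_congr rfl fun j _ => ?_
    ring

theorem isLocalMetric (g : SmoothMetric n M) (c : M) :
    IsLocalMetric (metricCoeff g c) (chartDom n c) where
  isOpen := isOpen_chartDom c
  smooth := contDiffOn_metricCoeff g c
  smooth_inv i j := contDiffOn_metricCoeff_inv g c i j fun _ hy => (metricCoeff_inv g hy).1
  symm _ _ _ _ := g.symm _ _ _
  det_pos _ hy := (metricCoeff_posDef g hy).det_pos

theorem sharp_symm (g : SmoothMetric n M) (x : M) (ξ η : Module.Dual ℝ (TangentSpace (𝓡 n) x)) :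
    ξ (sharp g x η) = η (sharp g x ξ) := by
  rw [← inner_sharp g x ξ, ← inner_sharp g x η, g.symm]

theorem frame_raise (g : SmoothMetric n M) {c : M} {y : Euc n} (hy : y ∈ chartDom n c)
    (ξ : Module.Dual ℝ (TangentSpace (𝓡 n) (chartInv c y))) :
    frame c y (raise (metricCoeff g c) y (ξ ∘ₗ frame c y)) = sharp g _ ξ := by
  have h : ξ = ∑ i, ξ (frameBasis hy i) • (frameBasis hy).coord i :=
    (frameBasis hy).ext fun j => by simp
  conv_rhs => rw [h]
  simp only [map_sum, map_smul, (metricCoeff_inv g hy).2, raise_apply, frameBasis_apply,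
    Finset.smul_sum, smul_smul]
  rfl

theorem extInner_inChart (g : SmoothMetric n M) {c : M} {y : Euc n} (hy : y ∈ chartDom n c)
    (a b : RoughForm n M) :
    extInner (raise (metricCoeff g c) y) (inChart c a y) (inChart c b y) =
      extInner (sharp g (chartInv c y)).toLinearMap (a (chartInv c y)) (b (chartInv c y)) :=
  extInner_pullback _ (frame_raise g hy) _ _

theorem extInner_sharp_self_pos (g : SmoothMetric n M) (x : M) {a : Ext (TangentSpace (𝓡 n) x)}
    (ha : a ≠ 0) : 0 < extInner (sharp g x).toLinearMap a a :=
  extInner_self_pos_of_inner (B := LinearMap.mk₂ ℝ (fun v w => g.inner x v w)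
      (by simp) (by simp) (by simp) (by simp))
    (fun v w => g.symm x v w) (fun v hv => g.pos x v hv) (inner_sharp g x) ha

theorem covDeriv_eq_nabla (g : SmoothMetric n M) (α : Form n M) (c : M) (y : Euc n) (i : Fin n) :
    covDeriv g α c y i = nabla (metricCoeff g c) (inChart c α.1) y i := by
  rw [nabla, derivOf_connVec]
  rfl

theorem inChart_structureOp (g : SmoothMetric n M) (Ω α : Form n M) {c : M} {y : Euc n}
    (hy : y ∈ chartDom n c) : inChart c (structureOp g Ω α).1 y =
      extendDerivation (localSymbol (metricCoeff g c) (inChart c Ω.1) y) (inChart c α.1 y) := by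
  change pullback (frame c y) (extendDerivation (structureSymbol g Ω _) (α.1 _)) = _
  rw [extendDerivation_apply (frameBasis hy), extendDerivation_localSymbol, map_sum]
  refine Finset.sum_congr rfl fun i _ => ?_
  have h : raise (metricCoeff g c) y (stdCovec i) = ∑ j, (metricCoeff g c y)⁻¹ i j • stdVec j := by
    rw [raise_apply, Finset.sum_eq_single i]
    · simp
    · intro j _ hj; simp [hj.symm]
    · simp
  rw [map_mul, structureSymbol, LinearMap.comp_apply, LinearEquiv.coe_coe,
    (metricCoeff_inv g hy).2 i, LinearMap.flip_apply, frameBasis_apply, h]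
  simp only [map_sum, map_smul, LinearMap.sum_apply, LinearMap.smul_apply, inChart,
    interior_pullback]

theorem inChart_deRham (α : Form n M) {c : M} {y : Euc n} (hy : y ∈ chartDom n c) :
    inChart c (deRham n M α).1 y = extD (inChart c α.1) y := inChart_roughD α hy

omit [IsManifold (𝓡 n) ∞ M] in
theorem inChart_wedge (Ω α : Form n M) (c : M) (y : Euc n) :
    inChart c (wedge Ω α).1 y = inChart c Ω.1 y * inChart c α.1 y :=
  map_mul (pullback (frame c y)) _ _

omit [IsManifold (𝓡 n) ∞ M] in
theorem chartInv_extChartAt (c : M) {x : M} (hx : x ∈ (extChartAt (𝓡 n) c).source) :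
    chartInv c (extChartAt (𝓡 n) c x) = x := (extChartAt (𝓡 n) c).left_inv hx

omit [IsManifold (𝓡 n) ∞ M] in
theorem mem_chartDom_self (x : M) : extChartAt (𝓡 n) x x ∈ chartDom n x := mem_extChartAt_target x

/-- The value of a form at a point is determined by its expression in a chart. -/
theorem pullback_coframe_inChart (a : RoughForm n M) {c : M} {y : Euc n} (hy : y ∈ chartDom n c) :
    pullback (coframe c (chartInv c y)) (inChart c a y) = a (chartInv c y) := by
  rw [inChart, ← pullback_comp, frame_comp_coframe hy, pullback_id]

/-- Two rough forms agree if they agree in all charts. -/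
theorem roughForm_ext {a b : RoughForm n M}
    (h : ∀ c, ∀ y ∈ chartDom n c, inChart c a y = inChart c b y) : a = b := by
  funext x
  have hy := mem_chartDom_self (n := n) x
  have hx := chartInv_extChartAt (n := n) x (mem_extChartAt_source x)
  have h1 := pullback_coframe_inChart a hy
  rw [h x _ hy, pullback_coframe_inChart b hy] at h1
  rw [← hx]
  exact h1.symm

theorem form_ext {a b : Form n M}
    (h : ∀ c, ∀ y ∈ chartDom n c, inChart c a.1 y = inChart c b.1 y) : a = b :=
  Subtype.ext (roughForm_ext h)

/-- `d² = 0`. -/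
theorem deRham_mul_deRham : deRham n M * deRham n M = 0 := by
  refine LinearMap.ext fun α => form_ext fun c y hy => ?_
  rw [Module.End.mul_apply, inChart_deRham _ hy, LinearMap.zero_apply]
  have h : inChart c (deRham n M α).1 =ᶠ[nhds y] extD (inChart c α.1) := by
    filter_upwards [(isOpen_chartDom c).mem_nhds hy] with z hz using inChart_deRham α hz
  rw [extD_congr h, extD_extD (α.2 c) (isOpen_chartDom c) hy]
  exact (map_zero (pullback (frame c y))).symm

omit [IsManifold (𝓡 n) ∞ M] in
theorem involute_inChart {Ω : Form n M} {k : ℕ} (hdeg : IsHomogeneous Ω k) (c : M) (y : Euc n) :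
    CliffordAlgebra.involute (inChart c Ω.1 y) = (-1 : ℝ) ^ k • inChart c Ω.1 y := by
  have h : ∀ a : Ext (TangentSpace (𝓡 n) (chartInv c y)),
      CliffordAlgebra.involute (pullback (frame c y) a) =
        pullback (frame c y) (CliffordAlgebra.involute a) := by
    intro a
    induction a using covec_induction with
    | h1 => simp
    | hadd a b ha hb => simp only [map_add, ha, hb]
    | hsmul r a ha => simp only [map_smul, ha]
    | hmul ξ a ha =>
      rw [map_mul, map_mul, map_mul, map_mul, ha, pullback_covec, involute_covec, involute_covec,
        map_neg, pullback_covec]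
  rw [inChart, h, involute_of_mem (hdeg _), map_smul]

/-- A parallel `k`-form `Ω` is closed, so `d(Ω ∧ η) = (-1)^k Ω ∧ dη`. -/
theorem deRham_mul_wedge (g : SmoothMetric n M) {k : ℕ} {Ω : Form n M} (hdeg : IsHomogeneous Ω k)
    (hpar : IsParallel g Ω) :
    deRham n M * wedge Ω = (-1 : ℝ) ^ k • (wedge Ω * deRham n M) := by
  refine LinearMap.ext fun α => form_ext fun c y hy => ?_
  have h1 : inChart c (wedge Ω α).1 = fun z => inChart c Ω.1 z * inChart c α.1 z :=
    funext fun z => inChart_wedge Ω α c z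
  have h2 : inChart c (((-1 : ℝ) ^ k • (wedge Ω * deRham n M)) α).1 y =
      (-1 : ℝ) ^ k • inChart c (wedge Ω (deRham n M α)).1 y :=
    map_smul (pullback (frame c y)) _ _
  rw [Module.End.mul_apply, inChart_deRham _ hy, h1, h2, inChart_wedge, inChart_deRham _ hy,
    extD_mul ((Ω.2 c).diffAt (isOpen_chartDom c) hy) ((α.2 c).diffAt (isOpen_chartDom c) hy),
    (isLocalMetric g c).extD_eq_zero hy fun l => ?_, involute_inChart hdeg, zero_mul, zero_add,
    smul_mul_assoc]
  rw [← covDeriv_eq_nabla]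
  exact hpar c y hy l

end Manifold

/-! ### The Riemannian measure -/

section Measure
variable {n : ℕ} {M : Type*} [TopologicalSpace M] [ChartedSpace (Euc n) M]

theorem continuousOn_chartInv (c : M) : ContinuousOn (chartInv c) (chartDom n c) :=
  continuousOn_extChartAt_symm c

theorem isOpen_chartInv_preimage (c : M) {A : Set M} (hA : IsOpen A) :
    IsOpen (chartInv c ⁻¹' A ∩ chartDom n c) := by
  rw [Set.inter_comm]
  exact (continuousOn_chartInv c).isOpen_inter_preimage (isOpen_chartDom c) hA

variable [IsManifold (𝓡 n) ∞ M]

theorem continuousOn_sqrt_det (g : SmoothMetric n M) (c : M) :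
    ContinuousOn (fun y => √(metricCoeff g c y).det) (chartDom n c) :=
  (contDiffOn_det (contDiffOn_metricCoeff g c)).continuousOn.sqrt

/-- The metric in terms of its coefficients in a chart. -/
theorem inner_eq_sum (g : SmoothMetric n M) {c : M} {z : Euc n} (hz : z ∈ chartDom n c) {x : M}
    (hx : chartInv c z = x) (u v : TangentSpace (𝓡 n) x) :
    g.inner x u v = ∑ j, (∑ i, stdCovec i (coframe c x u) * metricCoeff g c z i j) *
      stdCovec j (coframe c x v) := by
  subst hx
  have h : ∀ u, u = ∑ i, stdCovec i (coframe c (chartInv c z) u) • frame c z (stdVec i) := by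
    intro u
    have h1 : frame c z (coframe c (chartInv c z) u) = u :=
      DFunLike.congr_fun (frame_comp_coframe hz) u
    have h2 : coframe c (chartInv c z) u =
        ∑ i, stdCovec i (coframe c (chartInv c z) u) • stdVec i := by
      have := (EuclideanSpace.basisFun (Fin n) ℝ).toBasis.sum_repr (coframe c (chartInv c z) u)
      simp only [OrthonormalBasis.coe_toBasis] at this
      exact this.symm
    conv_lhs => rw [← h1, h2]
    simp only [map_sum, map_smul]
  conv_lhs => rw [h u, h v]
  simp only [map_sum, map_smul, _root_.sum_apply, _root_.smul_apply, smul_eq_mul, metricCoeff,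
    Matrix.of_apply, Finset.sum_mul, Finset.mul_sum]
  refine Finset.sum_congr rfl fun i _ => Finset.sum_congr rfl fun j _ => ?_
  ring

/-- The behaviour of `det g_ij` under a change of coordinates. -/
theorem det_metricCoeff_transition (g : SmoothMetric n M) {c c' : M} {y : Euc n}
    (hy : y ∈ chartDom n c) (hy' : chartInv c y ∈ (extChartAt (𝓡 n) c').source) :
    (metricCoeff g c y).det = (fderiv ℝ (transition c c') y).det ^ 2 *
      (metricCoeff g c' (transition c c' y)).det := by
  have hz : transition c c' y ∈ chartDom n c' := (extChartAt (𝓡 n) c').map_source hy'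
  set b := (EuclideanSpace.basisFun (Fin n) ℝ).toBasis
  set J := LinearMap.toMatrix b b (fderiv ℝ (transition c c') y : Euc n →ₗ[ℝ] Euc n) with hJ
  have h1 : metricCoeff g c y = J.transpose * metricCoeff g c' (transition c c' y) * J := by
    ext i j
    rw [Matrix.mul_apply]
    simp only [Matrix.mul_apply]
    conv_lhs => rw [metricCoeff, Matrix.of_apply,
      inner_eq_sum g hz (chartInv_extChartAt c' hy')]
    have h2 : ∀ v, coframe c' (chartInv c y) (frame c y v) =
        (fderiv ℝ (transition c c') y : Euc n →ₗ[ℝ] Euc n) v := fun v => by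
      rw [fderiv_transition hy hy']; rfl
    simp only [h2, Matrix.transpose_apply, hJ, LinearMap.toMatrix_apply, b,
      OrthonormalBasis.coe_toBasis]
    rfl
  rw [h1, Matrix.det_mul, Matrix.det_mul, Matrix.det_transpose, hJ, LinearMap.det_toMatrix]
  change _ = (LinearMap.det (fderiv ℝ (transition c c') y : Euc n →ₗ[ℝ] Euc n)) ^ 2 * _
  ring

variable [MeasurableSpace M] [BorelSpace M]

omit [IsManifold (𝓡 n) ∞ M] in
theorem aemeasurable_chartInv (c : M) :
    AEMeasurable (chartInv c) (volume.restrict (chartDom n c)) :=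
  (continuousOn_chartInv c).aemeasurable (isOpen_chartDom c).measurableSet

omit [MeasurableSpace M] [BorelSpace M] in
theorem aemeasurable_density (g : SmoothMetric n M) (c : M) :
    AEMeasurable (fun y => ENNReal.ofReal (√(metricCoeff g c y).det))
      (volume.restrict (chartDom n c)) :=
  ((continuousOn_sqrt_det g c).aemeasurable (isOpen_chartDom c).measurableSet).ennreal_ofReal

theorem chartVolume_apply (g : SmoothMetric n M) (c : M) {A : Set M} (hA : MeasurableSet A) :
    chartVolume g c A = ∫⁻ y in chartInv c ⁻¹' A ∩ chartDom n c,
      ENNReal.ofReal (√(metricCoeff g c y).det) := by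
  rw [chartVolume, Measure.map_apply_of_aemeasurable
    ((aemeasurable_chartInv c).mono_ac (withDensity_absolutelyContinuous _ _)) hA,
    withDensity_apply', Measure.restrict_restrict' (isOpen_chartDom c).measurableSet]

omit [IsManifold (𝓡 n) ∞ M] in
theorem measurableSet_chartInv_preimage (c : M) {A : Set M} (hA : MeasurableSet A) :
    MeasurableSet (chartInv c ⁻¹' A ∩ chartDom n c) := by
  have h := (isOpen_chartDom (n := n) c).measurableSet.subtype_image
    ((continuousOn_iff_continuous_domRestrict.mp (continuousOn_chartInv c)).measurable hA)
  convert h using 1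
  ext y
  simp [and_comm]

theorem chartVolume_inter_source (g : SmoothMetric n M) (c : M) {A : Set M}
    (hA : MeasurableSet A) :
    chartVolume g c (A ∩ (extChartAt (𝓡 n) c).source) = chartVolume g c A := by
  rw [chartVolume_apply g c (hA.inter (isOpen_extChartAt_source c).measurableSet),
    chartVolume_apply g c hA]
  congr 2
  ext y
  simp only [Set.mem_inter_iff, Set.mem_preimage]
  exact ⟨fun h => ⟨h.1.1, h.2⟩, fun h => ⟨⟨h.1, (extChartAt (𝓡 n) c).map_target h.2⟩, h.2⟩⟩

/-- The measures of two charts agree on the overlap. -/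
theorem chartVolume_eq (g : SmoothMetric n M) (c c' : M) {A : Set M} (hA : MeasurableSet A)
    (h : A ⊆ (extChartAt (𝓡 n) c).source) (h' : A ⊆ (extChartAt (𝓡 n) c').source) :
    chartVolume g c' A = chartVolume g c A := by
  set s := chartInv c ⁻¹' A ∩ chartDom n c with hs
  have hsub : ∀ y ∈ s, chartInv c y ∈ (extChartAt (𝓡 n) c').source := fun y hy => h' hy.1
  have himage : chartInv c' ⁻¹' A ∩ chartDom n c' = transition c c' '' s := by
    ext z
    constructor
    · rintro ⟨hz1, hz2⟩
      refine ⟨extChartAt (𝓡 n) c (chartInv c' z), ⟨?_, (extChartAt (𝓡 n) c).map_source (h hz1)⟩, ?_⟩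
      · rw [Set.mem_preimage, chartInv_extChartAt c (h hz1)]
        exact hz1
      · rw [transition, chartInv_extChartAt c (h hz1)]
        exact (extChartAt (𝓡 n) c').right_inv hz2
    · rintro ⟨y, hy, rfl⟩
      refine ⟨?_, (extChartAt (𝓡 n) c').map_source (hsub y hy)⟩
      rw [Set.mem_preimage, transition, chartInv_extChartAt c' (hsub y hy)]
      exact hy.1
  have hinj : Set.InjOn (transition c c') s := by
    intro y hy z hz hyz
    have h1 := congrArg (chartInv c') hyz
    rw [transition, transition, chartInv_extChartAt c' (hsub y hy),
      chartInv_extChartAt c' (hsub z hz)] at h1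
    have h2 := congrArg (extChartAt (𝓡 n) c) h1
    rwa [(extChartAt (𝓡 n) c).right_inv hy.2, (extChartAt (𝓡 n) c).right_inv hz.2] at h2
  -- In the change of variables the Jacobian cancels that of `√(det g_ij)`.
  rw [chartVolume_apply g c' hA, chartVolume_apply g c hA, himage,
    lintegral_image_eq_lintegral_abs_det_fderiv_mul volume (measurableSet_chartInv_preimage c hA)
      (fun y hy => ((contDiffAt_transition hy.2 (hsub y hy)).differentiableAt
        (by simp)).hasFDerivAt.hasFDerivWithinAt) hinj]
  refine setLIntegral_congr_fun (measurableSet_chartInv_preimage c hA) fun y hy => ?_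
  rw [det_metricCoeff_transition g hy.2 (hsub y hy), Real.sqrt_mul (sq_nonneg _),
    Real.sqrt_sq_eq_abs, ENNReal.ofReal_mul (abs_nonneg _)]

/-- In each chart the Riemannian measure is the measure of the chart.  Every `chartVolume g c'` is
at most the sum of `chartVolume g c` and the measure which is infinite on all non-empty sets in the
complement of the domain of the chart at `c`. -/
theorem riemannianVolume_restrict (g : SmoothMetric n M) (c : M) :
    (riemannianVolume g).restrict (extChartAt (𝓡 n) c).source = chartVolume g c := by
  have hsrc : MeasurableSet (extChartAt (𝓡 n) c).source :=
    (isOpen_extChartAt_source c).measurableSet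
  set ν := chartVolume g c +
    ((⊤ : ENNReal) • Measure.count).restrict (extChartAt (𝓡 n) c).sourceᶜ with hν
  refine le_antisymm ?_ ?_
  · have hle : riemannianVolume g ≤ ν := by
      refine iSup_le fun c' => Measure.le_iff.mpr fun A hA => ?_
      rw [hν, Measure.add_apply, Measure.restrict_apply hA, Measure.smul_apply]
      rcases (A ∩ (extChartAt (𝓡 n) c).sourceᶜ).eq_empty_or_nonempty with he | he
      · have hsub : A ⊆ (extChartAt (𝓡 n) c).source := by
          rwa [← Set.sdiff_eq, Set.sdiff_eq_empty] at he
        rw [he, measure_empty, smul_zero, add_zero, ← chartVolume_inter_source g c' hA,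
          chartVolume_eq g c c' (hA.inter (isOpen_extChartAt_source c').measurableSet)
            (Set.inter_subset_left.trans hsub) Set.inter_subset_right]
        exact measure_mono Set.inter_subset_left
      · have : (Measure.count : Measure M) (A ∩ (extChartAt (𝓡 n) c).sourceᶜ) ≠ 0 := by
          rw [Ne, Measure.count_eq_zero_iff]
          exact he.ne_empty
        rw [smul_eq_mul, ENNReal.top_mul this, add_top]
        exact le_top
    refine Measure.le_iff.mpr fun A hA => ?_
    rw [Measure.restrict_apply hA]
    refine (hle _).trans ?_
    rw [hν, Measure.add_apply, Measure.restrict_apply (hA.inter hsrc),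
      Set.inter_assoc, Set.inter_compl_self, Set.inter_empty, measure_empty, add_zero,
      chartVolume_inter_source g c hA]
  · refine Measure.le_iff.mpr fun A hA => ?_
    rw [Measure.restrict_apply hA, ← chartVolume_inter_source g c hA]
    exact (le_iSup (fun c => chartVolume g c) c : chartVolume g c ≤ riemannianVolume g) _

theorem riemannianVolume_isLocallyFinite (g : SmoothMetric n M) :
    IsLocallyFiniteMeasure (riemannianVolume g) := by
  refine ⟨fun x => ?_⟩
  have hy := mem_chartDom_self (n := n) x
  set y := extChartAt (𝓡 n) x x with hydef
  obtain ⟨r, hr, hball⟩ := Metric.nhds_basis_closedBall.mem_iff.mp ((isOpen_chartDom x).mem_nhds hy)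
  obtain ⟨B, hB⟩ := (isCompact_closedBall y r).exists_bound_of_continuousOn
    ((continuousOn_sqrt_det g x).mono hball)
  set V := (extChartAt (𝓡 n) x).source ∩ extChartAt (𝓡 n) x ⁻¹' Metric.ball y r with hV
  have hVo : IsOpen V :=
    (continuousOn_extChartAt x).isOpen_inter_preimage (isOpen_extChartAt_source x)
      Metric.isOpen_ball
  refine ⟨V, hVo.mem_nhds ⟨mem_extChartAt_source x, Metric.mem_ball_self hr⟩, ?_⟩
  have h1 : riemannianVolume g V = chartVolume g x V := by
    rw [← riemannianVolume_restrict g x, Measure.restrict_apply hVo.measurableSet,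
      Set.inter_eq_left.mpr Set.inter_subset_left]
  rw [h1, chartVolume_apply g x hVo.measurableSet]
  have hsub : chartInv x ⁻¹' V ∩ chartDom n x ⊆ Metric.closedBall y r := by
    rintro z ⟨hz1, hz2⟩
    have h2 : extChartAt (𝓡 n) x (chartInv x z) ∈ Metric.ball y r := hz1.2
    rw [(extChartAt (𝓡 n) x).right_inv hz2] at h2
    exact Metric.ball_subset_closedBall h2
  calc _ ≤ ∫⁻ y in Metric.closedBall y r, ENNReal.ofReal (√(metricCoeff g x y).det) :=
        lintegral_mono_set hsub
    _ ≤ ∫⁻ _ in Metric.closedBall y r, ENNReal.ofReal B :=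
        setLIntegral_mono' Metric.isClosed_closedBall.measurableSet fun z hz =>
          ENNReal.ofReal_le_ofReal ((le_abs_self _).trans (hB z hz))
    _ < ⊤ := by
        rw [setLIntegral_const]
        exact ENNReal.mul_lt_top ENNReal.ofReal_lt_top (isCompact_closedBall y r).measure_lt_top

theorem riemannianVolume_isOpenPos (g : SmoothMetric n M) :
    (riemannianVolume g).IsOpenPosMeasure := by
  refine ⟨fun U hU hne h0 => ?_⟩
  obtain ⟨x, hx⟩ := hne
  have h1 : chartVolume g x U = 0 := le_antisymm
    (((le_iSup (fun c => chartVolume g c) x : chartVolume g x ≤ riemannianVolume g) U).trans_eq h0)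
    zero_le
  rw [chartVolume, Measure.map_apply_of_aemeasurable
    ((aemeasurable_chartInv x).mono_ac (withDensity_absolutelyContinuous _ _))
      hU.measurableSet] at h1
  have h2 : volume.restrict (chartDom n x) ≪ (volume.restrict (chartDom n x)).withDensity
      fun y => ENNReal.ofReal (√(metricCoeff g x y).det) :=
    withDensity_absolutelyContinuous' (aemeasurable_density g x)
      ((ae_restrict_mem (isOpen_chartDom x).measurableSet).mono fun y hy => by
        rw [Ne, ENNReal.ofReal_eq_zero, not_le]
        exact Real.sqrt_pos.mpr ((isLocalMetric g x).det_pos y hy))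
  have h3 := h2 h1
  rw [Measure.restrict_apply' (isOpen_chartDom x).measurableSet] at h3
  refine ((isOpen_chartInv_preimage x hU).measure_pos volume
    ⟨extChartAt (𝓡 n) x x, ?_, mem_chartDom_self x⟩).ne' h3
  rw [Set.mem_preimage, chartInv_extChartAt x (mem_extChartAt_source x)]
  exact hx

/-- Integrals of functions supported in a chart. -/
theorem integral_riemannianVolume (g : SmoothMetric n M) (c : M) {F : M → ℝ} (hF : Continuous F)
    (h0 : ∀ x ∉ (extChartAt (𝓡 n) c).source, F x = 0) :
    ∫ x, F x ∂(riemannianVolume g) =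
      ∫ y in chartDom n c, √(metricCoeff g c y).det * F (chartInv c y) := by
  rw [← setIntegral_eq_integral_of_forall_compl_eq_zero h0, riemannianVolume_restrict, chartVolume,
    integral_map ((aemeasurable_chartInv c).mono_ac (withDensity_absolutelyContinuous _ _))
      hF.aestronglyMeasurable,
    integral_withDensity_eq_integral_toReal_smul₀ (aemeasurable_density g c)
      (Filter.Eventually.of_forall fun _ => ENNReal.ofReal_lt_top)]
  refine integral_congr_ae (Filter.Eventually.of_forall fun y => ?_)
  simp only [smul_eq_mul, ENNReal.toReal_ofReal (Real.sqrt_nonneg _)]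

end Measure

/-! ### Supports, cut-offs and the pairing of forms -/

section Pairing
variable {n : ℕ} {M : Type*} [TopologicalSpace M] [ChartedSpace (Euc n) M]
  [IsManifold (𝓡 n) ∞ M]

theorem contDiffOn_comp_chartInv {f : M → ℝ} (hf : ContMDiff (𝓡 n) 𝓘(ℝ) ∞ f) (c : M) :
    ContDiffOn ℝ ∞ (fun y => f (chartInv c y)) (chartDom n c) :=
  contMDiffOn_iff_contDiffOn.mp (hf.comp_contMDiffOn (contMDiffOn_extChartAt_symm c))

/-- The product of a smooth function and a form. -/
def smulForm (f : M → ℝ) (hf : ContMDiff (𝓡 n) 𝓘(ℝ) ∞ f) (α : Form n M) : Form n M :=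
  ⟨fun x => f x • α.1 x, fun c => (SmoothOn.smul (contDiffOn_comp_chartInv hf c) (α.2 c)).congr
    fun y _ => by simp [inChart]⟩

/-- The constant function `1` as a form. -/
def oneForm (n : ℕ) (M : Type*) [TopologicalSpace M] [ChartedSpace (Euc n) M]
    [IsManifold (𝓡 n) ∞ M] : Form n M :=
  ⟨fun _ => 1, fun c => (SmoothOn.sum_smul (J := Unit) (h := fun _ _ => 1)
    (fun _ => contDiffOn_const) fun _ => 1).congr fun y _ => by simp [inChart]⟩

theorem coframe_injective {c : M} {y : Euc n} (hy : y ∈ chartDom n c) {x : M}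
    (hx : chartInv c y = x) : Function.Injective (coframe (n := n) c x) := by
  subst hx
  exact Function.LeftInverse.injective (g := frame c y)
    fun v => DFunLike.congr_fun (frame_comp_coframe hy) v

/-- The fibre of `Λ^*T^*M` at a point is spanned by products of differentials of functions, so
every exterior form at a point is the value of a global form. -/
theorem exists_form_apply_eq [T2Space M] (x : M) (w : Ext (TangentSpace (𝓡 n) x)) :
    ∃ α : Form n M, α.1 x = w := by
  induction w using covec_induction with
  | h1 => exact ⟨oneForm n M, rfl⟩
  | hadd a b ha hb =>
    obtain ⟨α, rfl⟩ := ha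
    obtain ⟨β, rfl⟩ := hb
    exact ⟨α + β, rfl⟩
  | hsmul r a ha =>
    obtain ⟨α, rfl⟩ := ha
    exact ⟨r • α, rfl⟩
  | hmul ξ a ha =>
    obtain ⟨α, rfl⟩ := ha
    have hx := mem_chartDom_self (n := n) x
    obtain ⟨ξ', hξ'⟩ := LinearMap.dualMap_surjective_of_injective
      (coframe_injective hx (chartInv_extChartAt x (mem_extChartAt_source x))) ξ
    -- A linear function of the coordinates with differential `ξ`, cut off to a global function.
    let χ : SmoothBumpFunction (𝓡 n) x := Classical.arbitrary _
    set L : Euc n →L[ℝ] ℝ := LinearMap.toContinuousLinearMap ξ' with hL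
    have hs : ContMDiff (𝓡 n) 𝓘(ℝ) ∞ fun z => χ z • L (extChartAt (𝓡 n) x z) :=
      χ.contMDiff_smul (L.contMDiff.comp_contMDiffOn contMDiffOn_extChartAt)
    have hev : inChart x (smulForm _ hs (oneForm n M)).1 =ᶠ[nhds (extChartAt (𝓡 n) x x)]
        fun y => L y • (1 : Ext (Euc n)) := by
      have h1 : ∀ᶠ y in nhds (extChartAt (𝓡 n) x x), χ (chartInv x y) = 1 := by
        have hc : ContinuousAt (chartInv x) (extChartAt (𝓡 n) x x) := continuousAt_extChartAt_symm x
        rw [ContinuousAt, chartInv_extChartAt x (mem_extChartAt_source x)] at hc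
        exact hc.eventually χ.eventuallyEq_one
      filter_upwards [h1, (isOpen_chartDom x).mem_nhds hx] with y hy hyd
      rw [inChart]
      change pullback (frame x y) ((χ (chartInv x y) • L (extChartAt (𝓡 n) x (chartInv x y))) •
        (1 : Ext _)) = _
      rw [map_smul, map_one, hy, one_smul, (extChartAt (𝓡 n) x).right_inv hyd]
    refine ⟨wedge (deRham n M (smulForm _ hs (oneForm n M))) α, ?_⟩
    change roughD (smulForm _ hs (oneForm n M)).1 x * α.1 x = _
    rw [roughD, extD_congr hev, extD_smul_one L.differentiableAt, L.fderiv, pullback_covec, ← hξ']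
    rfl

omit [IsManifold (𝓡 n) ∞ M] in
theorem hasCompactFormSupport_of_subset [T2Space M] {α : Form n M} {K : Set M} (hK : IsCompact K)
    (h : ∀ x ∉ K, α.1 x = 0) : HasCompactFormSupport α :=
  hK.of_isClosed_subset isClosed_closure (closure_minimal
    (fun x hx => by_contra fun hxK => hx (h x hxK)) hK.isClosed)

omit [IsManifold (𝓡 n) ∞ M] in
theorem eq_zero_of_notMem_closure {α : Form n M} {x : M} (hx : x ∉ closure {x | α.1 x ≠ 0}) :
    α.1 x = 0 := by
  by_contra h
  exact hx (subset_closure h)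

omit [IsManifold (𝓡 n) ∞ M] in
/-- A form vanishing off a closed set vanishes near the other points, also in charts. -/
theorem inChart_eventuallyEq_zero {α : Form n M} {K : Set M} (hK : IsClosed K)
    (h : ∀ x ∉ K, α.1 x = 0) {c : M} {y : Euc n} (hy : y ∈ chartDom n c) (hyK : chartInv c y ∉ K) :
    inChart c α.1 =ᶠ[nhds y] fun _ => 0 := by
  filter_upwards [(isOpen_chartInv_preimage c hK.isOpen_compl).mem_nhds ⟨hyK, hy⟩] with z hz
  rw [inChart, h _ hz.1, map_zero]

theorem hasCompactFormSupport_smulForm [T2Space M] {f : M → ℝ}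
    (hf : ContMDiff (𝓡 n) 𝓘(ℝ) ∞ f) (hc : HasCompactSupport f) (α : Form n M) :
    HasCompactFormSupport (smulForm f hf α) :=
  hasCompactFormSupport_of_subset hc fun x hx => by
    change f x • α.1 x = 0
    rw [image_eq_zero_of_notMem_tsupport hx, zero_smul]

theorem deRham_eq_zero {α : Form n M} {K : Set M} (hK : IsClosed K) (h : ∀ x ∉ K, α.1 x = 0)
    {x : M} (hx : x ∉ K) : (deRham n M α).1 x = 0 := by
  change roughD α.1 x = 0
  have h1 := inChart_eventuallyEq_zero hK h (mem_chartDom_self (n := n) x)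
    (by rwa [chartInv_extChartAt x (mem_extChartAt_source x)])
  rw [roughD, extD_congr h1, extD_const, map_zero]

theorem hasCompactFormSupport_deRham [T2Space M] {α : Form n M} (h : HasCompactFormSupport α) :
    HasCompactFormSupport (deRham n M α) :=
  hasCompactFormSupport_of_subset h fun _ hx =>
    deRham_eq_zero isClosed_closure (fun _ => eq_zero_of_notMem_closure) hx

omit [IsManifold (𝓡 n) ∞ M] in
theorem hasCompactFormSupport_zero [T2Space M] : HasCompactFormSupport (0 : Form n M) :=
  hasCompactFormSupport_of_subset isCompact_empty fun _ _ => rfl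

omit [IsManifold (𝓡 n) ∞ M] in
theorem HasCompactFormSupport.add [T2Space M] {α β : Form n M} (hα : HasCompactFormSupport α)
    (hβ : HasCompactFormSupport β) : HasCompactFormSupport (α + β) :=
  hasCompactFormSupport_of_subset (hα.union hβ) fun x hx => by
    change α.1 x + β.1 x = 0
    rw [eq_zero_of_notMem_closure fun h => hx (Or.inl h),
      eq_zero_of_notMem_closure fun h => hx (Or.inr h), add_zero]

omit [IsManifold (𝓡 n) ∞ M] in
theorem HasCompactFormSupport.smul [T2Space M] {α : Form n M} (hα : HasCompactFormSupport α)
    (r : ℝ) : HasCompactFormSupport (r • α) :=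
  hasCompactFormSupport_of_subset hα fun x hx => by
    change r • α.1 x = 0
    rw [eq_zero_of_notMem_closure hx, smul_zero]

/-- The pointwise inner product of two forms. -/
def pairing (g : SmoothMetric n M) (a b : RoughForm n M) (x : M) : ℝ :=
  extInner (sharp g x).toLinearMap (a x) (b x)

theorem continuousOn_pairing (g : SmoothMetric n M) {a b : RoughForm n M} {c : M}
    (ha : SmoothOn (inChart c a) (chartDom n c)) (hb : SmoothOn (inChart c b) (chartDom n c)) :
    ContinuousOn (pairing g a b) (extChartAt (𝓡 n) c).source := by
  have h1 : ContinuousOn (fun x => extInner (raise (metricCoeff g c) (extChartAt (𝓡 n) c x))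
      (inChart c a (extChartAt (𝓡 n) c x)) (inChart c b (extChartAt (𝓡 n) c x)))
      (extChartAt (𝓡 n) c).source :=
    ((isLocalMetric g c).contDiffOn_extInner ha hb).continuousOn.comp (continuousOn_extChartAt c)
      fun x hx => (extChartAt (𝓡 n) c).map_source hx
  refine h1.congr fun x hx => ?_
  change _ = extInner _ _ _
  rw [extInner_inChart g ((extChartAt (𝓡 n) c).map_source hx), chartInv_extChartAt c hx]
  rfl

theorem continuous_pairing (g : SmoothMetric n M) (α β : Form n M) :
    Continuous (pairing g α.1 β.1) :=
  continuous_iff_continuousAt.mpr fun x => (continuousOn_pairing g (α.2 x) (β.2 x)).continuousAt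
    (extChartAt_source_mem_nhds x)

theorem pairing_eq_zero (g : SmoothMetric n M) {a b : RoughForm n M} {x : M}
    (h : a x = 0 ∨ b x = 0) : pairing g a b x = 0 := by
  rcases h with h | h
  · rw [pairing, h, extInner_zero_left]
  · rw [pairing, h, extInner_zero_right]

theorem hasCompactSupport_pairing [T2Space M] (g : SmoothMetric n M) {α β : Form n M}
    (h : HasCompactFormSupport α ∨ HasCompactFormSupport β) :
    HasCompactSupport (pairing g α.1 β.1) := by
  rcases h with h | h
  · exact HasCompactSupport.intro h fun x hx =>
      pairing_eq_zero g (Or.inl (eq_zero_of_notMem_closure hx))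
  · exact HasCompactSupport.intro h fun x hx =>
      pairing_eq_zero g (Or.inr (eq_zero_of_notMem_closure hx))

variable [MeasurableSpace M] [BorelSpace M]

theorem integrable_pairing [T2Space M] (g : SmoothMetric n M) {α β : Form n M}
    (h : HasCompactFormSupport α ∨ HasCompactFormSupport β) :
    Integrable (pairing g α.1 β.1) (riemannianVolume g) := by
  have := riemannianVolume_isLocallyFinite g
  exact (continuous_pairing g α β).integrable_of_hasCompactSupport (hasCompactSupport_pairing g h)

omit [BorelSpace M] in
theorem formInner_symm (g : SmoothMetric n M) (α β : Form n M) :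
    formInner g α β = formInner g β α :=
  integral_congr_ae (Filter.Eventually.of_forall fun x => extInner_symm (sharp_symm g x) _ _)

theorem formInner_add_left [T2Space M] (g : SmoothMetric n M) {α α' β : Form n M}
    (h : HasCompactFormSupport α ∨ HasCompactFormSupport β)
    (h' : HasCompactFormSupport α' ∨ HasCompactFormSupport β) :
    formInner g (α + α') β = formInner g α β + formInner g α' β := by
  refine Eq.trans ?_ (integral_add (integrable_pairing g h) (integrable_pairing g h'))
  exact integral_congr_ae (Filter.Eventually.of_forall fun x => extInner_add_left _ _ _ _)

theorem formInner_add_right [T2Space M] (g : SmoothMetric n M) {α β β' : Form n M}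
    (h : HasCompactFormSupport β ∨ HasCompactFormSupport α)
    (h' : HasCompactFormSupport β' ∨ HasCompactFormSupport α) :
    formInner g α (β + β') = formInner g α β + formInner g α β' := by
  rw [formInner_symm, formInner_add_left g h h', formInner_symm g β, formInner_symm g β']

omit [BorelSpace M] in
theorem formInner_smul_left (g : SmoothMetric n M) (r : ℝ) (α β : Form n M) :
    formInner g (r • α) β = r * formInner g α β := by
  refine Eq.trans ?_ (integral_const_mul r _)
  exact integral_congr_ae (Filter.Eventually.of_forall fun x => extInner_smul_left _ _ _ _)

omit [BorelSpace M] in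
theorem formInner_smul_right (g : SmoothMetric n M) (r : ℝ) (α β : Form n M) :
    formInner g α (r • β) = r * formInner g α β := by
  rw [formInner_symm, formInner_smul_left, formInner_symm]

/-- A form is determined by its inner products with compactly supported forms. -/
theorem form_eq_of_formInner_eq [T2Space M] (g : SmoothMetric n M) {β β' : Form n M}
    (h : ∀ α, HasCompactFormSupport α → formInner g α β = formInner g α β') : β = β' := by
  by_contra hne
  obtain ⟨x, hx⟩ : ∃ x, (β - β').1 x ≠ 0 := by
    by_contra! hall
    exact hne (sub_eq_zero.mp (Subtype.ext (funext hall)))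
  -- Pair the difference `γ` with `χ γ`, for a bump function `χ` at a point where `γ ≠ 0`.
  let χ : SmoothBumpFunction (𝓡 n) x := Classical.arbitrary _
  set γ := β - β' with hγ
  set α := smulForm χ χ.contMDiff γ with hα
  have hcomp : HasCompactFormSupport α :=
    hasCompactFormSupport_smulForm χ.contMDiff χ.hasCompactSupport γ
  have h1 : formInner g α γ = 0 := by
    rw [hγ, sub_eq_add_neg, ← neg_one_smul ℝ β', formInner_add_right g (Or.inr hcomp)
      (Or.inr hcomp), formInner_smul_right, h α hcomp]
    ring
  have := riemannianVolume_isLocallyFinite g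
  have := riemannianVolume_isOpenPos g
  have hval : ∀ z, pairing g α.1 γ.1 z = χ z * extInner (sharp g z).toLinearMap (γ.1 z) (γ.1 z) :=
    fun z => extInner_smul_left _ _ _ _
  have h2 : 0 < ∫ z, pairing g α.1 γ.1 z ∂(riemannianVolume g) := by
    refine (continuous_pairing g α γ).integral_pos_of_hasCompactSupport_nonneg_nonzero
      (hasCompactSupport_pairing g (Or.inl hcomp)) (x := x) (fun z => ?_) ?_
    · rw [hval]
      rcases eq_or_ne (γ.1 z) 0 with h0 | h0
      · rw [h0, extInner_zero_left, mul_zero]; rfl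
      · exact mul_nonneg χ.nonneg (extInner_sharp_self_pos g z h0).le
    · rw [hval, χ.eq_one, one_mul]
      exact (extInner_sharp_self_pos g x hx).ne'
  exact h2.ne' h1

end Pairing

/-! ### The codifferential -/

/-- The integral of a derivative of a compactly supported function vanishes. -/
theorem integral_fderiv_eq_zero {E : Type*} [NormedAddCommGroup E] [NormedSpace ℝ E]
    [FiniteDimensional ℝ E] [MeasurableSpace E] [BorelSpace E] (μ : Measure E)
    [μ.IsAddHaarMeasure] {f : E → ℝ} (hf : ContDiff ℝ 1 f) (hc : HasCompactSupport f) (v : E) :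
    ∫ x, fderiv ℝ f x v ∂μ = 0 := by
  have h := integral_mul_fderiv_eq_neg_fderiv_mul_of_integrable (μ := μ) (f := fun _ : E => (1 : ℝ))
    (g := f) (v := v) (by simp) ?_ ?_ (fun x _ => differentiableAt_const _)
    fun x _ => (hf.differentiable (by simp)).differentiableAt
  · simpa using h
  · simp only [one_mul]
    exact ((hf.continuous_fderiv (by simp)).clm_apply
      continuous_const).integrable_of_hasCompactSupport (hc.fderiv_apply (𝕜 := ℝ) v)
  · simp only [one_mul]
    exact hf.continuous.integrable_of_hasCompactSupport hc

/-- The divergence theorem for a vector field with compact support in an open set. -/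
theorem setIntegral_sum_fderiv_eq_zero {n : ℕ} {U K : Set (Euc n)} (hU : IsOpen U)
    (hK : IsCompact K) (hKU : K ⊆ U) {X : Fin n → Euc n → ℝ} (hX : ∀ i, ContDiffOn ℝ ∞ (X i) U)
    (h0 : ∀ i, ∀ y ∈ U, y ∉ K → X i y = 0) :
    ∫ y in U, ∑ i, fderiv ℝ (X i) y (stdVec i) = 0 := by
  classical
  -- Extended by zero, the components of `X` are smooth on all of `ℝⁿ`.
  set Y : Fin n → Euc n → ℝ := fun i => U.indicator (X i) with hY
  have hin : ∀ i, ∀ y ∈ U, Y i =ᶠ[nhds y] X i := fun i y hy => by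
    filter_upwards [hU.mem_nhds hy] with z hz using Set.indicator_of_mem hz _
  have hY0 : ∀ i, ∀ y ∉ K, Y i y = 0 := fun i y hy => by
    by_cases hyU : y ∈ U
    · rw [(hin i y hyU).eq_of_nhds, h0 i y hyU hy]
    · exact Set.indicator_of_notMem hyU _
  have hout : ∀ i, ∀ y ∉ K, Y i =ᶠ[nhds y] fun _ => 0 := fun i y hy => by
    filter_upwards [hK.isClosed.isOpen_compl.mem_nhds hy] with z hz using hY0 i z hz
  have hsm : ∀ i, ContDiff ℝ 1 (Y i) := fun i => contDiff_iff_contDiffAt.mpr fun y => by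
    by_cases hy : y ∈ K
    · exact ((((hX i).contDiffAt (hU.mem_nhds (hKU hy))).of_le
        ENat.LEInfty.out).congr_of_eventuallyEq (hin i y (hKU hy)))
    · exact contDiffAt_const.congr_of_eventuallyEq (hout i y hy)
  have hcs : ∀ i, HasCompactSupport (Y i) := fun i => HasCompactSupport.intro hK (hY0 i)
  have h1 : ∫ y in U, ∑ i, fderiv ℝ (X i) y (stdVec i) =
      ∫ y in U, ∑ i, fderiv ℝ (Y i) y (stdVec i) :=
    setIntegral_congr_fun hU.measurableSet fun y hy =>
      Finset.sum_congr rfl fun i _ => by rw [(hin i y hy).fderiv_eq]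
  rw [h1, setIntegral_eq_integral_of_forall_compl_eq_zero, integral_finsetSum]
  · exact Finset.sum_eq_zero fun i _ => integral_fderiv_eq_zero volume (hsm i) (hcs i) _
  · exact fun i _ => (((hsm i).continuous_fderiv (by simp)).clm_apply
      continuous_const).integrable_of_hasCompactSupport ((hcs i).fderiv_apply (𝕜 := ℝ) _)
  · intro y hy
    refine Finset.sum_eq_zero fun i _ => ?_
    rw [(hout i y fun h => hy (hKU h)).fderiv_eq, fderiv_fun_const]
    rfl

/-- Adjointness of `d` and `d^*` on an open subset of `ℝⁿ`. -/
theorem IsLocalMetric.setIntegral_extInner_sub_eq_zero {n : ℕ}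
    {G : Euc n → Matrix (Fin n) (Fin n) ℝ} {U K : Set (Euc n)} (hG : IsLocalMetric G U)
    (hK : IsCompact K) (hKU : K ⊆ U) {f h : Euc n → Ext (Euc n)} (hf : SmoothOn f U)
    (hh : SmoothOn h U) (h0 : ∀ y ∈ U, y ∉ K → f y = 0 ∨ h y = 0) :
    ∫ y in U, √(G y).det * (extInner (raise G y) (extD f y) (h y) -
      extInner (raise G y) (f y) (localCodiff G h y)) = 0 := by
  set X : Fin n → Euc n → ℝ := fun i z => √(G z).det *
    extInner (raise G z) (f z) (interior (raise G z (stdCovec i)) (h z)) with hX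
  have hdet : ContDiffOn ℝ ∞ (fun z => √(G z).det) U :=
    (contDiffOn_det hG.smooth).sqrt fun y hy => (hG.det_pos y hy).ne'
  have key := setIntegral_sum_fderiv_eq_zero hG.isOpen hK hKU (X := X)
    (fun i => hdet.mul (hG.contDiffOn_extInner hf (hG.smoothOn_interior_raise hh _)))
    (fun i y hy hyK => by
      rcases h0 y hy hyK with h3 | h3
      · simp only [hX, h3, extInner_zero_left, mul_zero]
      · simp only [hX, h3, map_zero, extInner_zero_right, mul_zero])
  refine (setIntegral_congr_fun hG.isOpen.measurableSet fun y hy => ?_).trans key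
  exact (hG.sum_fderiv_sqrt_det_mul hy (hf.diffAt hG.isOpen hy) (hh.diffAt hG.isOpen hy)).symm

section Codifferential
variable {n : ℕ} {M : Type*} [TopologicalSpace M] [ChartedSpace (Euc n) M]
  [IsManifold (𝓡 n) ∞ M]

open Classical in
/-- The codifferential of `β` in the domain of the chart at `c`, computed in this chart, and zero
elsewhere. -/
def chartCodiff (g : SmoothMetric n M) (c : M) (β : Form n M) : RoughForm n M := fun x =>
  if x ∈ (extChartAt (𝓡 n) c).source then
    pullback (coframe c x) (localCodiff (metricCoeff g c) (inChart c β.1) (extChartAt (𝓡 n) c x))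
  else 0

theorem inChart_chartCodiff (g : SmoothMetric n M) {c : M} (β : Form n M) {y : Euc n}
    (hy : y ∈ chartDom n c) : inChart c (chartCodiff g c β) y =
      localCodiff (metricCoeff g c) (inChart c β.1) y := by
  rw [inChart, chartCodiff, if_pos ((extChartAt (𝓡 n) c).map_target hy), ← pullback_comp,
    coframe_comp_frame hy, pullback_id, (extChartAt (𝓡 n) c).right_inv hy]

theorem smoothOn_chartCodiff (g : SmoothMetric n M) (c : M) (β : Form n M) :
    SmoothOn (inChart c (chartCodiff g c β)) (chartDom n c) :=
  ((isLocalMetric g c).smoothOn_localCodiff (β.2 c)).congr fun _ hy => inChart_chartCodiff g β hy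

theorem chartCodiff_eq_zero (g : SmoothMetric n M) {β : Form n M} {K : Set M} (hK : IsClosed K)
    (h : ∀ x ∉ K, β.1 x = 0) (c : M) {x : M} (hxK : x ∉ K) : chartCodiff g c β x = 0 := by
  rw [chartCodiff]
  split_ifs with hx
  · have h1 := inChart_eventuallyEq_zero hK h ((extChartAt (𝓡 n) c).map_source hx)
      (by rwa [chartInv_extChartAt c hx])
    rw [localCodiff_congr h1, localCodiff_zero, map_zero]
  · rfl

variable [T2Space M]

theorem continuous_pairing_chartCodiff (g : SmoothMetric n M) {α β : Form n M} {c : M} {K : Set M}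
    (hK : IsCompact K) (hKc : K ⊆ (extChartAt (𝓡 n) c).source)
    (h : (∀ x ∉ K, α.1 x = 0) ∨ (∀ x ∉ K, β.1 x = 0)) :
    Continuous (pairing g α.1 (chartCodiff g c β)) := by
  refine (continuousOn_pairing g (α.2 c) (smoothOn_chartCodiff g c β)).continuous_of_tsupport_subset
    (isOpen_extChartAt_source c)
    (Set.Subset.trans (closure_minimal (fun x hx => ?_) hK.isClosed) hKc)
  by_contra hxK
  exact hx (pairing_eq_zero g (h.imp (fun h => h x hxK)
    fun h => chartCodiff_eq_zero g hK.isClosed h c hxK))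

variable [MeasurableSpace M] [BorelSpace M]

/-- Adjointness of `d` and `d^*` for forms one of which is supported in a chart. -/
theorem formInner_deRham_chart (g : SmoothMetric n M) {α β : Form n M} {c : M} {K : Set M}
    (hK : IsCompact K) (hKc : K ⊆ (extChartAt (𝓡 n) c).source)
    (h : (∀ x ∉ K, α.1 x = 0) ∨ (∀ x ∉ K, β.1 x = 0)) :
    formInner g (deRham n M α) β =
      ∫ x, pairing g α.1 (chartCodiff g c β) x ∂(riemannianVolume g) := by
  have hG := isLocalMetric g c
  have h1 : ∀ x ∉ K, pairing g (deRham n M α).1 β.1 x = 0 := fun x hx =>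
    pairing_eq_zero g (h.imp (fun h => deRham_eq_zero hK.isClosed h hx) fun h => h x hx)
  have h2 : ∀ x ∉ K, pairing g α.1 (chartCodiff g c β) x = 0 := fun x hx =>
    pairing_eq_zero g (h.imp (fun h => h x hx) fun h => chartCodiff_eq_zero g hK.isClosed h c hx)
  have hc1 := continuous_pairing g (deRham n M α) β
  have hc2 := continuous_pairing_chartCodiff g hK hKc h
  have := riemannianVolume_isLocallyFinite g
  have hi1 : Integrable _ (riemannianVolume g) :=
    hc1.integrable_of_hasCompactSupport (HasCompactSupport.intro hK h1)
  have hi2 : Integrable _ (riemannianVolume g) :=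
    hc2.integrable_of_hasCompactSupport (HasCompactSupport.intro hK h2)
  refine sub_eq_zero.mp ((integral_sub hi1 hi2).symm.trans ?_)
  refine (integral_riemannianVolume g c (hc1.sub hc2) fun x hx => ?_).trans ?_
  · rw [Pi.sub_apply, h1 x fun hxK => hx (hKc hxK), h2 x fun hxK => hx (hKc hxK), sub_zero]
  have hKim : IsCompact (extChartAt (𝓡 n) c '' K) :=
    hK.image_of_continuousOn ((continuousOn_extChartAt c).mono hKc)
  refine (setIntegral_congr_fun (isOpen_chartDom c).measurableSet fun y hy => ?_).trans
    (hG.setIntegral_extInner_sub_eq_zero hKim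
      (by rintro _ ⟨x, hx, rfl⟩; exact (extChartAt (𝓡 n) c).map_source (hKc hx))
      (α.2 c) (β.2 c) fun y hy hyK => ?_)
  · change _ * (pairing g (deRham n M α).1 β.1 _ - pairing g α.1 (chartCodiff g c β) _) = _
    rw [pairing, pairing, ← extInner_inChart g hy, ← extInner_inChart g hy, inChart_deRham α hy,
      inChart_chartCodiff g β hy]
  · have hyK' : chartInv c y ∉ K := fun hK' => hyK ⟨_, hK', (extChartAt (𝓡 n) c).right_inv hy⟩
    exact h.imp (fun h => by rw [inChart, h _ hyK', map_zero])
      fun h => by rw [inChart, h _ hyK', map_zero]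

/-- The codifferentials of two charts agree on the overlap, since both represent the functional
`α ↦ (dα, β)` on forms supported there. -/
theorem chartCodiff_eq (g : SmoothMetric n M) (β : Form n M) {c c' x : M}
    (hx : x ∈ (extChartAt (𝓡 n) c).source) (hx' : x ∈ (extChartAt (𝓡 n) c').source) :
    chartCodiff g c β x = chartCodiff g c' β x := by
  by_contra hne
  set γ := chartCodiff g c β x - chartCodiff g c' β x with hγ
  obtain ⟨α, hα⟩ := exists_form_apply_eq x γ
  set W := (extChartAt (𝓡 n) c).source ∩ (extChartAt (𝓡 n) c').source with hW
  have hWo : IsOpen W := (isOpen_extChartAt_source c).inter (isOpen_extChartAt_source c')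
  set u : M → ℝ := fun z =>
    pairing g α.1 (chartCodiff g c β) z - pairing g α.1 (chartCodiff g c' β) z with hu
  have huc : ContinuousOn u W :=
    ((continuousOn_pairing g (α.2 c) (smoothOn_chartCodiff g c β)).mono Set.inter_subset_left).sub
      ((continuousOn_pairing g (α.2 c') (smoothOn_chartCodiff g c' β)).mono Set.inter_subset_right)
  have hux : 0 < u x := by
    have h := extInner_sharp_self_pos g x (sub_ne_zero.mpr hne)
    rw [← hγ, hγ, extInner_sub_right, ← hγ, ← hα] at h
    exact h
  have hV : IsOpen (W ∩ u ⁻¹' Set.Ioi 0) := huc.isOpen_inter_preimage hWo isOpen_Ioi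
  -- Otherwise `u > 0` near `x`, and `α` cut off there pairs differently with the two expressions,
  -- although both pairings are equal to `(d(χ α), β)`.
  obtain ⟨χ, -, hχ⟩ := (SmoothBumpFunction.nhds_basis_tsupport (I := 𝓡 n) x).mem_iff.mp
    (hV.mem_nhds ⟨⟨hx, hx'⟩, hux⟩)
  set a := smulForm χ χ.contMDiff α with ha
  have ha0 : ∀ z ∉ tsupport χ, a.1 z = 0 := fun z hz => by
    change χ z • α.1 z = 0
    rw [image_eq_zero_of_notMem_tsupport hz, zero_smul]
  have hK : IsCompact (tsupport χ) := χ.hasCompactSupport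
  have hsub : tsupport χ ⊆ W := hχ.trans Set.inter_subset_left
  have e1 := formInner_deRham_chart g (β := β) hK (hsub.trans Set.inter_subset_left) (Or.inl ha0)
  have e2 := formInner_deRham_chart g (β := β) hK (hsub.trans Set.inter_subset_right) (Or.inl ha0)
  have c1 := continuous_pairing_chartCodiff g (β := β) hK (hsub.trans Set.inter_subset_left)
    (Or.inl ha0)
  have c2 := continuous_pairing_chartCodiff g (β := β) hK (hsub.trans Set.inter_subset_right)
    (Or.inl ha0)
  have z : ∀ c, ∀ z ∉ tsupport χ, pairing g a.1 (chartCodiff g c β) z = 0 := fun c z hz =>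
    pairing_eq_zero g (Or.inl (ha0 z hz))
  have := riemannianVolume_isLocallyFinite g
  have := riemannianVolume_isOpenPos g
  have i1 : Integrable _ (riemannianVolume g) :=
    c1.integrable_of_hasCompactSupport (HasCompactSupport.intro hK (z c))
  have i2 : Integrable _ (riemannianVolume g) :=
    c2.integrable_of_hasCompactSupport (HasCompactSupport.intro hK (z c'))
  have hval : ∀ t, pairing g a.1 (chartCodiff g c β) t - pairing g a.1 (chartCodiff g c' β) t =
      χ t * u t := fun t => by
    have h1 : ∀ b : RoughForm n M, pairing g a.1 b t = χ t * pairing g α.1 b t := fun b =>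
      extInner_smul_left _ _ _ _
    rw [h1, h1, ← mul_sub]
  have hzero := integral_sub i1 i2
  rw [← e1, ← e2, sub_self] at hzero
  refine (Continuous.integral_pos_of_hasCompactSupport_nonneg_nonzero (x := x) (c1.sub c2)
    (HasCompactSupport.intro hK fun t ht => ?_) (fun t => ?_) ?_).ne' hzero
  · rw [Pi.sub_apply, z c t ht, z c' t ht, sub_zero]
  · rw [Pi.sub_apply, hval]
    by_cases ht : t ∈ tsupport χ
    · exact mul_nonneg χ.nonneg (le_of_lt (hχ ht).2)
    · rw [image_eq_zero_of_notMem_tsupport ht, zero_mul]; rfl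
  · rw [Pi.sub_apply, hval, χ.eq_one, one_mul]
    exact hux.ne'

/-- The codifferential at `x`, computed in the coordinates centred at `x`. -/
def roughCodiff (g : SmoothMetric n M) (β : Form n M) : RoughForm n M := fun x =>
  chartCodiff g x β x

theorem roughCodiff_eq (g : SmoothMetric n M) (β : Form n M) {c x : M}
    (hx : x ∈ (extChartAt (𝓡 n) c).source) : roughCodiff g β x = chartCodiff g c β x :=
  chartCodiff_eq g β (mem_extChartAt_source x) hx

theorem inChart_roughCodiff (g : SmoothMetric n M) (β : Form n M) {c : M} {y : Euc n}
    (hy : y ∈ chartDom n c) : inChart c (roughCodiff g β) y =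
      localCodiff (metricCoeff g c) (inChart c β.1) y := by
  rw [← inChart_chartCodiff g β hy, inChart, inChart,
    roughCodiff_eq g β ((extChartAt (𝓡 n) c).map_target hy)]

omit [T2Space M] [MeasurableSpace M] [BorelSpace M] [IsManifold (𝓡 n) ∞ M] in
theorem inChart_add (a b : RoughForm n M) (c : M) (y : Euc n) :
    inChart c (a + b) y = inChart c a y + inChart c b y :=
  map_add (pullback (frame c y)) _ _

omit [T2Space M] [MeasurableSpace M] [BorelSpace M] [IsManifold (𝓡 n) ∞ M] in
theorem inChart_smul (r : ℝ) (a : RoughForm n M) (c : M) (y : Euc n) :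
    inChart c (r • a) y = r • inChart c a y :=
  map_smul (pullback (frame c y)) _ _

theorem roughCodiff_add (g : SmoothMetric n M) (α β : Form n M) :
    roughCodiff g (α + β) = roughCodiff g α + roughCodiff g β := by
  refine roughForm_ext fun c y hy => ?_
  have e : inChart c (α + β).1 = fun z => inChart c α.1 z + inChart c β.1 z :=
    funext fun z => inChart_add α.1 β.1 c z
  rw [inChart_roughCodiff g _ hy, inChart_add, inChart_roughCodiff g _ hy,
    inChart_roughCodiff g _ hy, e, localCodiff_add ((α.2 c).diffAt (isOpen_chartDom c) hy)
      ((β.2 c).diffAt (isOpen_chartDom c) hy)]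

theorem roughCodiff_smul (g : SmoothMetric n M) (r : ℝ) (β : Form n M) :
    roughCodiff g (r • β) = r • roughCodiff g β := by
  refine roughForm_ext fun c y hy => ?_
  have e : inChart c (r • β).1 = fun z => r • inChart c β.1 z :=
    funext fun z => inChart_smul r β.1 c z
  rw [inChart_roughCodiff g _ hy, inChart_smul, inChart_roughCodiff g _ hy, e,
    localCodiff_smul ((β.2 c).diffAt (isOpen_chartDom c) hy)]

/-- The codifferential `d^*`, in coordinates `-∑ g^{ij} e_i ⌟ ∇_j`. -/
def codifferential (g : SmoothMetric n M) : Module.End ℝ (Form n M) where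
  toFun β := ⟨roughCodiff g β, fun c => ((isLocalMetric g c).smoothOn_localCodiff (β.2 c)).congr
    fun _ hy => inChart_roughCodiff g β hy⟩
  map_add' α β := Subtype.ext (roughCodiff_add g α β)
  map_smul' r β := Subtype.ext (roughCodiff_smul g r β)

theorem inChart_codifferential (g : SmoothMetric n M) (β : Form n M) {c : M} {y : Euc n}
    (hy : y ∈ chartDom n c) : inChart c (codifferential g β).1 y =
      localCodiff (metricCoeff g c) (inChart c β.1) y := inChart_roughCodiff g β hy

theorem codifferential_eq_zero (g : SmoothMetric n M) {β : Form n M} {K : Set M} (hK : IsClosed K)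
    (h : ∀ x ∉ K, β.1 x = 0) {x : M} (hx : x ∉ K) : (codifferential g β).1 x = 0 :=
  chartCodiff_eq_zero g hK h x hx

theorem formInner_deRham_of_support (g : SmoothMetric n M) {α β : Form n M} {c : M} {K : Set M}
    (hK : IsCompact K) (hKc : K ⊆ (extChartAt (𝓡 n) c).source)
    (h : (∀ x ∉ K, α.1 x = 0) ∨ (∀ x ∉ K, β.1 x = 0)) :
    formInner g (deRham n M α) β = formInner g α (codifferential g β) := by
  rw [formInner_deRham_chart g hK hKc h]
  refine integral_congr_ae (Filter.Eventually.of_forall fun x => ?_)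
  change pairing g α.1 (chartCodiff g c β) x = pairing g α.1 (codifferential g β).1 x
  by_cases hx : x ∈ K
  · rw [pairing, pairing, ← roughCodiff_eq g β (hKc hx)]
    rfl
  · rw [pairing_eq_zero g (h.imp (fun h => h x hx)
        fun h => chartCodiff_eq_zero g hK.isClosed h c hx),
      pairing_eq_zero g (h.imp (fun h => h x hx)
        fun h => codifferential_eq_zero g hK.isClosed h hx)]

omit [MeasurableSpace M] [BorelSpace M] in
/-- A compactly supported form is a finite sum of forms supported in charts. -/
theorem HasCompactFormSupport.exists_sum [SigmaCompactSpace M] {α : Form n M}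
    (hα : HasCompactFormSupport α) : ∃ (s : Finset M) (a : M → Form n M), α = ∑ c ∈ s, a c ∧
      ∀ c ∈ s, ∃ K, IsCompact K ∧ K ⊆ (extChartAt (𝓡 n) c).source ∧ ∀ x ∉ K, (a c).1 x = 0 := by
  obtain ⟨ρ, hρ⟩ := SmoothPartitionOfUnity.exists_isSubordinate (𝓡 n) (isClosed_univ (X := M))
    (fun c : M => (extChartAt (𝓡 n) c).source) (fun c => isOpen_extChartAt_source c)
    fun x _ => Set.mem_iUnion.mpr ⟨x, mem_extChartAt_source x⟩
  set K := closure {x | α.1 x ≠ 0} with hKdef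
  have hK : IsCompact K := hα
  have hfin := ρ.locallyFinite.finite_nonempty_inter_compact hK
  refine ⟨hfin.toFinset, fun c => smulForm (ρ c) (ρ c).contMDiff α, ?_, fun c _ =>
    ⟨K ∩ tsupport (ρ c), hK.inter_right (isClosed_tsupport _),
      Set.inter_subset_right.trans (hρ c), fun x hx => ?_⟩⟩
  · refine Subtype.ext (funext fun x => ?_)
    have h1 : (∑ c ∈ hfin.toFinset, smulForm (ρ c) (ρ c).contMDiff α).1 x =
        (∑ c ∈ hfin.toFinset, ρ c x) • α.1 x := by
      rw [Finset.sum_smul, Submodule.coe_sum, Finset.sum_apply]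
      rfl
    rw [h1]
    by_cases hx : x ∈ K
    · have h2 : ∑ c ∈ hfin.toFinset, ρ c x = 1 := by
        rw [← ρ.sum_eq_one (Set.mem_univ x)]
        refine (finsum_eq_sum_of_support_subset _ fun c hc => ?_).symm
        simp only [Set.Finite.coe_toFinset, Set.mem_ofPred_eq]
        exact ⟨x, hc, hx⟩
      rw [h2, one_smul]
    · rw [eq_zero_of_notMem_closure hx, smul_zero]
  · change ρ c x • α.1 x = 0
    by_cases hxK : x ∈ K
    · rw [image_eq_zero_of_notMem_tsupport fun h => hx ⟨hxK, h⟩, zero_smul]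
    · rw [eq_zero_of_notMem_closure hxK, smul_zero]

theorem hasCompactFormSupport_codifferential (g : SmoothMetric n M) {α : Form n M}
    (h : HasCompactFormSupport α) : HasCompactFormSupport (codifferential g α) :=
  hasCompactFormSupport_of_subset h fun _ hx =>
    codifferential_eq_zero g isClosed_closure (fun _ => eq_zero_of_notMem_closure) hx

omit [T2Space M] [BorelSpace M] in
theorem formInner_zero_left (g : SmoothMetric n M) (β : Form n M) : formInner g 0 β = 0 :=
  integral_eq_zero_of_ae (Filter.Eventually.of_forall fun _ => extInner_zero_left _ _)

omit [T2Space M] [BorelSpace M] in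
theorem formInner_zero_right (g : SmoothMetric n M) (β : Form n M) : formInner g β 0 = 0 :=
  (formInner_symm g β 0).trans (formInner_zero_left g β)

set_option maxHeartbeats 1000000 in
/-- Adjointness of operators that preserve compact supports may be checked on forms one of which is
supported in a chart. -/
theorem isAdjoint_of_support [SigmaCompactSpace M] (g : SmoothMetric n M)
    {P Q : Module.End ℝ (Form n M)}
    (hP : ∀ α, HasCompactFormSupport α → HasCompactFormSupport (P α))
    (hQ : ∀ α, HasCompactFormSupport α → HasCompactFormSupport (Q α))
    (h : ∀ (α β : Form n M) (c : M) (K : Set M), IsCompact K →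
      K ⊆ (extChartAt (𝓡 n) c).source → ((∀ x ∉ K, α.1 x = 0) ∨ (∀ x ∉ K, β.1 x = 0)) →
      formInner g (P α) β = formInner g α (Q β)) : IsAdjoint g P Q := by
  rintro α β (hα | hβ)
  · obtain ⟨s, a, rfl, ha⟩ := hα.exists_sum
    refine (Finset.sum_induction a (fun a => HasCompactFormSupport a ∧
      formInner g (P a) β = formInner g a (Q β)) ?_ ?_ ?_).2
    · rintro a b ⟨ha, ha'⟩ ⟨hb, hb'⟩
      refine ⟨ha.add hb, ?_⟩
      rw [map_add P a b, formInner_add_left g (Or.inl (hP a ha)) (Or.inl (hP b hb)), ha', hb',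
        formInner_add_left g (Or.inl ha) (Or.inl hb)]
    · exact ⟨hasCompactFormSupport_zero, by
        rw [map_zero P, formInner_zero_left, formInner_zero_left]⟩
    · intro c hc
      obtain ⟨K, hK, hKc, h0⟩ := ha c hc
      exact ⟨hasCompactFormSupport_of_subset hK h0, h _ _ c K hK hKc (Or.inl h0)⟩
  · obtain ⟨s, b, rfl, hb⟩ := hβ.exists_sum
    refine (Finset.sum_induction b (fun b => HasCompactFormSupport b ∧
      formInner g (P α) b = formInner g α (Q b)) ?_ ?_ ?_).2
    · rintro a b ⟨ha, ha'⟩ ⟨hb, hb'⟩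
      refine ⟨ha.add hb, ?_⟩
      have e : Q (a + b) = Q a + Q b := map_add Q a b
      have e1 := formInner_add_right g (α := P α) (Or.inl ha) (Or.inl hb)
      have e2 := formInner_add_right g (α := α) (Or.inl (hQ a ha)) (Or.inl (hQ b hb))
      exact e1.trans ((congrArg₂ (· + ·) ha' hb').trans (e2.symm.trans (congrArg _ e.symm)))
    · exact ⟨hasCompactFormSupport_zero, by
        have e : Q 0 = 0 := map_zero Q
        exact (formInner_zero_right g _).trans
          ((congrArg _ e).trans (formInner_zero_right g α)).symm⟩
    · intro c hc
      obtain ⟨K, hK, hKc, h0⟩ := hb c hc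
      exact ⟨hasCompactFormSupport_of_subset hK h0, h _ _ c K hK hKc (Or.inr h0)⟩

/-- The codifferential is adjoint to the exterior derivative. -/
theorem isAdjoint_codifferential [SigmaCompactSpace M] (g : SmoothMetric n M) :
    IsAdjoint g (deRham n M) (codifferential g) :=
  isAdjoint_of_support g (fun _ => hasCompactFormSupport_deRham)
    (fun _ => hasCompactFormSupport_codifferential g)
    fun _ _ _ _ hK hKc h => formInner_deRham_of_support g hK hKc h

end Codifferential

/-! ### Operator algebra -/

section OperatorAlgebra
variable {A : Type*} [Ring A] [Algebra ℝ A] {d δ L Λ D E : A} {s : ℝ}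

/-- If `d` supercommutes with `L` and with `D = ± {δ, L}`, where `s = (-1)^k` is the sign of `L`,
then `L` commutes with `dδ + δd`, by the super Jacobi identity. -/
theorem laplacian_comm_of_superComm (hs : s * s = 1) (hdL : d * L = s • (L * d))
    (hD : D = s • (δ * L - s • (L * δ))) (hdD : d * D + s • (D * d) = 0) :
    (d * δ + δ * d) * L - L * (d * δ + δ * d) = 0 := by
  subst hD
  rcases mul_self_eq_one_iff.mp hs with rfl | rfl
  · simp only [one_smul] at *
    linear_combination (norm := noncomm_ring) hdD + hdL * δ + δ * hdL
  · simp only [neg_one_smul] at *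
    linear_combination (norm := noncomm_ring) - hdD - hdL * δ + δ * hdL

theorem sub_neg_smul (x y : A) (s : ℝ) : x - (-s) • y = x + s • y := by
  rw [neg_smul, sub_neg_eq_add]

omit [Algebra ℝ A] in
theorem sub_eq_zero_swap {x y : A} (h : x - y = 0) : y - x = 0 := by
  rw [← neg_sub, h, neg_zero]

theorem superComm_swap {x y : A} (hs : s * s = 1) (h : x * y + s • (y * x) = 0) :
    y * x + s • (x * y) = 0 := by
  have h' := congrArg (s • ·) h
  simp only [smul_add, smul_smul, hs, one_smul, smul_zero] at h'
  rw [add_comm, h']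

/-- If `d² = 0` then `d` supercommutes with `{d, C}`. -/
theorem superComm_superComm_self {C : A} (hd : d * d = 0) (hD : D = d * C - s • (C * d)) :
    d * D + s • (D * d) = 0 := by
  rw [hD, mul_sub, sub_mul, ← mul_assoc, hd, zero_mul, mul_smul_comm, smul_mul_assoc, mul_assoc C,
    hd, mul_zero, smul_zero, sub_zero, mul_assoc, zero_sub, neg_add_cancel]

theorem superComm_bracket_eq_zero (hs : s * s = 1) (hδ : δ * δ = 0)
    (hD : D = s • (δ * L - s • (L * δ))) : δ * D + s • (D * δ) = 0 := by
  subst hD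
  rcases mul_self_eq_one_iff.mp hs with rfl | rfl
  · simp only [one_smul]
    linear_combination (norm := noncomm_ring) hδ * L - L * hδ
  · simp only [neg_one_smul]
    linear_combination (norm := noncomm_ring) - hδ * L + L * hδ

/-- The super Jacobi identity behind the formula for the twisted Laplacian, where `D = ± {δ, L}` and
`E = ± {Λ, d}`. -/
theorem superComm_bracket_bracket (hs : s * s = 1) (hdL : d * L = s • (L * d))
    (hδΛ : Λ * δ = s • (δ * Λ)) (hD : D = s • (δ * L - s • (L * δ)))
    (hE : E = s • (Λ * d - s • (d * Λ)))
    (hΛ : (d * δ + δ * d) * Λ - Λ * (d * δ + δ * d) = 0) :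
    D * E + s • (E * D) = δ * ((L * Λ - s • (Λ * L)) * d - d * (L * Λ - s • (Λ * L))) +
      ((L * Λ - s • (Λ * L)) * d - d * (L * Λ - s • (Λ * L))) * δ := by
  subst hD hE
  rcases mul_self_eq_one_iff.mp hs with rfl | rfl
  · simp only [one_smul] at *
    linear_combination (norm := noncomm_ring) L * hΛ - hΛ * L + δ * hdL * Λ
      - Λ * hdL * δ + L * hδΛ * d + hdL * Λ * δ + L * d * hδΛ - d * hδΛ * L - hδΛ * L * d
      - Λ * δ * hdL
  · simp only [neg_one_smul] at *
    linear_combination (norm := noncomm_ring) L * hΛ + hΛ * L + δ * hdL * Λ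
      - Λ * hdL * δ + L * hδΛ * d + hdL * Λ * δ - L * d * hδΛ - d * hδΛ * L - hδΛ * L * d
      + Λ * δ * hdL

end OperatorAlgebra

section Adjoints
variable {n : ℕ} {M : Type*} [TopologicalSpace M] [ChartedSpace (Euc n) M]
  [IsManifold (𝓡 n) ∞ M]

/-- Contraction with `Ω`: for `Ω = ξ₁ ∧ ⋯ ∧ ξᵣ` it is `η ↦ ♯ξᵣ ⌟ ⋯ ⌟ ♯ξ₁ ⌟ η`. -/
def contractForm (g : SmoothMetric n M) (Ω : Form n M) : Module.End ℝ (Form n M) where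
  toFun η := ⟨fun x =>
      contraction (sharp g x).toLinearMap (CliffordAlgebra.reverse (Ω.1 x)) (η.1 x),
    fun c => ((isLocalMetric g c).smoothOn_contraction
      ((Ω.2 c).linear CliffordAlgebra.reverse) (η.2 c)).congr fun y hy => by
        rw [inChart, inChart, reverse_pullback]
        exact (contraction_pullback _ (frame_raise g hy) _ _).symm⟩
  map_add' α β := Subtype.ext <| funext fun x => map_add _ (α.1 x) (β.1 x)
  map_smul' r α := Subtype.ext <| funext fun x =>
    (contraction (sharp g x).toLinearMap (CliffordAlgebra.reverse (Ω.1 x))).map_smul r (α.1 x)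

theorem isAdjoint_contractForm [MeasurableSpace M] (g : SmoothMetric n M) (Ω : Form n M) :
    IsAdjoint g (wedge Ω) (contractForm g Ω) := fun α β _ =>
  integral_congr_ae (Filter.Eventually.of_forall fun x =>
    extInner_mul_left _ (Ω.1 x) (α.1 x) (β.1 x))

omit [IsManifold (𝓡 n) ∞ M] in
theorem superComm_eq_sub {a b : ℕ} {s : ℝ} (h : (-1 : ℝ) ^ (a * b) = s)
    (P Q : Module.End ℝ (Form n M)) : superComm a b P Q = P * Q - s • (Q * P) :=
  congrArg (fun t : ℝ => P * Q - t • (Q * P)) h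

omit [IsManifold (𝓡 n) ∞ M] in
theorem superComm_eq_add {a b : ℕ} {s : ℝ} (h : (-1 : ℝ) ^ (a * b) = -s)
    (P Q : Module.End ℝ (Form n M)) : superComm a b P Q = P * Q + s • (Q * P) :=
  (superComm_eq_sub h P Q).trans (sub_neg_smul (P * Q) (Q * P) s)

omit [IsManifold (𝓡 n) ∞ M] in
theorem superComm_eq_commutator {a b : ℕ} (h : (-1 : ℝ) ^ (a * b) = 1)
    (P Q : Module.End ℝ (Form n M)) : superComm a b P Q = P * Q - Q * P :=
  (superComm_eq_sub h P Q).trans (congrArg (P * Q - ·) (one_smul ℝ (Q * P)))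

omit [IsManifold (𝓡 n) ∞ M] in
theorem superComm_eq_anticommutator {a b : ℕ} (h : (-1 : ℝ) ^ (a * b) = -1)
    (P Q : Module.End ℝ (Form n M)) : superComm a b P Q = P * Q + Q * P :=
  (superComm_eq_add h P Q).trans (congrArg (P * Q + ·) (one_smul ℝ (Q * P)))

set_option maxHeartbeats 1000000 in
/-- For a parallel form the twisted de Rham operator is, up to sign, the supercommutator of the
codifferential with the wedge product. -/
theorem twistedD_eq [T2Space M] [MeasurableSpace M] [BorelSpace M] (g : SmoothMetric n M) {k : ℕ}
    {Ω : Form n M} (hdeg : IsHomogeneous Ω k) (hpar : IsParallel g Ω) :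
    twistedD g k Ω = (-1 : ℝ) ^ k •
      (codifferential g * wedge Ω - (-1 : ℝ) ^ k • (wedge Ω * codifferential g)) := by
  refine (superComm_eq_sub (congrArg _ (one_mul k)) (deRham n M) (structureOp g Ω)).trans ?_
  refine LinearMap.ext fun α => form_ext fun c y hy => ?_
  have key := (isLocalMetric g c).extD_structure_sub hy ((Ω.2 c).diffAt (isOpen_chartDom c) hy)
    ((α.2 c).diffAt (isOpen_chartDom c) hy)
    (fun l => (covDeriv_eq_nabla g Ω c y l).symm.trans (hpar c y hy l)) (involute_inChart hdeg c y)
  have e1 : extD (inChart c (structureOp g Ω α).1) y = extD (fun z =>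
      extendDerivation (localSymbol (metricCoeff g c) (inChart c Ω.1) z) (inChart c α.1 z)) y :=
    extD_congr (by
      filter_upwards [(isOpen_chartDom c).mem_nhds hy] with z hz using inChart_structureOp g Ω α hz)
  have e2 : inChart c (wedge Ω α).1 = fun z => inChart c Ω.1 z * inChart c α.1 z :=
    funext fun z => inChart_wedge Ω α c z
  have e3 : ∀ (r : ℝ) (a b : Form n M), inChart c (a - r • b).1 y =
      inChart c a.1 y - r • inChart c b.1 y := fun r a b =>
    (map_sub (pullback (frame c y)) _ _).trans (congrArg _ (map_smul (pullback (frame c y)) _ _))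
  refine (e3 _ (deRham n M (structureOp g Ω α)) (structureOp g Ω (deRham n M α))).trans ?_
  refine Eq.trans ?_ ((inChart_smul _ _ c y).trans (congrArg _
    (e3 _ (codifferential g (wedge Ω α)) (wedge Ω (codifferential g α))))).symm
  rw [inChart_deRham _ hy, inChart_structureOp g Ω _ hy, inChart_deRham α hy, e1, key,
    inChart_codifferential g _ hy, e2, inChart_wedge, inChart_codifferential g α hy]

/-- The operators `P` and `Q` preserve compact supports, and `Q` is adjoint to `P`. -/
structure IsAdjointPair [MeasurableSpace M] (g : SmoothMetric n M)
    (P Q : Module.End ℝ (Form n M)) : Prop where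
  isAdjoint : IsAdjoint g P Q
  left : ∀ α, HasCompactFormSupport α → HasCompactFormSupport (P α)
  right : ∀ α, HasCompactFormSupport α → HasCompactFormSupport (Q α)

variable [T2Space M] [MeasurableSpace M]

theorem IsAdjoint.eq [BorelSpace M] {g : SmoothMetric n M} {P Q Q' : Module.End ℝ (Form n M)}
    (h : IsAdjoint g P Q) (h' : IsAdjoint g P Q') : Q = Q' :=
  LinearMap.ext fun β => form_eq_of_formInner_eq g fun α hα =>
    (h α β (Or.inl hα)).symm.trans (h' α β (Or.inl hα))

theorem IsAdjoint.adjoint_eq [BorelSpace M] {g : SmoothMetric n M}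
    {P Q : Module.End ℝ (Form n M)} (h : IsAdjoint g P Q) : adjoint g P = Q := by
  have hex : ∃ Q, IsAdjoint g P Q := ⟨Q, h⟩
  rw [adjoint, dif_pos hex]
  exact hex.choose_spec.eq h

namespace IsAdjointPair

variable {g : SmoothMetric n M} {P Q P' Q' : Module.End ℝ (Form n M)}

omit [T2Space M] in
theorem symm (h : IsAdjointPair g P Q) : IsAdjointPair g Q P where
  isAdjoint α β hc := ((formInner_symm g _ _).trans (h.isAdjoint β α hc.symm).symm).trans
    (formInner_symm g _ _)
  left := h.right
  right := h.left

omit [T2Space M] in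
theorem mul (h : IsAdjointPair g P Q) (h' : IsAdjointPair g P' Q') :
    IsAdjointPair g (P * P') (Q' * Q) where
  isAdjoint α β hc := (h.isAdjoint (P' α) β (hc.imp_left (h'.left α))).trans
    (h'.isAdjoint α (Q β) (hc.imp_right (h.right β)))
  left α hα := h.left _ (h'.left α hα)
  right α hα := h'.right _ (h.right α hα)

theorem smul (h : IsAdjointPair g P Q) (r : ℝ) : IsAdjointPair g (r • P) (r • Q) where
  isAdjoint α β hc := (formInner_smul_left g r (P α) β).trans
    ((congrArg (r * ·) (h.isAdjoint α β hc)).trans (formInner_smul_right g r α (Q β)).symm)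
  left α hα := (h.left α hα).smul r
  right α hα := (h.right α hα).smul r

theorem add [BorelSpace M] (h : IsAdjointPair g P Q) (h' : IsAdjointPair g P' Q') :
    IsAdjointPair g (P + P') (Q + Q') where
  isAdjoint α β hc :=
    (formInner_add_left g (α := P α) (α' := P' α) (hc.imp_left (h.left α))
      (hc.imp_left (h'.left α))).trans
      ((congrArg₂ (· + ·) (h.isAdjoint α β hc) (h'.isAdjoint α β hc)).trans
        (formInner_add_right g (β := Q β) (β' := Q' β) (hc.symm.imp_left (h.right β))
          (hc.symm.imp_left (h'.right β))).symm)
  left α hα := (h.left α hα).add (h'.left α hα)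
  right α hα := (h.right α hα).add (h'.right α hα)

theorem sub [BorelSpace M] (h : IsAdjointPair g P Q) (h' : IsAdjointPair g P' Q') :
    IsAdjointPair g (P - P') (Q - Q') := by
  have e : ∀ X Y : Module.End ℝ (Form n M), X - Y = X + (-1 : ℝ) • Y := fun X Y =>
    LinearMap.ext fun a => Subtype.ext <| funext fun x => by
      change (X a).1 x - (Y a).1 x = (X a).1 x + (-1 : ℝ) • (Y a).1 x
      rw [neg_one_smul, sub_eq_add_neg]
  rw [e, e]
  exact h.add (h'.smul (-1))

/-- Identities between operators pass to their adjoints. -/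
theorem eq_zero [BorelSpace M] (h : IsAdjointPair g P Q) (hP : P = 0) : Q = 0 := by
  refine h.isAdjoint.eq (Q' := 0) fun α β _ => ?_
  rw [hP]
  exact (formInner_zero_left g β).trans (formInner_zero_right g α).symm

end IsAdjointPair

theorem isAdjointPair_deRham [BorelSpace M] [SigmaCompactSpace M] (g : SmoothMetric n M) :
    IsAdjointPair g (deRham n M) (codifferential g) where
  isAdjoint := isAdjoint_codifferential g
  left _ := hasCompactFormSupport_deRham
  right _ := hasCompactFormSupport_codifferential g

theorem isAdjointPair_wedge (g : SmoothMetric n M) (Ω : Form n M) :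
    IsAdjointPair g (wedge Ω) (contractForm g Ω) where
  isAdjoint := isAdjoint_contractForm g Ω
  left α hα := hasCompactFormSupport_of_subset hα fun x hx => by
    change Ω.1 x * α.1 x = 0
    rw [eq_zero_of_notMem_closure hx, mul_zero]
  right α hα := hasCompactFormSupport_of_subset hα fun x hx => by
    change contraction _ _ (α.1 x) = 0
    rw [eq_zero_of_notMem_closure hx, map_zero]

/-- The adjoint of the twisted de Rham operator of a parallel form. -/
theorem isAdjointPair_twistedD [BorelSpace M] [SigmaCompactSpace M] (g : SmoothMetric n M) {k : ℕ}
    {Ω : Form n M} (hdeg : IsHomogeneous Ω k) (hpar : IsParallel g Ω) :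
    IsAdjointPair g (twistedD g k Ω) ((-1 : ℝ) ^ k •
      (contractForm g Ω * deRham n M - (-1 : ℝ) ^ k • (deRham n M * contractForm g Ω))) := by
  rw [twistedD_eq g hdeg hpar]
  have hd := (isAdjointPair_deRham g).symm
  have hL := isAdjointPair_wedge g Ω
  exact ((hd.mul hL).sub ((hL.mul hd).smul _)).smul _

end Adjoints

end ParallelForm
end

open ParallelForm

theorem mainTheorem3 {n : ℕ} {M : Type*} [TopologicalSpace M]
    [ChartedSpace (EuclideanSpace ℝ (Fin n)) M] [IsManifold (𝓡 n) ∞ M]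
    [T2Space M] [SigmaCompactSpace M] [MeasurableSpace M] [BorelSpace M]
    (g : ParallelForm.SmoothMetric n M) (k : ℕ) (Ω : ParallelForm.Form n M)
    (hdeg : ParallelForm.IsHomogeneous Ω k) (hpar : ParallelForm.IsParallel g Ω) :
    (ParallelForm.IsAdjoint g (ParallelForm.deRham n M) (ParallelForm.codiff g) ∧
      ParallelForm.IsAdjoint g (ParallelForm.twistedD g k Ω) (ParallelForm.twistedCodiff g k Ω) ∧
      ParallelForm.IsAdjoint g (ParallelForm.wedge Ω) (ParallelForm.wedgeAdjoint g Ω)) ∧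
    (ParallelForm.superComm 1 (k + 1)
        (ParallelForm.deRham n M) (ParallelForm.twistedD g k Ω) = 0 ∧
      ParallelForm.superComm 1 (k + 1)
        (ParallelForm.deRham n M) (ParallelForm.twistedCodiff g k Ω) = 0 ∧
      ParallelForm.superComm 1 (k + 1)
        (ParallelForm.codiff g) (ParallelForm.twistedD g k Ω) = 0 ∧
      ParallelForm.superComm 1 (k + 1)
        (ParallelForm.codiff g) (ParallelForm.twistedCodiff g k Ω) = 0) ∧
    (ParallelForm.superComm 0 k (ParallelForm.laplacian g) (ParallelForm.wedge Ω) = 0 ∧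
      ParallelForm.superComm 0 k (ParallelForm.laplacian g) (ParallelForm.wedgeAdjoint g Ω) = 0) ∧
    ParallelForm.twistedLaplacian g k Ω =
      ParallelForm.superComm 1 1 (ParallelForm.codiff g)
        (ParallelForm.superComm 0 1 (ParallelForm.lefschetzH g k Ω) (ParallelForm.deRham n M)) := by
  have hs : (-1 : ℝ) ^ k * (-1 : ℝ) ^ k = 1 := by rw [← mul_pow]; simp
  have hkk : (-1 : ℝ) ^ (k * k) = (-1 : ℝ) ^ k := by
    rcases Nat.even_or_odd k with h | h
    · rw [(h.mul_left k).neg_one_pow, h.neg_one_pow]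
    · rw [(h.mul h).neg_one_pow, h.neg_one_pow]
  have hk1 : (-1 : ℝ) ^ ((k + 1) * (k + 1)) = -(-1 : ℝ) ^ k := by
    rw [show (k + 1) * (k + 1) = k * k + 2 * k + 1 by ring, pow_succ, pow_add, hkk,
      pow_mul (-1 : ℝ) 2 k]
    simp
  have h1k : (-1 : ℝ) ^ (1 * (k + 1)) = -(-1 : ℝ) ^ k := by rw [one_mul, pow_succ, mul_neg_one]
  have hd := isAdjointPair_deRham g
  have hL := isAdjointPair_wedge g Ω
  have hD := isAdjointPair_twistedD g hdeg hpar
  have hDeq := twistedD_eq g hdeg hpar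
  have hDdef : twistedD g k Ω =
      deRham n M * structureOp g Ω - (-1 : ℝ) ^ k • (structureOp g Ω * deRham n M) :=
    superComm_eq_sub (congrArg _ (one_mul k)) _ _
  have hdd := deRham_mul_deRham (n := n) (M := M)
  have hdL := deRham_mul_wedge g hdeg hpar
  simp only [codiff, twistedCodiff, wedgeAdjoint, twistedLaplacian, laplacian, lefschetzH,
    hd.isAdjoint.adjoint_eq, hL.isAdjoint.adjoint_eq, hD.isAdjoint.adjoint_eq]
  have hdD := superComm_superComm_self (A := Module.End ℝ (Form n M)) hdd hDdef
  have hδD := superComm_bracket_eq_zero (A := Module.End ℝ (Form n M)) hs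
    ((hd.mul hd).eq_zero hdd) hDeq
  have hΔL := laplacian_comm_of_superComm (A := Module.End ℝ (Form n M)) hs hdL hDeq hdD
  -- The remaining relations are the adjoints of those above.
  have hδE := superComm_swap (A := Module.End ℝ (Form n M)) hs
    (((hd.mul hD).add ((hD.mul hd).smul _)).eq_zero hdD)
  have hdE := superComm_swap (A := Module.End ℝ (Form n M)) hs
    (((hd.symm.mul hD).add ((hD.mul hd.symm).smul _)).eq_zero hδD)
  have hδΛ := (sub_eq_zero (G := Module.End ℝ (Form n M))).mp
    (((hd.mul hL).sub ((hL.mul hd).smul ((-1 : ℝ) ^ k))).eq_zero (sub_eq_zero.mpr hdL))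
  have hΔ := (hd.mul hd.symm).add (hd.symm.mul hd)
  have hΔΛ := ((hL.mul hΔ).sub (hΔ.mul hL)).eq_zero
    (sub_eq_zero_swap (A := Module.End ℝ (Form n M)) hΔL)
  have hJ := superComm_bracket_bracket (A := Module.End ℝ (Form n M)) hs hdL hδΛ hDeq rfl hΔΛ
  -- The sign of each supercommutator in the statement.
  have e01 : (-1 : ℝ) ^ (0 * 1) = 1 := by norm_num
  have e0k : (-1 : ℝ) ^ (0 * k) = 1 := by simp
  have e11 : (-1 : ℝ) ^ (1 * 1) = -1 := by norm_num
  have hLap := superComm_eq_anticommutator e11 (deRham n M) (codifferential g)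
  have hH := superComm_eq_sub hkk (wedge Ω) (contractForm g Ω)
  have hHd := (congrArg (superComm 0 1 · (deRham n M)) hH).trans
    (superComm_eq_commutator e01 _ _)
  refine ⟨⟨hd.isAdjoint, hD.isAdjoint, hL.isAdjoint⟩,
    ⟨(superComm_eq_add h1k _ _).trans hdD,
      (superComm_eq_add h1k _ _).trans hdE,
      (superComm_eq_add h1k _ _).trans hδD,
      (superComm_eq_add h1k _ _).trans hδE⟩, ⟨?_, ?_⟩, ?_⟩
  · exact (congrArg (superComm 0 k · (wedge Ω)) hLap).trans
      ((superComm_eq_commutator e0k _ _).trans hΔL)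
  · exact (congrArg (superComm 0 k · (contractForm g Ω)) hLap).trans
      ((superComm_eq_commutator e0k _ _).trans hΔΛ)
  · exact (superComm_eq_add hk1 _ _).trans (hJ.trans
      ((congrArg (superComm 1 1 (codifferential g)) hHd).trans
        (superComm_eq_anticommutator e11 _ _)).symm)
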